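/- Let $d\ge 1$, $\mathbb T^d=\mathbb R^d/2\pi\mathbb Z^d$, $V=\mathbb C^{N}$ with $N=2^{\lfloor d/2\rfloor}$, and let $\gamma^1,\dots,\gamma^d$ be any self-adjoint $N\times N$ matrices with $\gamma^\mu\gamma^\nu+\gamma^\nu\gamma^\mu=2\delta^{\mu\nu}$. Let $\mathcal H=L^2(\mathbb T^d)\otimes V$, let the Dirac operator $D$ on $\mathcal H$ be the closure of $-i\sum_{\mu}\partial_\mu\otimes\gamma^\mu$ on smooth $V$-valued functions, and let $C(\mathbb T^d)$ act on $\mathcal H$ by multiplication. For $\Lambda\ge 0$ let $P_\Lambda$ be the orthogonal projection of $\mathcal H$ onto the closed span of the eigenvectors of $D$ with eigenvalues of modulus $\le\Lambda$, let $D_\Lambda=P_\Lambda DP_\Lambda$ on $P_\Lambda\mathcal H$, and let $\mathcal E_\Lambda=P_\Lambda C^\infty(\mathbb T^d)P_\Lambda\subseteq\mathcal B(P_\Lambda\mathcal H)$. A state of a unital $*$-closed subspace of bounded operators is a linear functional that is positive (non-negative on the positive operators in the subspace) and takes the value $1$ at the identity; $\mathcal S(\cdot)$ denotes the set of states. On $\mathcal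 S(\mathcal E_\Lambda)$ and $\mathcal S(C(\mathbb T^d))$ consider the Connes distances $$d_\Lambda(\varphi,\psi)=\sup\{|\varphi(T)-\psi(T)| : T\in\mathcal E_\Lambda,\ \|[D_\Lambda,T]\|=1\},$$ $$d(\varphi,\psi)=\sup\{|\varphi(f)-\psi(f)| : f\in C^\infty(\mathbb T^d),\ \|[D,f]\|=1\},$$ where the supremum of the empty set is $0$. Then $(\mathcal S(\mathcal E_\Lambda),d_\Lambda)$, for every $\Lambda\ge 0$, and $(\mathcal S(C(\mathbb T^d)),d)$ are nonempty compact metric spaces, and $(\mathcal S(\mathcal E_\Lambda),d_\Lambda)$ converges to $(\mathcal S(C(\mathbb T^d)),d)$ in the Gromov–Hausdorff distance as $\Lambda\to\infty$. -/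

import Mathlib

open MeasureTheory Filter Topology
open scoped Real ENNReal NNReal ContDiff

noncomputable section

namespace SpectralTruncation

/-! ### Operator systems, state spaces, Connes' distance, spectral compressions -/

section Abstract

variable {H : Type*} [NormedAddCommGroup H] [InnerProductSpace ℂ H] [CompleteSpace H]

/-- A concrete operator system: a unital `*`-closed linear subspace of the bounded operators. -/
structure OperatorSystem (H : Type*) [NormedAddCommGroup H] [InnerProductSpace ℂ H]
    [CompleteSpace H] extends Submodule ℂ (H →L[ℂ] H) where
  one_mem' : (1 : H →L[ℂ] H) ∈ carrier
  star_mem' : ∀ {a : H →L[ℂ] H}, a ∈ carrier → star a ∈ carrier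

/-- The unit of an operator system. -/
def OperatorSystem.unit (E : OperatorSystem H) : E.toSubmodule := ⟨1, E.one_mem'⟩

/-- A state of an operator system: a unital positive linear functional
(such a functional is automatically bounded, of norm one). -/
structure State (E : OperatorSystem H) where
  toLinearMap : E.toSubmodule →ₗ[ℂ] ℂ
  map_unit : toLinearMap E.unit = 1
  map_nonneg : ∀ a : E.toSubmodule, (a : H →L[ℂ] H).IsPositive →
    0 ≤ (toLinearMap a).re ∧ (toLinearMap a).im = 0

/-- The norm `‖[D, a]‖` of the commutator of a (densely defined) operator `D` with a bounded
operator `a`: the least `C` such that `‖(D a - a D) ψ‖ ≤ C ‖ψ‖` for all `ψ ∈ dom D`.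
It is `∞` if `a` does not preserve `dom D` or if `[D, a]` is not bounded. -/
def commutatorNorm (D : H →ₗ.[ℂ] H) (a : H →L[ℂ] H) : ℝ≥0∞ :=
  sInf {C : ℝ≥0∞ | ∀ ψ : D.domain, ∃ h : a (ψ : H) ∈ D.domain,
    ‖D ⟨a (ψ : H), h⟩ - a (D ψ)‖ₑ ≤ C * ‖(ψ : H)‖ₑ}

/-- Connes' distance `sup {|φ(a) - ψ(a)| : a ∈ 𝓔, ‖[D, a]‖ = 1}` between two states of an operator
system `E`, where `𝓔` is the (dense) subspace of `E` of the elements that are admitted. -/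
def connesDist (D : H →ₗ.[ℂ] H) (E : OperatorSystem H) (𝓔 : Submodule ℂ (H →L[ℂ] H))
    (φ ψ : State E) : ℝ≥0∞ :=
  ⨆ (a : E.toSubmodule) (_ : (a : H →L[ℂ] H) ∈ 𝓔) (_ : commutatorNorm D (a : H →L[ℂ] H) = 1),
    ‖φ.toLinearMap a - ψ.toLinearMap a‖ₑ

/-- The closed span of the eigenvectors of `D` with eigenvalues of modulus at most `Λ`,
i.e. the range `P_Λ H` of the spectral projection. -/
def spectralSubspace (D : H →ₗ.[ℂ] H) (Λ : ℝ) : Submodule ℂ H :=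
  (Submodule.span ℂ {ψ : H | ∃ l : ℝ, |l| ≤ Λ ∧
    ∃ h : ψ ∈ D.domain, D ⟨ψ, h⟩ = (l : ℂ) • ψ}).topologicalClosure

instance (D : H →ₗ.[ℂ] H) (Λ : ℝ) : CompleteSpace (spectralSubspace D Λ) :=
  inferInstanceAs (CompleteSpace (Submodule.topologicalClosure _))

/-- The compression `a ↦ P a P` of bounded operators to the closed subspace `K = P H`. -/
def compress (K : Submodule ℂ H) [CompleteSpace K] : (H →L[ℂ] H) →ₗ[ℂ] (K →L[ℂ] K) where
  toFun a := K.orthogonalProjectionOnto ∘L a ∘L K.subtypeL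
  map_add' a b := by ext; simp
  map_smul' c a := by ext; simp

/-- The compression `P D P` of an unbounded operator to the closed subspace `K = P H`. -/
def compressPMap (D : H →ₗ.[ℂ] H) (K : Submodule ℂ H) [CompleteSpace K] : K →ₗ.[ℂ] K where
  domain := D.domain.comap K.subtype
  toFun :=
    { toFun := fun ψ => K.orthogonalProjectionOnto (D ⟨(ψ : K), ψ.2⟩)
      map_add' := fun x y => by
        rw [← map_add, ← LinearPMap.map_add]; rfl
      map_smul' := fun c x => by
        rw [RingHom.id_apply, ← map_smul, ← LinearPMap.map_smul]; rfl }

theorem compress_one {H : Type*} [NormedAddCommGroup H] [InnerProductSpace ℂ H]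
    (K : Submodule ℂ H) [CompleteSpace K] : compress K 1 = 1 := by
  ext x; simp [compress]

theorem compress_star (K : Submodule ℂ H) [CompleteSpace K] (a : H →L[ℂ] H) :
    compress K (star a) = star (compress K a) := by
  rw [ContinuousLinearMap.star_eq_adjoint, ContinuousLinearMap.star_eq_adjoint,
    ContinuousLinearMap.eq_adjoint_iff]
  intro x y
  simp [compress, ContinuousLinearMap.adjoint_inner_left]

/-- The operator system `P 𝓔 P ⊆ B(P H)`, for a unital `*`-closed subspace `𝓔` of `B(H)`. -/
def compressSystem (E : OperatorSystem H) (K : Submodule ℂ H) [CompleteSpace K] :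
    OperatorSystem K where
  toSubmodule := E.toSubmodule.map (compress K)
  one_mem' := ⟨1, E.one_mem', compress_one K⟩
  star_mem' := by
    rintro _ ⟨a, ha, rfl⟩
    exact ⟨star a, E.star_mem' ha, compress_star K a⟩

/-- The nonempty compact metric space `p` represents `X` with the distance function `δ`. -/
def Represents {X : Type*} (p : GromovHausdorff.GHSpace) (δ : X → X → ℝ≥0∞) : Prop :=
  ∃ e : X ≃ p.Rep, ∀ x y : X, edist (e x) (e y) = δ x y

/-- Gromov-Hausdorff convergence of `(X Λ, δ Λ)` to `(Y, δY)` along the filter `l`: all these are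
nonempty compact metric spaces, and their isometry classes converge
in the Gromov-Hausdorff distance. -/
def GHConverges {ι : Type*} (l : Filter ι) (X : ι → Type*) (δ : ∀ i, X i → X i → ℝ≥0∞)
    (Y : Type*) (δY : Y → Y → ℝ≥0∞) : Prop :=
  ∃ (p : ι → GromovHausdorff.GHSpace) (q : GromovHausdorff.GHSpace),
    (∀ i, Represents (p i) (δ i)) ∧ Represents q δY ∧ Tendsto p l (𝓝 q)

end Abstract

/-! ### The torus and its Dirac operator -/

instance twoPiPos : Fact (0 < 2 * π) := ⟨Real.two_pi_pos⟩

/-- The torus `ℝ^d / 2πℤ^d`. -/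
abbrev Torus (d : ℕ) : Type := Fin d → AddCircle (2 * π)

/-- The quotient map `ℝ^d → ℝ^d / 2πℤ^d`. -/
def proj (d : ℕ) (x : Fin d → ℝ) : Torus d := fun i => (x i : AddCircle (2 * π))

/-- Lebesgue measure on the torus, normalised to total mass one
(so that the characters `e_n` are orthonormal). -/
abbrev torusMeasure (d : ℕ) : Measure (Torus d) :=
  Measure.pi fun _ => AddCircle.haarAddCircle

/-- The space of spinors `V = ℂ^N`, `N = 2^⌊d/2⌋`. -/
abbrev Spinor (d : ℕ) : Type := EuclideanSpace ℂ (Fin (2 ^ (d / 2)))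

/-- `L²(𝕋^d) ⊗ V`, as the space of square integrable `V`-valued functions. -/
abbrev SpinorL2 (d : ℕ) : Type := Lp (Spinor d) 2 (torusMeasure d)

/-- A choice of gamma matrices: self-adjoint matrices `γ^1, …, γ^d` of size `2^⌊d/2⌋` with
`γ^μ γ^ν + γ^ν γ^μ = 2 δ^{μν}`. -/
structure GammaMatrices (d : ℕ) where
  γ : Fin d → Matrix (Fin (2 ^ (d / 2))) (Fin (2 ^ (d / 2))) ℂ
  isHermitian : ∀ μ, (γ μ).IsHermitian
  clifford : ∀ μ ν, γ μ * γ ν + γ ν * γ μ = if μ = ν then 2 else 0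

/-- Gamma matrices exist in every dimension: `γ^μ ⊗ σ_z`, `1 ⊗ σ_x`, `1 ⊗ σ_y` in dimension
`d + 2`, starting from the empty family for `d = 0` and from `γ^1 = 1` for `d = 1`. -/
theorem GammaMatrices.nonempty : ∀ d : ℕ, Nonempty (GammaMatrices d)
  | 0 => ⟨⟨fun i => i.elim0, fun i => i.elim0, fun i => i.elim0⟩⟩
  | 1 => ⟨⟨fun _ => 1, fun _ => Matrix.isHermitian_one, fun μ ν => by
      simp [Subsingleton.elim μ ν, one_add_one_eq_two]⟩⟩
  | d + 2 => by
    obtain ⟨γ, h1, h2⟩ := GammaMatrices.nonempty d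
    have hN : 2 ^ (d / 2) * 2 = 2 ^ ((d + 2) / 2) := by
      rw [show (d + 2) / 2 = d / 2 + 1 by omega, pow_succ]
    let e : Fin (2 ^ (d / 2)) × Fin 2 ≃ Fin (2 ^ ((d + 2) / 2)) :=
      finProdFinEquiv.trans (finCongr hN)
    let sx : Matrix (Fin 2) (Fin 2) ℂ := !![0, 1; 1, 0]
    let sy : Matrix (Fin 2) (Fin 2) ℂ := !![0, -Complex.I; Complex.I, 0]
    let sz : Matrix (Fin 2) (Fin 2) ℂ := !![1, 0; 0, -1]
    have hx : sx.conjTranspose = sx := by ext i j; fin_cases i <;> fin_cases j <;> simp [sx]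
    have hy : sy.conjTranspose = sy := by ext i j; fin_cases i <;> fin_cases j <;> simp [sy]
    have hz : sz.conjTranspose = sz := by ext i j; fin_cases i <;> fin_cases j <;> simp [sz]
    have xx : sx * sx = 1 := by ext i j; fin_cases i <;> fin_cases j <;> simp [sx]
    have yy : sy * sy = 1 := by ext i j; fin_cases i <;> fin_cases j <;> simp [sy]
    have zz : sz * sz = 1 := by ext i j; fin_cases i <;> fin_cases j <;> simp [sz]
    have xy : sx * sy = -(sy * sx) := by
      ext i j; fin_cases i <;> fin_cases j <;> simp [sx, sy]
    have xz : sx * sz = -(sz * sx) := by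
      ext i j; fin_cases i <;> fin_cases j <;> simp [sx, sz]
    have yz : sy * sz = -(sz * sy) := by
      ext i j; fin_cases i <;> fin_cases j <;> simp [sy, sz]
    let g : Fin (d + 2) → Matrix (Fin (2 ^ (d / 2)) × Fin 2) (Fin (2 ^ (d / 2)) × Fin 2) ℂ :=
      Fin.cons (Matrix.kroneckerMap (· * ·) 1 sx)
        (Fin.cons (Matrix.kroneckerMap (· * ·) 1 sy)
          (fun μ => Matrix.kroneckerMap (· * ·) (γ μ) sz))
    have kneg : ∀ (A : Matrix (Fin (2 ^ (d / 2))) (Fin (2 ^ (d / 2))) ℂ)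
        (B : Matrix (Fin 2) (Fin 2) ℂ), Matrix.kroneckerMap (· * ·) A (-B) =
          -Matrix.kroneckerMap (· * ·) A B := by
      intro A B; ext i j; simp [Matrix.kroneckerMap]
    have two : (1 : Matrix (Fin (2 ^ (d / 2)) × Fin 2) (Fin (2 ^ (d / 2)) × Fin 2) ℂ) + 1 = 2 :=
      one_add_one_eq_two
    have k1 : Matrix.kroneckerMap (· * ·) (1 : Matrix (Fin (2 ^ (d / 2))) (Fin (2 ^ (d / 2))) ℂ)
        (1 : Matrix (Fin 2) (Fin 2) ℂ) = 1 := Matrix.one_kronecker_one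
    refine ⟨⟨fun μ => Matrix.reindexAlgEquiv ℂ ℂ e (g μ), fun μ => ?_, fun μ ν => ?_⟩⟩
    · have hg : (g μ).IsHermitian := by
        refine Fin.cases ?_ (fun μ => Fin.cases ?_ (fun μ => ?_) μ) μ
        · simp [g, Matrix.IsHermitian, Matrix.conjTranspose_kronecker, hx]
        · simp [g, Matrix.IsHermitian, Matrix.conjTranspose_kronecker, hy]
        · simp [g, Matrix.IsHermitian, Matrix.conjTranspose_kronecker, hz, (h1 μ).eq]
      exact hg.submatrix e.symm
    · have hg : g μ * g ν + g ν * g μ = if μ = ν then 2 else 0 := by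
        refine Fin.cases ?_ (fun μ => Fin.cases ?_ (fun μ => ?_) μ) μ <;>
        refine Fin.cases ?_ (fun ν => Fin.cases ?_ (fun ν => ?_) ν) ν
        · simp [g, ← Matrix.mul_kronecker_mul, xx, k1, two]
        · simp [g, ← Matrix.mul_kronecker_mul, xy, kneg]
        · simp [g, ← Matrix.mul_kronecker_mul, xz, kneg, (Fin.succ_ne_zero _).symm]
        · simp [g, ← Matrix.mul_kronecker_mul, xy, kneg]
        · simp [g, ← Matrix.mul_kronecker_mul, yy, k1, two]
        · have h0 : (1 : Fin (d + 2)) ≠ ν.succ.succ := by simp [Fin.ext_iff]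
          simp [g, ← Matrix.mul_kronecker_mul, yz, kneg, h0]
        · simp [g, ← Matrix.mul_kronecker_mul, xz, kneg]
        · have h0 : μ.succ.succ ≠ (1 : Fin (d + 2)) := by simp [Fin.ext_iff]
          simp [g, ← Matrix.mul_kronecker_mul, yz, kneg, h0]
        · have h0 := h2 μ ν
          simp only [g, Fin.cons_succ, ← Matrix.mul_kronecker_mul, zz, ← Matrix.add_kronecker, h0,
            Fin.succ_inj]
          split_ifs
          · have h2' : (2 : Matrix (Fin (2 ^ (d / 2))) (Fin (2 ^ (d / 2))) ℂ) = 1 + 1 :=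
              one_add_one_eq_two.symm
            rw [h2', Matrix.add_kronecker, Matrix.one_kronecker_one, two]
          · simp
      rw [← map_mul, ← map_mul, ← map_add, hg]
      split_ifs
      · exact map_ofNat _ 2
      · exact map_zero _

variable {d : ℕ} {F : Type*} [NormedAddCommGroup F] [NormedSpace ℂ F]

/-- A function on the torus is smooth if it lifts to a smooth function on `ℝ^d`. -/
def IsSmooth (f : Torus d → F) : Prop := ContDiff ℝ ∞ fun x : Fin d → ℝ => f (proj d x)

/-- The partial derivative `∂_μ` of a function on the torus. -/
def partialDeriv (μ : Fin d) (f : Torus d → F) (x : Torus d) : F :=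
  deriv (fun t : ℝ => f (x + proj d (Pi.single μ t))) 0

theorem proj_isOpenQuotientMap : IsOpenQuotientMap (proj d) := by
  unfold proj
  exact IsOpenQuotientMap.piMap (fun _ => QuotientAddGroup.isOpenQuotientMap_mk)

theorem hasDerivAt_proj {f : Torus d → F} (hf : IsSmooth f) (μ : Fin d) (x : Fin d → ℝ) :
    HasDerivAt (fun t : ℝ => f (proj d x + proj d (Pi.single μ t)))
      (fderiv ℝ (fun y => f (proj d y)) x (Pi.single μ 1)) 0 := by
  have h1 : HasFDerivAt (fun y => f (proj d y)) (fderiv ℝ (fun y => f (proj d y)) x)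
      (x + (0 : ℝ) • Pi.single μ (1 : ℝ)) := by
    simpa using (ContDiff.differentiable hf (by simp) x).hasFDerivAt
  have h2 : HasDerivAt (fun t : ℝ => x + t • (Pi.single μ (1 : ℝ) : Fin d → ℝ))
      (Pi.single μ 1) 0 := by
    simpa using ((hasDerivAt_id (0 : ℝ)).smul_const (Pi.single μ (1 : ℝ) : Fin d → ℝ)).const_add x
  convert h1.comp_hasDerivAt (0 : ℝ) h2 using 1
  funext t
  simp only [Function.comp]
  congr 1
  funext i
  by_cases h : i = μ
  · subst h; simp [proj]
  · simp [proj, h]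

theorem partialDeriv_proj {f : Torus d → F} (hf : IsSmooth f) (μ : Fin d) (x : Fin d → ℝ) :
    partialDeriv μ f (proj d x) = fderiv ℝ (fun y => f (proj d y)) x (Pi.single μ 1) :=
  (hasDerivAt_proj hf μ x).deriv

theorem differentiableAt_shift {f : Torus d → F} (hf : IsSmooth f) (μ : Fin d) (x : Torus d) :
    DifferentiableAt ℝ (fun t : ℝ => f (x + proj d (Pi.single μ t))) 0 := by
  obtain ⟨y, rfl⟩ := proj_isOpenQuotientMap.surjective x
  exact (hasDerivAt_proj hf μ y).differentiableAt

theorem continuous_partialDeriv {f : Torus d → F} (hf : IsSmooth f) (μ : Fin d) :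
    Continuous (partialDeriv μ f) := by
  rw [← proj_isOpenQuotientMap.continuous_comp_iff]
  have h : partialDeriv μ f ∘ proj d =
      fun x => fderiv ℝ (fun y => f (proj d y)) x (Pi.single μ 1) :=
    funext fun x => partialDeriv_proj hf μ x
  rw [h]
  exact (ContDiff.continuous_fderiv hf (by simp)).clm_apply continuous_const

variable (d F) in
/-- The smooth `F`-valued functions on the torus, as a subspace of the continuous ones. -/
def smoothFunctions : Submodule ℂ C(Torus d, F) where
  carrier := {f | IsSmooth f}
  add_mem' {f g} hf hg := by
    have hf' : IsSmooth f := hf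
    have hg' : IsSmooth g := hg
    exact ContDiff.add hf' hg'
  zero_mem' := by
    have h : IsSmooth (fun _ : Torus d => (0 : F)) := contDiff_const
    exact h
  smul_mem' c f hf := by
    have hf' : IsSmooth f := hf
    exact ContDiff.const_smul c hf'

/-- The differential operator `D = -i ∑_μ ∂_μ ⊗ γ^μ` on smooth spinors. -/
def diracSmooth (Γ : GammaMatrices d) :
    smoothFunctions d (Spinor d) →ₗ[ℂ] C(Torus d, Spinor d) where
  toFun ψ :=
    { toFun := fun x => -Complex.I •
        ∑ μ, Matrix.toEuclideanCLM (𝕜 := ℂ) (Γ.γ μ) (partialDeriv μ ψ.1 x)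
      continuous_toFun := by
        have := fun μ => continuous_partialDeriv ψ.2 μ
        fun_prop }
  map_add' ψ χ := by
    ext1 x
    have h : ∀ μ, partialDeriv μ (ψ + χ).1 x = partialDeriv μ ψ.1 x + partialDeriv μ χ.1 x :=
      fun μ => deriv_add (differentiableAt_shift ψ.2 μ x) (differentiableAt_shift χ.2 μ x)
    simp only [ContinuousMap.coe_mk, ContinuousMap.add_apply, h, map_add,
      Finset.sum_add_distrib, smul_add]
  map_smul' c ψ := by
    ext1 x
    have h : ∀ μ, partialDeriv μ (c • ψ).1 x = c • partialDeriv μ ψ.1 x :=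
      fun μ => deriv_const_smul c (differentiableAt_shift ψ.2 μ x)
    simp only [ContinuousMap.coe_mk, ContinuousMap.smul_apply, h, map_smul,
      ← Finset.smul_sum, RingHom.id_apply]
    rw [smul_comm]

variable (d) in
/-- The inclusion of the smooth spinors into `L²`. -/
def smoothToL2 : smoothFunctions d (Spinor d) →ₗ[ℂ] SpinorL2 d :=
  (ContinuousMap.toLp 2 (torusMeasure d) ℂ).toLinearMap ∘ₗ (smoothFunctions d (Spinor d)).subtype

theorem smoothToL2_injective : Function.Injective (smoothToL2 d) :=
  (ContinuousMap.toLp_injective (𝕜 := ℂ) (p := 2) (torusMeasure d)).comp Subtype.val_injective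

/-- The Dirac operator with domain the smooth spinors. -/
def diracCore (Γ : GammaMatrices d) : SpinorL2 d →ₗ.[ℂ] SpinorL2 d where
  domain := LinearMap.range (smoothToL2 d)
  toFun := (ContinuousMap.toLp 2 (torusMeasure d) ℂ).toLinearMap ∘ₗ diracSmooth Γ ∘ₗ
    (LinearEquiv.ofInjective (smoothToL2 d) smoothToL2_injective).symm.toLinearMap

/-- The Dirac operator `D` of the torus: the closure of `-i ∑_μ ∂_μ ⊗ γ^μ` on smooth spinors. -/
def dirac (Γ : GammaMatrices d) : SpinorL2 d →ₗ.[ℂ] SpinorL2 d := (diracCore Γ).closure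

variable (d) in
/-- The action of `C(𝕋^d)` on `L²(𝕋^d) ⊗ V` by pointwise multiplication. -/
def mulOp : C(Torus d, ℂ) →ₗ[ℂ] (SpinorL2 d →L[ℂ] SpinorL2 d) :=
  ((ContinuousLinearMap.lsmul ℂ ℂ : ℂ →L[ℂ] Spinor d →L[ℂ] Spinor d).holderL
    (torusMeasure d) ∞ 2 2).toLinearMap ∘ₗ
    (ContinuousMap.toLp ∞ (torusMeasure d) ℂ).toLinearMap

theorem mulOp_ae (f : C(Torus d, ℂ)) (ψ : SpinorL2 d) :
    mulOp d f ψ =ᵐ[torusMeasure d] fun x => f x • ψ x := by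
  have h1 := (ContinuousLinearMap.lsmul ℂ ℂ : ℂ →L[ℂ] Spinor d →L[ℂ] Spinor d).coeFn_holder
    (r := 2) (ContinuousMap.toLp ∞ (torusMeasure d) ℂ f) ψ
  have h2 := ContinuousMap.coeFn_toLp (p := ∞) (𝕜 := ℂ) (torusMeasure d) f
  filter_upwards [h1, h2] with x hx1 hx2
  rw [hx2] at hx1
  exact hx1

theorem mulOp_one : mulOp d 1 = 1 := by
  ext1 ψ
  refine Lp.ext ?_
  filter_upwards [mulOp_ae 1 ψ] with x hx
  simpa using hx

theorem mulOp_star (f : C(Torus d, ℂ)) : mulOp d (star f) = star (mulOp d f) := by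
  rw [ContinuousLinearMap.star_eq_adjoint, ContinuousLinearMap.eq_adjoint_iff]
  intro ψ χ
  rw [L2.inner_def, L2.inner_def]
  refine integral_congr_ae ?_
  filter_upwards [mulOp_ae (star f) ψ, mulOp_ae f χ] with x h1 h2
  rw [h1, h2, inner_smul_left, inner_smul_right]
  simp

variable (d) in
/-- `C(𝕋^d)`, acting on `L²(𝕋^d) ⊗ V`. -/
def continuousSystem : OperatorSystem (SpinorL2 d) where
  toSubmodule := LinearMap.range (mulOp d)
  one_mem' := ⟨1, mulOp_one⟩
  star_mem' := by
    rintro _ ⟨f, rfl⟩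
    exact ⟨star f, mulOp_star f⟩

variable (d) in
/-- `C^∞(𝕋^d)`, acting on `L²(𝕋^d) ⊗ V`. -/
def smoothSystem : OperatorSystem (SpinorL2 d) where
  toSubmodule := (smoothFunctions d ℂ).map (mulOp d)
  one_mem' := by
    have h : IsSmooth (fun _ : Torus d => (1 : ℂ)) := contDiff_const
    exact ⟨1, h, mulOp_one⟩
  star_mem' := by
    rintro _ ⟨f, hf, rfl⟩
    exact ⟨star f, (Complex.conjCLE.contDiff (n := ∞)).comp hf, mulOp_star f⟩

/-- `P_Λ H`, the span of the eigenspinors with eigenvalues of modulus at most `Λ`. -/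
abbrev truncSpace (Γ : GammaMatrices d) (Λ : ℝ≥0) : Submodule ℂ (SpinorL2 d) :=
  spectralSubspace (dirac Γ) Λ

/-- The operator system `P_Λ C^∞(𝕋^d) P_Λ` in `B(P_Λ H)`. -/
def truncSystem (Γ : GammaMatrices d) (Λ : ℝ≥0) : OperatorSystem (truncSpace Γ Λ) :=
  compressSystem (smoothSystem d) (truncSpace Γ Λ)

/-- Connes' distance on the states of `P_Λ C^∞(𝕋^d) P_Λ`, with respect to `P_Λ D P_Λ`. -/
def truncDist (Γ : GammaMatrices d) (Λ : ℝ≥0) :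
    State (truncSystem Γ Λ) → State (truncSystem Γ Λ) → ℝ≥0∞ :=
  connesDist (compressPMap (dirac Γ) (truncSpace Γ Λ)) (truncSystem Γ Λ)
    (truncSystem Γ Λ).toSubmodule

/-- Connes' distance on the states of `C(𝕋^d)`, as a supremum over `C^∞(𝕋^d)`. -/
def torusDist (Γ : GammaMatrices d) :
    State (continuousSystem d) → State (continuousSystem d) → ℝ≥0∞ :=
  connesDist (dirac Γ) (continuousSystem d) (smoothSystem d).toSubmodule

end SpectralTruncation

end

/-! The two state spaces are compared through unital positive maps in opposite directions.
Compression r(f) = P_Λ f P_Λ maps C(𝕋^d) to 𝓔_Λ. The lower symbol s(T)(x) = ⟨w_x, T w_x⟩ maps back,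
where w_x is a unit wave packet with equal weights on all frequencies of a cube |n_i| ≤ M lying
inside the ball |n| ≤ Λ. Then s(r(f)) = F_M * f and r(s(P f P)) = P (F_M * f) P, with F_M the Fejér
kernel of the cube.

Neither map increases commutator norms. For r this holds because P_Λ commutes with D
(`commutatorNorm_compress_le`). For s it holds because the symbol of [D, s(T)] at x is a matrix
coefficient of [D_Λ, T] between packets located at the same point
(`CommutatorFormBound.commutatorNorm_fejerMean_le`).

Both composites are close to the identity on Lipschitz balls by one estimate on block Toeplitz forms
with entries c(m - n), `norm_sum_one_sub_fejerCoeff_le`. Since 1 - F̂_M(k) = ∫ F_M(y) (1 - e_k(y))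
dy, the form of T - r(s(T)) averages the differences between T and its translates. Translation by t
moves T by at most ∑ |t_μ| ‖[-i∂_μ, T]‖. Moreover 2 [-i∂_μ, T] = γ^μ [D, T] + [D, T] γ^μ with γ^μ
unitary, so each component is bounded by ‖[D, T]‖. The first moments of F_M are O(M^{-1/2}), hence
the error ε_M tends to 0. The argument involves forms on a finite set of frequencies only, so it
serves for f and for P f P alike, with the same constant.

Pulling back states along r and s then bounds the Gromov–Hausdorff distance by 4 ε_M
(`dist_le_of_isLipschitzMap`). Compactness is Rieffel's criterion, total boundedness of the
Lipschitz ball modulo scalars (`IsLipschitzSubspace.exists_represents`). In 𝓔_Λ it follows from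
finite dimension and the case M = 0 of the estimate, where the Fejér mean is a scalar. In C(𝕋^d) it
is inherited from the truncations through r and s. -/

noncomputable section

namespace SpectralTruncation

/-! ### Scaling and attainment of the commutator norm -/

section CommutatorNorm

variable {H : Type*} [NormedAddCommGroup H] [InnerProductSpace ℂ H]

/-- The infimum is attained, because the defining inequality is closed in the constant and
preservation of the domain does not involve the constant. A finite bound excludes the empty set,
whose infimum is `⊤`. -/
theorem commutatorNorm_le_iff {D : H →ₗ.[ℂ] H} {a : H →L[ℂ] H} {C : ℝ≥0} :
    commutatorNorm D a ≤ C ↔ ∀ ψ : D.domain, ∃ h : a (ψ : H) ∈ D.domain,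
      ‖D ⟨a (ψ : H), h⟩ - a (D ψ)‖ ≤ C * ‖(ψ : H)‖ := by
  have key : ∀ (x y : H), ‖x‖ ≤ C * ‖y‖ ↔ ‖x‖ₑ ≤ (C : ℝ≥0∞) * ‖y‖ₑ := by
    intro x y
    rw [enorm_eq_nnnorm, enorm_eq_nnnorm, ← ENNReal.coe_mul, ENNReal.coe_le_coe,
      ← NNReal.coe_le_coe]
    simp
  constructor
  · intro hC ψ
    have hne : {C : ℝ≥0∞ | ∀ ψ : D.domain, ∃ h : a (ψ : H) ∈ D.domain,
        ‖D ⟨a (ψ : H), h⟩ - a (D ψ)‖ₑ ≤ C * ‖(ψ : H)‖ₑ}.Nonempty := by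
      by_contra hne
      rw [Set.not_nonempty_iff_eq_empty] at hne
      rw [commutatorNorm, hne, sInf_empty] at hC
      exact absurd hC (by simp)
    have h := hne.some_mem ψ
    refine ⟨h.choose, (key _ _).2 ?_⟩
    obtain ⟨u, -, hu, hmem⟩ := exists_seq_tendsto_sInf hne (OrderBot.bddBelow _)
    have h2 : ‖D ⟨a (ψ : H), h.choose⟩ - a (D ψ)‖ₑ ≤ commutatorNorm D a * ‖(ψ : H)‖ₑ :=
      ge_of_tendsto (ENNReal.Tendsto.mul_const hu (Or.inr enorm_ne_top))
        (Eventually.of_forall fun n => (hmem n ψ).choose_spec)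
    exact h2.trans (by gcongr)
  · intro h
    refine sInf_le fun ψ => ?_
    obtain ⟨h1, h2⟩ := h ψ
    exact ⟨h1, (key _ _).1 h2⟩

theorem commutatorNorm_smul_le {D : H →ₗ.[ℂ] H} {a : H →L[ℂ] H} (c : ℂ) {C : ℝ≥0}
    (h : commutatorNorm D a ≤ C) : commutatorNorm D (c • a) ≤ (‖c‖₊ * C : ℝ≥0) := by
  rw [commutatorNorm_le_iff] at h ⊢
  intro ψ
  obtain ⟨h1, h2⟩ := h ψ
  refine ⟨D.domain.smul_mem c h1, ?_⟩
  have : D ⟨(c • a) (ψ : H), D.domain.smul_mem c h1⟩ = c • D ⟨a (ψ : H), h1⟩ :=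
    D.map_smul c ⟨a (ψ : H), h1⟩
  rw [this, smul_apply, ← smul_sub, norm_smul, NNReal.coe_mul, mul_assoc]
  exact mul_le_mul_of_nonneg_left h2 (norm_nonneg _)

theorem commutatorNorm_smul {D : H →ₗ.[ℂ] H} {a : H →L[ℂ] H} {c : ℂ} (hc : c ≠ 0) {C : ℝ≥0}
    (h : commutatorNorm D a = C) : commutatorNorm D (c • a) = (‖c‖₊ * C : ℝ≥0) := by
  refine le_antisymm (commutatorNorm_smul_le c h.le) ?_
  have h1 := commutatorNorm_smul_le c h.le
  lift commutatorNorm D (c • a) to ℝ≥0 using ne_top_of_le_ne_top ENNReal.coe_ne_top h1 with B hB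
  have h2 := commutatorNorm_smul_le c⁻¹ hB.symm.le
  rw [inv_smul_smul₀ hc, h, ENNReal.coe_le_coe, nnnorm_inv] at h2
  rw [ENNReal.coe_le_coe]
  have : ‖c‖₊ ≠ 0 := by simpa using hc
  calc ‖c‖₊ * C ≤ ‖c‖₊ * (‖c‖₊⁻¹ * B) := by gcongr
    _ = B := by rw [mul_inv_cancel_left₀ this]

end CommutatorNorm

/-! ### States: boundedness, pull-back and weak-* compactness -/

section States

variable {H : Type*} [NormedAddCommGroup H] [InnerProductSpace ℂ H] [CompleteSpace H]
  {E : OperatorSystem H}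

theorem State.ext {φ ψ : State E} (h : ∀ a, φ.toLinearMap a = ψ.toLinearMap a) : φ = ψ := by
  cases φ; cases ψ; congr; exact LinearMap.ext h

theorem isPositive_norm_smul_one_add {a : H →L[ℂ] H} (ha : IsSelfAdjoint a) :
    ((‖a‖ : ℂ) • (1 : H →L[ℂ] H) + a).IsPositive := by
  rw [ContinuousLinearMap.isPositive_def']
  refine ⟨?_, fun x => ?_⟩
  · refine IsSelfAdjoint.add ?_ ha
    rw [IsSelfAdjoint, star_smul, star_one]; simp
  · have h1 : ‖inner ℂ (a x) x‖ ≤ ‖a‖ * ‖x‖ * ‖x‖ :=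
      (norm_inner_le_norm _ _).trans (by gcongr; exact a.le_opNorm x)
    have h2 := (Complex.abs_re_le_norm _).trans h1
    rw [abs_le] at h2
    simp only [ContinuousLinearMap.reApplyInnerSelf, add_apply,
      smul_apply, one_apply_eq_self, inner_add_left,
      inner_smul_left, inner_self_eq_norm_sq_to_K, map_add]
    have h3 : (starRingEnd ℂ) (‖a‖ : ℂ) * ((‖x‖ : ℂ)) ^ 2 = ((‖a‖ * ‖x‖ * ‖x‖ : ℝ) : ℂ) := by
      simp; ring
    have h4 : RCLike.re ((starRingEnd ℂ) (‖a‖ : ℂ) * ((‖x‖ : ℂ)) ^ 2) = ‖a‖ * ‖x‖ * ‖x‖ := by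
      rw [h3]; simp
    have h5 : RCLike.re (inner ℂ (a x) x) = (inner ℂ (a x) x).re := rfl
    simp only [Complex.coe_algebraMap, h4, h5]
    linarith [h2.1]

theorem State.norm_apply_le_of_isSelfAdjoint (φ : State E) (a : E.toSubmodule)
    (ha : IsSelfAdjoint (a : H →L[ℂ] H)) : ‖φ.toLinearMap a‖ ≤ ‖(a : H →L[ℂ] H)‖ := by
  have h1 := φ.map_nonneg ((‖(a : H →L[ℂ] H)‖ : ℂ) • E.unit + a)
    (isPositive_norm_smul_one_add ha)
  have h2 := φ.map_nonneg ((‖(a : H →L[ℂ] H)‖ : ℂ) • E.unit + -a) (by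
    have := isPositive_norm_smul_one_add ha.neg
    rwa [norm_neg] at this)
  simp only [map_add, map_smul, map_neg, φ.map_unit, smul_eq_mul, mul_one, Complex.add_re,
    Complex.ofReal_re, Complex.add_im, Complex.ofReal_im, Complex.neg_re, Complex.neg_im,
    zero_add] at h1 h2
  have h3 : φ.toLinearMap a = ((φ.toLinearMap a).re : ℂ) := by
    apply Complex.ext <;> simp [h1.2]
  rw [h3, Complex.norm_real, Real.norm_eq_abs, abs_le]
  constructor <;> linarith [h1.1, h2.1]

/-- Follows from the self-adjoint case applied to a + a* and i(a - a*). The constant 2 is not sharp,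
but only the order of the error matters later. -/
theorem State.norm_apply_le (φ : State E) (a : E.toSubmodule) :
    ‖φ.toLinearMap a‖ ≤ 2 * ‖(a : H →L[ℂ] H)‖ := by
  set b : E.toSubmodule := ⟨star (a : H →L[ℂ] H), E.star_mem' a.2⟩ with hb
  have hbn : ‖(b : H →L[ℂ] H)‖ = ‖(a : H →L[ℂ] H)‖ := by simp [hb]
  have h1 := φ.norm_apply_le_of_isSelfAdjoint (a + b) (IsSelfAdjoint.add_star_self _)
  have h2 := φ.norm_apply_le_of_isSelfAdjoint (Complex.I • (a - b)) (by
    rw [IsSelfAdjoint]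
    simp only [hb, Submodule.coe_smul, Submodule.coe_sub, star_smul, star_sub, star_star]
    rw [← neg_sub, smul_neg, ← neg_smul]; simp)
  have h3 : ‖((a + b : E.toSubmodule) : H →L[ℂ] H)‖ ≤ 2 * ‖(a : H →L[ℂ] H)‖ := by
    refine (norm_add_le _ _).trans (by rw [hbn]; linarith)
  have h4 : ‖((Complex.I • (a - b) : E.toSubmodule) : H →L[ℂ] H)‖ ≤ 2 * ‖(a : H →L[ℂ] H)‖ := by
    rw [Submodule.coe_smul, norm_smul, Complex.norm_I, one_mul]
    refine (norm_sub_le _ _).trans (by rw [hbn]; linarith)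
  have h5 : φ.toLinearMap a = (1 / 2 : ℂ) * (φ.toLinearMap (a + b) +
      -Complex.I * φ.toLinearMap (Complex.I • (a - b))) := by
    rw [map_smul, map_add, map_sub, smul_eq_mul, ← mul_assoc]
    simp; ring
  rw [h5, norm_mul]
  have h6 : ‖φ.toLinearMap (a + b) + -Complex.I * φ.toLinearMap (Complex.I • (a - b))‖ ≤
      4 * ‖(a : H →L[ℂ] H)‖ := by
    refine (norm_add_le _ _).trans ?_
    rw [norm_mul, norm_neg, Complex.norm_I, one_mul]
    linarith
  have h7 : ‖(1 / 2 : ℂ)‖ = 1 / 2 := by simp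
  rw [h7]; linarith

/-- The vector state of a unit vector. -/
def vectorState (E : OperatorSystem H) (v : H) (hv : ‖v‖ = 1) : State E where
  toLinearMap :=
    { toFun := fun a => inner ℂ v ((a : H →L[ℂ] H) v)
      map_add' := fun a b => by simp
      map_smul' := fun c a => by simp }
  map_unit := by simp [OperatorSystem.unit, inner_self_eq_norm_sq_to_K, hv]
  map_nonneg a ha := by
    have := ha.inner_nonneg_right v
    rw [Complex.le_def] at this
    exact ⟨by simpa using this.1, by simpa using this.2.symm⟩

theorem State.nonempty [Nontrivial H] (E : OperatorSystem H) : Nonempty (State E) := by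
  obtain ⟨v, hv⟩ := exists_norm_eq H zero_le_one
  exact ⟨vectorState E v hv⟩

/-- The pull-back of states along a unital positive map. -/
def State.comap {H' : Type*} [NormedAddCommGroup H'] [InnerProductSpace ℂ H'] [CompleteSpace H']
    {E' : OperatorSystem H'} (r : E.toSubmodule →ₗ[ℂ] E'.toSubmodule) (h1 : r E.unit = E'.unit)
    (h2 : ∀ a : E.toSubmodule, (a : H →L[ℂ] H).IsPositive → (r a : H' →L[ℂ] H').IsPositive) (φ : State E') :
    State E where
  toLinearMap := φ.toLinearMap ∘ₗ r
  map_unit := by simp [h1, φ.map_unit]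
  map_nonneg a ha := φ.map_nonneg _ (h2 a ha)

/-- Banach–Alaoglu by hand: the values at each a stay in a fixed disc, hence converge along the
ultrafilter, and linearity, positivity and normalisation are closed conditions. -/
theorem State.exists_tendsto (𝒰 : Ultrafilter (State E)) :
    ∃ φ : State E, ∀ a, Tendsto (fun ψ : State E => ψ.toLinearMap a) 𝒰 (𝓝 (φ.toLinearMap a)) := by
  have h : ∀ a : E.toSubmodule, ∃ z : ℂ,
      Tendsto (fun ψ : State E => ψ.toLinearMap a) 𝒰 (𝓝 z) := by
    intro a
    obtain ⟨z, -, hz⟩ := (isCompact_closedBall (0 : ℂ) (2 * ‖(a : H →L[ℂ] H)‖)).ultrafilter_le_nhds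
      (𝒰.map fun ψ : State E => ψ.toLinearMap a) (by
        rw [le_principal_iff, Ultrafilter.coe_map]
        exact mem_map.2 (univ_mem' fun ψ => by simpa using ψ.norm_apply_le a))
    exact ⟨z, hz⟩
  choose z hz using h
  refine ⟨⟨⟨⟨z, fun a b => ?_⟩, fun c a => ?_⟩, ?_, fun a ha => ⟨?_, ?_⟩⟩, hz⟩
  · refine tendsto_nhds_unique (hz (a + b)) ?_
    simpa using (hz a).add (hz b)
  · refine tendsto_nhds_unique (hz (c • a)) ?_
    simpa using (hz a).const_mul c
  · refine tendsto_nhds_unique (hz E.unit) ?_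
    simp [State.map_unit]
  · exact ge_of_tendsto (Complex.continuous_re.continuousAt.tendsto.comp (hz a))
      (Eventually.of_forall fun ψ => (ψ.map_nonneg a ha).1)
  · refine tendsto_nhds_unique (Complex.continuous_im.continuousAt.tendsto.comp (hz a)) ?_
    refine tendsto_const_nhds.congr fun ψ => ?_
    exact ((ψ.map_nonneg a ha).2).symm

end States

/-! ### Rieffel's criterion: Connes' distance metrises a compact state space -/

section CompactQuantumMetric

variable {H : Type*} [NormedAddCommGroup H] [InnerProductSpace ℂ H] [CompleteSpace H]

/-- Rieffel's criterion: the elements of `𝓔`, which is dense in `E`, have bounded commutators with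
`D`, and those with commutator norm at most one are totally bounded modulo scalars. -/
structure IsLipschitzSubspace (D : H →ₗ.[ℂ] H) (E : OperatorSystem H)
    (𝓔 : Submodule ℂ (H →L[ℂ] H)) : Prop where
  le : 𝓔 ≤ E.toSubmodule
  dense : (E.toSubmodule : Set (H →L[ℂ] H)) ⊆ closure 𝓔
  commutatorNorm_ne_top : ∀ a ∈ 𝓔, commutatorNorm D a ≠ ⊤
  totallyBounded : ∀ ε > 0, ∃ F : Set E.toSubmodule, F.Finite ∧ ∀ a ∈ 𝓔, commutatorNorm D a ≤ 1 →
    ∃ c : ℂ, ∃ b ∈ F, ‖a - c • (1 : H →L[ℂ] H) - b‖ ≤ ε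

variable {D : H →ₗ.[ℂ] H} {E : OperatorSystem H} {𝓔 : Submodule ℂ (H →L[ℂ] H)}

/-- The difference of two states annihilates scalars. Each state contributes 2ε on the remainder,
whence 4ε. -/
theorem State.norm_sub_apply_le (φ ψ : State E) (a b : E.toSubmodule) (c : ℂ) {ε : ℝ}
    (h : ‖(a : H →L[ℂ] H) - c • (1 : H →L[ℂ] H) - b‖ ≤ ε) :
    ‖φ.toLinearMap a - ψ.toLinearMap a‖ ≤ 4 * ε + ‖φ.toLinearMap b - ψ.toLinearMap b‖ := by
  have h1 := φ.norm_apply_le (a - c • E.unit - b)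
  have h2 := ψ.norm_apply_le (a - c • E.unit - b)
  have h3 : ‖((a - c • E.unit - b : E.toSubmodule) : H →L[ℂ] H)‖ ≤ ε := h
  have h4 : φ.toLinearMap a - ψ.toLinearMap a =
      (φ.toLinearMap (a - c • E.unit - b) - ψ.toLinearMap (a - c • E.unit - b)) +
        (φ.toLinearMap b - ψ.toLinearMap b) := by
    simp only [map_sub, map_smul, φ.map_unit, ψ.map_unit]; ring
  rw [h4]
  refine (norm_add_le _ _).trans (add_le_add_left ((norm_sub_le _ _).trans ?_) _)
  linarith

/-- The supremum defining the distance only sees commutator norm exactly 1, so norm 0 needs a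
separate argument. All multiples n a lie in the Lipschitz ball, on which the difference of the two
states is bounded; hence it vanishes at a. -/
theorem IsLipschitzSubspace.apply_eq_of_commutatorNorm_eq_zero (hE : IsLipschitzSubspace D E 𝓔)
    (φ ψ : State E) (a : E.toSubmodule) (ha : (a : H →L[ℂ] H) ∈ 𝓔)
    (h : commutatorNorm D (a : H →L[ℂ] H) = 0) : φ.toLinearMap a = ψ.toLinearMap a := by
  obtain ⟨F, hF, hF2⟩ := hE.totallyBounded 1 one_pos
  obtain ⟨M, hM⟩ := (hF.image fun b => ‖φ.toLinearMap b - ψ.toLinearMap b‖).bddAbove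
  have key : ∀ n : ℕ, n * ‖φ.toLinearMap a - ψ.toLinearMap a‖ ≤ 4 + M := by
    intro n
    have h1 := commutatorNorm_smul_le (D := D) (a := a) n (C := 0) (by simp [h])
    obtain ⟨c, b, hb, hab⟩ := hF2 ((n : ℂ) • (a : H →L[ℂ] H)) (𝓔.smul_mem _ ha)
      (h1.trans (by simp))
    have h2 := State.norm_sub_apply_le φ ψ ((n : ℂ) • a) b c hab
    have h3 := hM (Set.mem_image_of_mem _ hb)
    simp only [map_smul, ← smul_sub, norm_smul, Complex.norm_natCast] at h2
    linarith
  by_contra hne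
  obtain ⟨n, hn⟩ := Archimedean.arch (4 + M + 1) (norm_pos_iff.2 (sub_ne_zero.2 hne))
  have := key n
  rw [nsmul_eq_mul] at hn
  linarith

/-- Dividing a by its commutator norm brings it into the set over which the supremum is taken; norm
0 is covered by the preceding lemma. From here on the normalisation to exactly 1 can be replaced by
upper bounds. -/
theorem IsLipschitzSubspace.enorm_sub_le (hE : IsLipschitzSubspace D E 𝓔)
    (φ ψ : State E) (a : E.toSubmodule) (ha : (a : H →L[ℂ] H) ∈ 𝓔) {C : ℝ≥0}
    (h : commutatorNorm D (a : H →L[ℂ] H) ≤ C) :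
    ‖φ.toLinearMap a - ψ.toLinearMap a‖ₑ ≤ C * connesDist D E 𝓔 φ ψ := by
  rcases eq_or_ne (commutatorNorm D (a : H →L[ℂ] H)) 0 with h0 | h0
  · simp [hE.apply_eq_of_commutatorNorm_eq_zero φ ψ a ha h0]
  lift commutatorNorm D (a : H →L[ℂ] H) to ℝ≥0 using hE.commutatorNorm_ne_top a ha with B hB
  have hB0 : B ≠ 0 := by simpa using h0
  have hc : ((B : ℂ))⁻¹ ≠ 0 := by simpa using hB0
  have h1 := commutatorNorm_smul hc hB.symm
  have h2 : (‖((B : ℂ))⁻¹‖₊ * B : ℝ≥0) = 1 := by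
    rw [nnnorm_inv]
    have : ‖(B : ℂ)‖₊ = B := by ext; simp
    rw [this, inv_mul_cancel₀ hB0]
  rw [h2, ENNReal.coe_one] at h1
  have h3 : ‖φ.toLinearMap (((B : ℂ))⁻¹ • a) - ψ.toLinearMap (((B : ℂ))⁻¹ • a)‖ₑ ≤
      connesDist D E 𝓔 φ ψ :=
    le_iSup_of_le (((B : ℂ))⁻¹ • a) (le_iSup_of_le (𝓔.smul_mem _ ha) (le_iSup_of_le h1 le_rfl))
  have h4 : φ.toLinearMap a - ψ.toLinearMap a = (B : ℂ) *
      (φ.toLinearMap (((B : ℂ))⁻¹ • a) - ψ.toLinearMap (((B : ℂ))⁻¹ • a)) := by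
    rw [map_smul, map_smul, ← smul_sub, smul_eq_mul, mul_inv_cancel_left₀]
    simpa using hB0
  have h5 : ‖(B : ℂ)‖ₑ = B := by rw [enorm_eq_nnnorm]; congr; ext; simp
  rw [h4, enorm_mul, h5]
  gcongr

theorem connesDist_le {φ ψ : State E} {C : ℝ≥0∞}
    (h : ∀ a : E.toSubmodule, (a : H →L[ℂ] H) ∈ 𝓔 → commutatorNorm D (a : H →L[ℂ] H) ≤ 1 →
      ‖φ.toLinearMap a - ψ.toLinearMap a‖ₑ ≤ C) : connesDist D E 𝓔 φ ψ ≤ C :=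
  iSup_le fun a => iSup_le fun ha => iSup_le fun h1 => h a ha h1.le

theorem connesDist_le_ofReal {φ ψ : State E} {C : ℝ}
    (h : ∀ a : E.toSubmodule, (a : H →L[ℂ] H) ∈ 𝓔 → commutatorNorm D (a : H →L[ℂ] H) ≤ 1 →
      ‖φ.toLinearMap a - ψ.toLinearMap a‖ ≤ C) : connesDist D E 𝓔 φ ψ ≤ ENNReal.ofReal C := by
  refine connesDist_le fun a ha h1 => ?_
  rw [← ofReal_norm]
  exact ENNReal.ofReal_le_ofReal (h a ha h1)

theorem connesDist_self (φ : State E) : connesDist D E 𝓔 φ φ = 0 := by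
  simp [connesDist]

theorem connesDist_comm (φ ψ : State E) : connesDist D E 𝓔 φ ψ = connesDist D E 𝓔 ψ φ := by
  simp only [connesDist, enorm_sub_rev]

theorem connesDist_triangle (φ ψ χ : State E) :
    connesDist D E 𝓔 φ χ ≤ connesDist D E 𝓔 φ ψ + connesDist D E 𝓔 ψ χ := by
  refine iSup_le fun a => iSup_le fun ha => iSup_le fun h1 => ?_
  have h2 : ∀ φ ψ : State E, ‖φ.toLinearMap a - ψ.toLinearMap a‖ₑ ≤ connesDist D E 𝓔 φ ψ :=
    fun φ ψ => le_iSup_of_le a (le_iSup_of_le ha (le_iSup_of_le h1 le_rfl))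
  rw [← sub_add_sub_cancel _ (ψ.toLinearMap a)]
  exact (enorm_add_le _ _).trans (add_le_add (h2 φ ψ) (h2 ψ χ))

theorem IsLipschitzSubspace.connesDist_ne_top (hE : IsLipschitzSubspace D E 𝓔) (φ ψ : State E) :
    connesDist D E 𝓔 φ ψ ≠ ⊤ := by
  obtain ⟨F, hF, hF2⟩ := hE.totallyBounded 1 one_pos
  obtain ⟨M, hM⟩ := (hF.image fun b => ‖φ.toLinearMap b - ψ.toLinearMap b‖).bddAbove
  refine ne_top_of_le_ne_top (ENNReal.ofReal_ne_top (r := 4 * 1 + M))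
    (connesDist_le_ofReal fun a ha h1 => ?_)
  obtain ⟨c, b, hb, hab⟩ := hF2 a ha h1
  have h2 := State.norm_sub_apply_le φ ψ a b c hab
  have h3 := hM (Set.mem_image_of_mem _ hb)
  linarith

theorem IsLipschitzSubspace.eq_of_connesDist_eq_zero (hE : IsLipschitzSubspace D E 𝓔)
    {φ ψ : State E} (h : connesDist D E 𝓔 φ ψ = 0) : φ = ψ := by
  have h1 : ∀ a : E.toSubmodule, (a : H →L[ℂ] H) ∈ 𝓔 → φ.toLinearMap a = ψ.toLinearMap a := by
    intro a ha
    obtain ⟨C, hC⟩ := WithTop.ne_top_iff_exists.1 (hE.commutatorNorm_ne_top a ha)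
    have := hE.enorm_sub_le φ ψ a ha hC.symm.le
    rw [h, mul_zero, nonpos_iff_eq_zero, enorm_eq_zero, sub_eq_zero] at this
    exact this
  refine State.ext fun a => ?_
  rw [← sub_eq_zero, ← norm_le_zero_iff]
  refine le_of_forall_pos_le_add fun ε hε => ?_
  obtain ⟨b, hb, hab⟩ := Metric.mem_closure_iff.1 (hE.dense a.2) (ε / 4) (by positivity)
  rw [dist_eq_norm] at hab
  have h2 := State.norm_sub_apply_le φ ψ a ⟨b, hE.le hb⟩ 0 (by simpa using hab.le)
  rw [h1 ⟨b, hE.le hb⟩ hb, sub_self, norm_zero] at h2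
  linarith

/-- A weak-* limit of states is also a limit for the distance: total boundedness reduces the
supremum over the Lipschitz ball to finitely many elements, on which convergence is pointwise. -/
theorem IsLipschitzSubspace.exists_represents [Nontrivial H] (hE : IsLipschitzSubspace D E 𝓔) :
    ∃ p, Represents p (connesDist D E 𝓔) := by
  let _ : EMetricSpace (State E) :=
    { edist := connesDist D E 𝓔
      edist_self := connesDist_self
      edist_comm := connesDist_comm
      edist_triangle := connesDist_triangle
      eq_of_edist_eq_zero := hE.eq_of_connesDist_eq_zero }
  let _ : MetricSpace (State E) := EMetricSpace.toMetricSpace hE.connesDist_ne_top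
  have : Nonempty (State E) := State.nonempty E
  have : CompactSpace (State E) := by
    refine ⟨isCompact_iff_ultrafilter_le_nhds.2 fun 𝒰 _ => ?_⟩
    obtain ⟨φ, hφ⟩ := State.exists_tendsto 𝒰
    refine ⟨φ, Set.mem_univ _, ?_⟩
    refine Metric.nhds_basis_eball.ge_iff.2 fun ε hε => ?_
    obtain ⟨δ, hδ0, hδ⟩ := ENNReal.lt_iff_exists_nnreal_btwn.1 hε
    have hδ1 : 0 < (δ : ℝ) := by exact_mod_cast hδ0
    -- A net of mesh δ/8 costs 4 · δ/8 = δ/2; the other δ/2 is left for the values on the net.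
    obtain ⟨F, hF, hF2⟩ := hE.totallyBounded (δ / 8) (by positivity)
    have h1 : ∀ᶠ ψ : State E in 𝒰, ∀ b ∈ F, ‖ψ.toLinearMap b - φ.toLinearMap b‖ < δ / 2 := by
      refine (eventually_all_finite hF).2 fun b _ => ?_
      have := (tendsto_iff_norm_sub_tendsto_zero.1 (hφ b))
      exact this.eventually (gt_mem_nhds (by positivity))
    refine mem_of_superset h1 fun ψ hψ => ?_
    refine lt_of_le_of_lt (?_ : connesDist D E 𝓔 ψ φ ≤ ENNReal.ofReal δ) (by simpa using hδ)
    refine connesDist_le_ofReal fun a ha h1 => ?_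
    obtain ⟨c, b, hb, hab⟩ := hF2 a ha h1
    have h2 := State.norm_sub_apply_le ψ φ a b c hab
    have h3 := hψ b hb
    linarith
  obtain ⟨e⟩ := GromovHausdorff.toGHSpace_eq_toGHSpace_iff_isometryEquiv.1
    (GromovHausdorff.GHSpace.toGHSpace_rep (GromovHausdorff.toGHSpace (State E)))
  exact ⟨GromovHausdorff.toGHSpace (State E), e.symm.toEquiv, fun x y => e.symm.isometry x y⟩

end CompactQuantumMetric

/-! ### Gromov–Hausdorff estimates from approximately inverse Lipschitz maps -/

section Approximation

theorem dist_le_of_approx {X Y : Type*} {p q : GromovHausdorff.GHSpace} {δ : X → X → ℝ≥0∞}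
    {δ' : Y → Y → ℝ≥0∞} (hp : Represents p δ) (hq : Represents q δ') (r : X → Y) {ε : ℝ≥0}
    (h1 : ∀ x y, δ' (r x) (r y) ≤ δ x y) (h2 : ∀ x y, δ x y ≤ δ' (r x) (r y) + 2 * ε)
    (h3 : ∀ y, ∃ x, δ' y (r x) ≤ ε) : dist p q ≤ 2 * ε := by
  obtain ⟨e, he⟩ := hp
  obtain ⟨e', he'⟩ := hq
  rw [GromovHausdorff.dist_ghDist]
  -- The general bound is ε₁ + ε₂ / 2 + ε₃, which here is 0 + ε + ε.
  refine (GromovHausdorff.ghDist_le_of_approx_subsets (s := Set.univ) (ε₁ := 0) (ε₂ := 2 * ε)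
    (ε₃ := ε) (fun x => e' (r (e.symm x))) (fun x => ⟨x, Set.mem_univ _, by simp⟩)
    (fun y => ?_) (fun x y => ?_)).trans (by linarith)
  · obtain ⟨x, hx⟩ := h3 (e'.symm y)
    refine ⟨⟨e x, Set.mem_univ _⟩, ?_⟩
    rw [← he', e'.apply_symm_apply, edist_le_coe] at hx
    simpa using NNReal.coe_le_coe.2 hx
  · have hx1 := h1 (e.symm x) (e.symm y)
    have hx2 := h2 (e.symm x) (e.symm y)
    rw [← he, ← he', e.apply_symm_apply, e.apply_symm_apply] at hx1 hx2
    rw [edist_nndist, edist_nndist, ENNReal.coe_le_coe] at hx1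
    rw [edist_nndist, edist_nndist, ← ENNReal.coe_ofNat, ← ENNReal.coe_mul, ← ENNReal.coe_add,
      ENNReal.coe_le_coe] at hx2
    have hx1' := NNReal.coe_le_coe.2 hx1
    have hx2' := NNReal.coe_le_coe.2 hx2
    push_cast at hx1' hx2'
    rw [abs_le, Subtype.dist_eq]
    constructor <;> linarith

variable {H₁ H₂ : Type*} [NormedAddCommGroup H₁] [InnerProductSpace ℂ H₁] [CompleteSpace H₁]
  [NormedAddCommGroup H₂] [InnerProductSpace ℂ H₂] [CompleteSpace H₂]
  {D₁ : H₁ →ₗ.[ℂ] H₁} {E₁ : OperatorSystem H₁} {𝓔₁ : Submodule ℂ (H₁ →L[ℂ] H₁)}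
  {D₂ : H₂ →ₗ.[ℂ] H₂} {E₂ : OperatorSystem H₂} {𝓔₂ : Submodule ℂ (H₂ →L[ℂ] H₂)}

/-- A unital positive map of operator systems which does not increase commutator norms. -/
structure IsLipschitzMap (D₁ : H₁ →ₗ.[ℂ] H₁) (𝓔₁ : Submodule ℂ (H₁ →L[ℂ] H₁))
    (D₂ : H₂ →ₗ.[ℂ] H₂) (𝓔₂ : Submodule ℂ (H₂ →L[ℂ] H₂))
    (r : E₁.toSubmodule →ₗ[ℂ] E₂.toSubmodule) : Prop where
  map_unit : r E₁.unit = E₂.unit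
  map_nonneg : ∀ a : E₁.toSubmodule, (a : H₁ →L[ℂ] H₁).IsPositive → (r a : H₂ →L[ℂ] H₂).IsPositive
  map_mem : ∀ a : E₁.toSubmodule, (a : H₁ →L[ℂ] H₁) ∈ 𝓔₁ → (r a : H₂ →L[ℂ] H₂) ∈ 𝓔₂
  commutatorNorm_le : ∀ a : E₁.toSubmodule, (a : H₁ →L[ℂ] H₁) ∈ 𝓔₁ →
    ∀ C : ℝ≥0, commutatorNorm D₁ (a : H₁ →L[ℂ] H₁) ≤ C →
      commutatorNorm D₂ (r a : H₂ →L[ℂ] H₂) ≤ C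

theorem IsLipschitzMap.connesDist_comap_le {r : E₁.toSubmodule →ₗ[ℂ] E₂.toSubmodule}
    (hr : IsLipschitzMap D₁ 𝓔₁ D₂ 𝓔₂ r) (hE : IsLipschitzSubspace D₂ E₂ 𝓔₂) (φ ψ : State E₂) :
    connesDist D₁ E₁ 𝓔₁ (φ.comap r hr.map_unit hr.map_nonneg)
      (ψ.comap r hr.map_unit hr.map_nonneg) ≤ connesDist D₂ E₂ 𝓔₂ φ ψ := by
  refine connesDist_le fun a ha h1 => ?_
  have := hE.enorm_sub_le φ ψ (r a) (hr.map_mem a ha) (hr.commutatorNorm_le a ha 1 (by simpa))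
  rwa [ENNReal.coe_one, one_mul] at this

theorem connesDist_comap_comap_le {r : E₁.toSubmodule →ₗ[ℂ] E₂.toSubmodule}
    {s : E₂.toSubmodule →ₗ[ℂ] E₁.toSubmodule} (hr : IsLipschitzMap D₁ 𝓔₁ D₂ 𝓔₂ r)
    (hs : IsLipschitzMap D₂ 𝓔₂ D₁ 𝓔₁ s) {ε : ℝ≥0}
    (h : ∀ a : E₁.toSubmodule, (a : H₁ →L[ℂ] H₁) ∈ 𝓔₁ →
      commutatorNorm D₁ (a : H₁ →L[ℂ] H₁) ≤ 1 →
      ‖(a : H₁ →L[ℂ] H₁) - (s (r a) : H₁ →L[ℂ] H₁)‖ ≤ ε) (φ : State E₁) :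
    connesDist D₁ E₁ 𝓔₁ φ ((φ.comap s hs.map_unit hs.map_nonneg).comap r hr.map_unit hr.map_nonneg)
      ≤ (2 * ε : ℝ≥0) := by
  refine (connesDist_le_ofReal (C := 2 * ε) fun a ha h1 => ?_).trans (by
    rw [← NNReal.coe_ofNat, ← NNReal.coe_mul, ENNReal.ofReal_coe_nnreal])
  have h2 := φ.norm_apply_le (a - s (r a))
  rw [map_sub] at h2
  refine h2.trans ?_
  have := h a ha h1
  rw [Submodule.coe_sub]
  linarith

/-- Pull-back along r is 1-Lipschitz from the states of `E₂` to those of `E₁`, and pull-back along s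
is 1-Lipschitz the other way. The two composites move every state by at most 2ε, so pull-back along
r distorts distances by at most 4ε and has 2ε-dense range. -/
theorem dist_le_of_isLipschitzMap {p q : GromovHausdorff.GHSpace}
    (hE₁ : IsLipschitzSubspace D₁ E₁ 𝓔₁) (hE₂ : IsLipschitzSubspace D₂ E₂ 𝓔₂)
    (hp : Represents p (connesDist D₂ E₂ 𝓔₂)) (hq : Represents q (connesDist D₁ E₁ 𝓔₁))
    {r : E₁.toSubmodule →ₗ[ℂ] E₂.toSubmodule} {s : E₂.toSubmodule →ₗ[ℂ] E₁.toSubmodule}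
    (hr : IsLipschitzMap D₁ 𝓔₁ D₂ 𝓔₂ r) (hs : IsLipschitzMap D₂ 𝓔₂ D₁ 𝓔₁ s) {ε : ℝ≥0}
    (h₁ : ∀ a : E₁.toSubmodule, (a : H₁ →L[ℂ] H₁) ∈ 𝓔₁ →
      commutatorNorm D₁ (a : H₁ →L[ℂ] H₁) ≤ 1 →
      ‖(a : H₁ →L[ℂ] H₁) - (s (r a) : H₁ →L[ℂ] H₁)‖ ≤ ε)
    (h₂ : ∀ b : E₂.toSubmodule, (b : H₂ →L[ℂ] H₂) ∈ 𝓔₂ →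
      commutatorNorm D₂ (b : H₂ →L[ℂ] H₂) ≤ 1 →
      ‖(b : H₂ →L[ℂ] H₂) - (r (s b) : H₂ →L[ℂ] H₂)‖ ≤ ε) :
    dist p q ≤ 4 * ε := by
  have := dist_le_of_approx hp hq (fun φ => φ.comap r hr.map_unit hr.map_nonneg) (ε := 2 * ε)
    (hr.connesDist_comap_le hE₂) (fun φ ψ => ?_)
    (fun χ => ⟨χ.comap s hs.map_unit hs.map_nonneg, connesDist_comap_comap_le hr hs h₁ χ⟩)
  · push_cast at this; linarith
  have a1 := connesDist_comap_comap_le hs hr h₂ φ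
  have a2 := connesDist_comap_comap_le hs hr h₂ ψ
  have a3 := hs.connesDist_comap_le hE₁ (φ.comap r hr.map_unit hr.map_nonneg)
    (ψ.comap r hr.map_unit hr.map_nonneg)
  rw [connesDist_comm] at a2
  refine (connesDist_triangle _ _ _).trans ((add_le_add a1 ((connesDist_triangle _ _ _).trans
    (add_le_add a3 a2))).trans (le_of_eq ?_))
  ring

/-- The s-image of a finite net for the Lipschitz ball of `E₂` is a net for that of `E₁`: one ε
comes from a - s(r(a)), the other from the net, since s is contractive and unital. -/
theorem IsLipschitzSubspace.totallyBounded_of_approx (hE₂ : IsLipschitzSubspace D₂ E₂ 𝓔₂)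
    {r : E₁.toSubmodule →ₗ[ℂ] E₂.toSubmodule} {s : E₂.toSubmodule →ₗ[ℂ] E₁.toSubmodule}
    (hle : 𝓔₁ ≤ E₁.toSubmodule)
    (hr : IsLipschitzMap D₁ 𝓔₁ D₂ 𝓔₂ r) (hs : s E₂.unit = E₁.unit)
    (hs' : ∀ b : E₂.toSubmodule, ‖(s b : H₁ →L[ℂ] H₁)‖ ≤ ‖(b : H₂ →L[ℂ] H₂)‖) {ε : ℝ} (hε : 0 < ε)
    (h₁ : ∀ a : E₁.toSubmodule, (a : H₁ →L[ℂ] H₁) ∈ 𝓔₁ →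
      commutatorNorm D₁ (a : H₁ →L[ℂ] H₁) ≤ 1 →
      ‖(a : H₁ →L[ℂ] H₁) - (s (r a) : H₁ →L[ℂ] H₁)‖ ≤ ε) :
    ∃ F : Set E₁.toSubmodule, F.Finite ∧ ∀ a ∈ 𝓔₁, commutatorNorm D₁ a ≤ 1 →
      ∃ c : ℂ, ∃ b ∈ F, ‖a - c • (1 : H₁ →L[ℂ] H₁) - b‖ ≤ 2 * ε := by
  obtain ⟨F, hF, hF2⟩ := hE₂.totallyBounded ε hε
  refine ⟨s '' F, hF.image _, fun a ha h1 => ?_⟩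
  obtain ⟨c, b, hb, hab⟩ := hF2 (r ⟨a, hle ha⟩) (hr.map_mem _ ha)
    (hr.commutatorNorm_le _ ha 1 (by simpa using h1))
  refine ⟨c, s b, Set.mem_image_of_mem _ hb, ?_⟩
  have h2 := h₁ ⟨a, hle ha⟩ ha h1
  have h3 := (hs' (r ⟨a, hle ha⟩ - c • E₂.unit - b)).trans hab
  rw [map_sub, map_sub, map_smul, hs] at h3
  have h4 : a - c • (1 : H₁ →L[ℂ] H₁) - (s b : H₁ →L[ℂ] H₁) =
    (a - (s (r ⟨a, hle ha⟩) : H₁ →L[ℂ] H₁)) +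
      ((s (r ⟨a, hle ha⟩) - c • E₁.unit - s b : E₁.toSubmodule) : H₁ →L[ℂ] H₁) := by
    simp only [OperatorSystem.unit, Submodule.coe_sub, Submodule.coe_smul]
    abel
  rw [h4]
  refine (norm_add_le _ _).trans ?_
  linarith

end Approximation

/-! ### Characters of the torus and their calculus -/

section Characters

variable {d : ℕ}

/-- The character `e_n` of the torus. -/
def torusChar (n : Fin d → ℤ) : C(Torus d, ℂ) where
  toFun x := ∏ i, fourier (n i) (x i)
  continuous_toFun := by fun_prop

theorem proj_add (x y : Fin d → ℝ) : proj d (x + y) = proj d x + proj d y := by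
  ext i; simp [proj]

theorem proj_zero : proj d 0 = 0 := by
  ext i; simp [proj]

theorem torusChar_proj (n : Fin d → ℤ) (x : Fin d → ℝ) :
    torusChar n (proj d x) = Complex.exp (Complex.I * ∑ i, (n i : ℂ) * x i) := by
  rw [Finset.mul_sum, Complex.exp_sum]
  change ∏ i, fourier (n i) (proj d x i) = _
  refine Finset.prod_congr rfl fun i _ => ?_
  rw [proj, fourier_coe_apply]
  congr 1
  have : (π : ℂ) ≠ 0 := by exact_mod_cast Real.pi_ne_zero
  push_cast
  field_simp

theorem torusChar_neg (n : Fin d → ℤ) (x : Torus d) :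
    torusChar (-n) x = starRingEnd ℂ (torusChar n x) := by
  simp only [torusChar, Pi.neg_apply, fourier_neg, ContinuousMap.coe_mk, map_prod]

theorem torusChar_add (m n : Fin d → ℤ) (x : Torus d) :
    torusChar (m + n) x = torusChar m x * torusChar n x := by
  simp only [torusChar, Pi.add_apply, fourier_add, ContinuousMap.coe_mk, ← Finset.prod_mul_distrib]

theorem torusChar_zero : torusChar (0 : Fin d → ℤ) = 1 := by
  ext x; simp [torusChar]

theorem norm_torusChar_apply (n : Fin d → ℤ) (x : Torus d) : ‖torusChar n x‖ = 1 := by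
  simp only [torusChar, ContinuousMap.coe_mk, norm_prod, fourier_apply, Circle.norm_coe,
    Finset.prod_const_one]

theorem torusChar_apply_add (n : Fin d → ℤ) (x y : Torus d) :
    torusChar n (x + y) = torusChar n x * torusChar n y := by
  obtain ⟨x, rfl⟩ := proj_isOpenQuotientMap.surjective x
  obtain ⟨y, rfl⟩ := proj_isOpenQuotientMap.surjective y
  rw [← proj_add, torusChar_proj, torusChar_proj, torusChar_proj, ← Complex.exp_add, ← mul_add,
    ← Finset.sum_add_distrib]
  simp [mul_add]

theorem conj_mul_torusChar (m n : Fin d → ℤ) (x : Torus d) :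
    starRingEnd ℂ (torusChar m x) * torusChar n x = torusChar (n - m) x := by
  rw [← torusChar_neg, ← torusChar_add, neg_add_eq_sub]

theorem torusChar_single (μ : Fin d) (x : Torus d) :
    torusChar (Pi.single μ 1) x = fourier 1 (x μ) := by
  simp only [torusChar, ContinuousMap.coe_mk]
  rw [Finset.prod_eq_single μ]
  · simp
  · intro i _ hi; simp [hi]
  · simp

/-- Stone–Weierstrass. The span is already a star algebra because characters are closed under
products and conjugation, and the coordinate characters separate points. -/
theorem span_torusChar_closure_eq_top :
    (Submodule.span ℂ (Set.range (torusChar (d := d)))).topologicalClosure = ⊤ := by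
  let A : StarSubalgebra ℂ C(Torus d, ℂ) :=
    { toSubalgebra := Algebra.adjoin ℂ (Set.range torusChar)
      star_mem' := by
        change Algebra.adjoin ℂ (Set.range torusChar) ≤ star (Algebra.adjoin ℂ (Set.range torusChar))
        refine Algebra.adjoin_le ?_
        rintro _ ⟨n, rfl⟩
        refine Algebra.subset_adjoin ⟨-n, ?_⟩
        ext1 x
        simp only [torusChar_neg, starRingEnd_apply, ContinuousMap.star_apply] }
  have h1 : A.toSubalgebra.toSubmodule = Submodule.span ℂ (Set.range torusChar) := by
    apply Algebra.adjoin_eq_span_of_subset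
    refine .trans (fun x ↦ Submonoid.closure_induction (fun _ ↦ id) ⟨0, torusChar_zero⟩ ?_)
      Submodule.subset_span
    rintro _ _ _ _ ⟨m, rfl⟩ ⟨n, rfl⟩
    exact ⟨m + n, by ext z; exact torusChar_add m n z⟩
  have h2 : A.SeparatesPoints := by
    intro x y hxy
    obtain ⟨i, hi⟩ := Function.ne_iff.1 hxy
    refine ⟨_, ⟨torusChar (Pi.single i 1), Algebra.subset_adjoin ⟨Pi.single i 1, rfl⟩, rfl⟩, ?_⟩
    dsimp only
    rw [torusChar_single, torusChar_single, fourier_one, fourier_one]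
    exact fun h => hi (AddCircle.injective_toCircle Real.two_pi_pos.ne' (Circle.ext h))
  rw [← h1]
  exact congr_arg (Subalgebra.toSubmodule <| StarSubalgebra.toSubalgebra ·)
    (ContinuousMap.starSubalgebra_topologicalClosure_eq_top_of_separatesPoints A h2)

theorem integral_torusChar (n : Fin d → ℤ) :
    ∫ x, torusChar n x ∂torusMeasure d = if n = 0 then 1 else 0 := by
  split_ifs with h
  · rw [h, torusChar_zero]; simp
  · simp only [torusChar, ContinuousMap.coe_mk]
    rw [torusMeasure, integral_fintype_prod_eq_prod (𝕜 := ℂ) (fun i => ⇑(fourier (n i)))]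
    obtain ⟨i, hi⟩ := Function.ne_iff.mp h
    apply Finset.prod_eq_zero (Finset.mem_univ i)
    have := (orthonormal_iff_ite.mp <| orthonormal_fourier (T := 2 * π)) 0 (n i)
    have hi' : (0 : ℤ) ≠ n i := fun h => hi h.symm
    simpa [ContinuousMap.inner_toLp, hi'] using this

theorem isSmooth_torusChar (n : Fin d → ℤ) : IsSmooth (torusChar n) := by
  have h : (fun x : Fin d → ℝ => torusChar n (proj d x)) =
      fun x => Complex.exp (Complex.I * ∑ i, (n i : ℂ) * x i) := funext (torusChar_proj n)
  rw [IsSmooth, h]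
  refine Complex.contDiff_exp.comp (contDiff_const.mul (ContDiff.sum fun i _ => contDiff_const.mul ?_))
  exact Complex.ofRealCLM.contDiff.comp (contDiff_apply ℝ ℝ i)

theorem hasDerivAt_torusChar_shift (n : Fin d → ℤ) (μ : Fin d) (x : Torus d) :
    HasDerivAt (fun t : ℝ => torusChar n (x + proj d (Pi.single μ t)))
      (Complex.I * n μ * torusChar n x) 0 := by
  have h : ∀ t : ℝ, torusChar n (x + proj d (Pi.single μ t)) =
      torusChar n x * Complex.exp (Complex.I * n μ * t) := by
    intro t
    rw [torusChar_apply_add, torusChar_proj, Finset.sum_eq_single μ]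
    · simp [mul_assoc]
    · intro i _ hi; simp [hi]
    · simp
  have h1 : HasDerivAt (fun t : ℝ => Complex.I * n μ * (t : ℂ)) (Complex.I * n μ * 1) (0 : ℝ) :=
    (Complex.ofRealCLM.hasDerivAt (x := (0 : ℝ))).const_mul _
  have h2 := (h1.cexp).const_mul (torusChar n x)
  rw [funext h]
  refine h2.congr_deriv ?_
  rw [Complex.ofReal_zero, mul_zero, Complex.exp_zero]
  ring

theorem partialDeriv_torusChar (n : Fin d → ℤ) (μ : Fin d) (x : Torus d) :
    partialDeriv μ (torusChar n) x = Complex.I * n μ * torusChar n x :=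
  (hasDerivAt_torusChar_shift n μ x).deriv

theorem IsSmooth.smul {F : Type*} [NormedAddCommGroup F] [NormedSpace ℂ F] {f : Torus d → ℂ}
    {g : Torus d → F} (hf : IsSmooth f) (hg : IsSmooth g) : IsSmooth fun x => f x • g x :=
  ContDiff.smul hf hg

theorem partialDeriv_smul {F : Type*} [NormedAddCommGroup F] [NormedSpace ℂ F] {f : Torus d → ℂ}
    {g : Torus d → F} (hf : IsSmooth f) (hg : IsSmooth g) (μ : Fin d) (x : Torus d) :
    partialDeriv μ (fun x => f x • g x) x = f x • partialDeriv μ g x + partialDeriv μ f x • g x := by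
  have h := ((differentiableAt_shift hf μ x).hasDerivAt.smul
    (differentiableAt_shift hg μ x).hasDerivAt).deriv
  simp only [Pi.single_zero, proj_zero, add_zero] at h
  exact h

/-- Translation invariance of the measure makes the integral of a derivative vanish. -/
theorem integral_partialDeriv {f : Torus d → ℂ} (hf : IsSmooth f) (hc : Continuous f) (μ : Fin d) :
    ∫ x, partialDeriv μ f x ∂torusMeasure d = 0 := by
  have hder : ∀ x : Torus d, ∀ t : ℝ, HasDerivAt (fun t : ℝ => f (x + proj d (Pi.single μ t)))
      (partialDeriv μ f (x + proj d (Pi.single μ t))) t := by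
    intro x t
    have h1 := (differentiableAt_shift hf μ (x + proj d (Pi.single μ t))).hasDerivAt
    have h2 : HasDerivAt (fun s : ℝ => s - t) 1 t := (hasDerivAt_id t).sub_const t
    have h1' : HasDerivAt (fun s : ℝ => f (x + proj d (Pi.single μ t) + proj d (Pi.single μ s)))
      (partialDeriv μ f (x + proj d (Pi.single μ t))) (t - t) := by rw [sub_self]; exact h1
    have h3 := HasDerivAt.scomp (h := fun s : ℝ => s - t) t h1' h2
    rw [one_smul] at h3
    refine h3.congr_of_eventuallyEq (Eventually.of_forall fun s => ?_)
    simp only [Function.comp]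
    rw [add_assoc, ← proj_add, ← Pi.single_add, add_sub_cancel]
  have hcd := continuous_partialDeriv hf μ
  obtain ⟨M, hM⟩ := (isCompact_univ (X := Torus d)).exists_bound_of_continuousOn hcd.continuousOn
  have hint : ∀ g : Torus d → ℂ, Continuous g → Integrable g (torusMeasure d) := fun g hg =>
    hg.integrable_of_hasCompactSupport (HasCompactSupport.of_compactSpace g)
  have key := hasDerivAt_integral_of_dominated_loc_of_deriv_le (μ := torusMeasure d)
    (F := fun (t : ℝ) (x : Torus d) => f (x + proj d (Pi.single μ t)))
    (F' := fun (t : ℝ) (x : Torus d) => partialDeriv μ f (x + proj d (Pi.single μ t)))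
    (x₀ := 0) (s := Set.univ) (bound := fun _ => M) univ_mem
    (Eventually.of_forall fun t => (hc.comp (continuous_id.add continuous_const)).aestronglyMeasurable)
    (hint _ (hc.comp (continuous_id.add continuous_const)))
    (hcd.comp (continuous_id.add continuous_const)).aestronglyMeasurable
    (Eventually.of_forall fun x t _ => hM _ (Set.mem_univ _))
    (integrable_const M)
    (Eventually.of_forall fun x t _ => hder x t)
  have h0 : ∀ t : ℝ, ∫ x, f (x + proj d (Pi.single μ t)) ∂torusMeasure d =
      ∫ x, f x ∂torusMeasure d := fun t => integral_add_right_eq_self f _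
  have h1 := key.2
  simp only [h0] at h1
  have h2 := h1.unique (hasDerivAt_const 0 _)
  simpa [proj_zero] using h2

end Characters

section

variable {d : ℕ}

/-! ### Clifford multiplication by frequency vectors -/

section Clifford

variable (Γ : GammaMatrices d)

/-- Clifford multiplication by the `μ`-th basis vector. -/
def gammaCLM (μ : Fin d) : Spinor d →L[ℂ] Spinor d := Matrix.toEuclideanCLM (𝕜 := ℂ) (Γ.γ μ)

theorem inner_gammaCLM (μ : Fin d) (v w : Spinor d) :
    inner ℂ (gammaCLM Γ μ v) w = inner ℂ v (gammaCLM Γ μ w) := by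
  have h : star (gammaCLM Γ μ) = gammaCLM Γ μ := by
    rw [gammaCLM, ← map_star, Matrix.star_eq_conjTranspose, (Γ.isHermitian μ).eq]
  rw [← ContinuousLinearMap.adjoint_inner_right, ← ContinuousLinearMap.star_eq_adjoint, h]

theorem gammaCLM_anticomm (μ ν : Fin d) (v : Spinor d) :
    gammaCLM Γ μ (gammaCLM Γ ν v) + gammaCLM Γ ν (gammaCLM Γ μ v) =
      (if μ = ν then 2 else 0 : ℂ) • v := by
  have h := congrArg (fun A => Matrix.toEuclideanCLM (𝕜 := ℂ) A v) (Γ.clifford μ ν)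
  simp only [map_add, map_mul, add_apply, mul_apply_eq_comp] at h
  rw [gammaCLM, gammaCLM, h]
  split_ifs
  · rw [map_ofNat, ← Nat.cast_ofNat (R := Spinor d →L[ℂ] Spinor d), ← nsmul_one, smul_apply]
    simp [two_smul]
  · simp

theorem gammaCLM_gammaCLM (μ : Fin d) (v : Spinor d) : gammaCLM Γ μ (gammaCLM Γ μ v) = v := by
  have h := gammaCLM_anticomm Γ μ μ v
  rw [if_pos rfl, ← two_smul ℂ] at h
  exact smul_right_injective _ two_ne_zero h

theorem norm_gammaCLM (μ : Fin d) (v : Spinor d) : ‖gammaCLM Γ μ v‖ = ‖v‖ := by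
  rw [@norm_eq_sqrt_re_inner ℂ, @norm_eq_sqrt_re_inner ℂ _ _ _ _ v, inner_gammaCLM,
    gammaCLM_gammaCLM]

/-- Clifford multiplication by a frequency vector. -/
def cliffordMul (k : Fin d → ℤ) : Spinor d →L[ℂ] Spinor d := ∑ μ, (k μ : ℂ) • gammaCLM Γ μ

theorem cliffordMul_apply (k : Fin d → ℤ) (v : Spinor d) :
    cliffordMul Γ k v = ∑ μ, (k μ : ℂ) • gammaCLM Γ μ v := by
  simp [cliffordMul]

theorem cliffordMul_sub (k l : Fin d → ℤ) (v : Spinor d) :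
    cliffordMul Γ (k - l) v = cliffordMul Γ k v - cliffordMul Γ l v := by
  simp [cliffordMul_apply, sub_smul, Finset.sum_sub_distrib]

theorem inner_cliffordMul (k : Fin d → ℤ) (v w : Spinor d) :
    inner ℂ (cliffordMul Γ k v) w = inner ℂ v (cliffordMul Γ k w) := by
  simp only [cliffordMul_apply, sum_inner, inner_sum, inner_smul_left, inner_smul_right,
    inner_gammaCLM, map_intCast]

/-- Only the μ-th term of the sum survives anticommutation. This recovers a single coordinate of the
frequency from Clifford multiplication, and hence [-i∂_μ, T] from [D, T]. -/
theorem gammaCLM_cliffordMul (μ : Fin d) (k : Fin d → ℤ) (v : Spinor d) :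
    gammaCLM Γ μ (cliffordMul Γ k v) + cliffordMul Γ k (gammaCLM Γ μ v) =
      (2 * k μ : ℂ) • v := by
  simp only [cliffordMul_apply, map_sum, map_smul, ← Finset.sum_add_distrib, ← smul_add,
    gammaCLM_anticomm, smul_smul, ← Finset.sum_smul]
  simp [mul_comm]

/-- Twice the square is a sum of anticommutators with the individual γ^μ. The identity makes ±|k|
the only possible eigenvalues of D on e_k ⊗ V. -/
theorem cliffordMul_cliffordMul (k : Fin d → ℤ) (v : Spinor d) :
    cliffordMul Γ k (cliffordMul Γ k v) = ((∑ μ, k μ ^ 2 : ℤ) : ℂ) • v := by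
  have h : (2 : ℂ) • cliffordMul Γ k (cliffordMul Γ k v) =
      (2 : ℂ) • ((∑ μ, k μ ^ 2 : ℤ) : ℂ) • v := by
    rw [two_smul]
    nth_rw 1 [cliffordMul_apply]
    nth_rw 3 [cliffordMul_apply]
    rw [map_sum, ← Finset.sum_add_distrib]
    simp only [map_smul, ← smul_add, gammaCLM_cliffordMul, smul_smul, ← Finset.sum_smul]
    congr 1
    push_cast
    rw [Finset.mul_sum]
    exact Finset.sum_congr rfl fun μ _ => by ring
  exact smul_right_injective _ two_ne_zero h

end Clifford

/-! ### Plane waves: orthogonality, completeness, Toeplitz form of multiplication -/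

section PlaneWaves

theorem inner_toLp_toLp (F G : C(Torus d, Spinor d)) :
    inner ℂ (ContinuousMap.toLp 2 (torusMeasure d) ℂ F : SpinorL2 d)
      (ContinuousMap.toLp 2 (torusMeasure d) ℂ G) = ∫ x, inner ℂ (F x) (G x) ∂torusMeasure d := by
  rw [L2.inner_def]
  refine integral_congr_ae ?_
  filter_upwards [F.coeFn_toLp (p := 2) (𝕜 := ℂ) (torusMeasure d),
    G.coeFn_toLp (p := 2) (𝕜 := ℂ) (torusMeasure d)] with x h1 h2
  rw [h1, h2]

/-- The spinor `e_n ⊗ v`, as a smooth function. -/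
def smoothWave (n : Fin d → ℤ) : Spinor d →ₗ[ℂ] smoothFunctions d (Spinor d) where
  toFun v := ⟨⟨fun x => torusChar n x • v, by fun_prop⟩,
    ContDiff.smul (isSmooth_torusChar n) contDiff_const⟩
  map_add' v w := by ext x : 2; exact smul_add _ _ _
  map_smul' c v := by ext x : 2; exact smul_comm _ _ _

theorem smoothWave_apply (n : Fin d → ℤ) (v : Spinor d) (x : Torus d) :
    (smoothWave n v).1 x = torusChar n x • v := rfl

/-- The spinor `e_n ⊗ v`, as an element of `L²`. -/
def planeWave (n : Fin d → ℤ) : Spinor d →L[ℂ] SpinorL2 d :=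
  LinearMap.toContinuousLinearMap (smoothToL2 d ∘ₗ smoothWave n)

theorem inner_planeWave_toLp (n : Fin d → ℤ) (v : Spinor d) (G : C(Torus d, Spinor d)) :
    inner ℂ (planeWave n v) (ContinuousMap.toLp 2 (torusMeasure d) ℂ G) =
      ∫ x, starRingEnd ℂ (torusChar n x) * inner ℂ v (G x) ∂torusMeasure d := by
  refine (inner_toLp_toLp _ G).trans (integral_congr_ae (Eventually.of_forall fun x => ?_))
  exact inner_smul_left _ _ _

theorem mulOp_toLp (f : C(Torus d, ℂ)) (G : C(Torus d, Spinor d)) :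
    mulOp d f (ContinuousMap.toLp 2 (torusMeasure d) ℂ G) =
      ContinuousMap.toLp 2 (torusMeasure d) ℂ (f • G) := by
  refine Lp.ext ?_
  filter_upwards [mulOp_ae f (ContinuousMap.toLp 2 (torusMeasure d) ℂ G),
    G.coeFn_toLp (p := 2) (𝕜 := ℂ) (torusMeasure d),
    (f • G).coeFn_toLp (p := 2) (𝕜 := ℂ) (torusMeasure d)] with x h1 h2 h3
  rw [h1, h2, h3]; rfl

/-- The Fourier coefficients of a continuous function. -/
def fCoeff (f : C(Torus d, ℂ)) (k : Fin d → ℤ) : ℂ :=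
  ∫ x, starRingEnd ℂ (torusChar k x) * f x ∂torusMeasure d

theorem inner_planeWave_mulOp_planeWave (f : C(Torus d, ℂ)) (m n : Fin d → ℤ) (v w : Spinor d) :
    inner ℂ (planeWave m v) (mulOp d f (planeWave n w)) = fCoeff f (m - n) * inner ℂ v w := by
  have h : mulOp d f (planeWave n w) = ContinuousMap.toLp 2 (torusMeasure d) ℂ
      (f • (smoothWave n w).1) := mulOp_toLp _ _
  rw [h, inner_planeWave_toLp, fCoeff, ← integral_mul_const]
  refine integral_congr_ae (Eventually.of_forall fun x => ?_)
  have h2 : (f • (smoothWave n w).1) x = f x • torusChar n x • w := rfl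
  have h3 : starRingEnd ℂ (torusChar (m - n) x) =
      starRingEnd ℂ (torusChar m x) * torusChar n x := by
    rw [conj_mul_torusChar, ← torusChar_neg, neg_sub]
  simp only [h2, h3, inner_smul_right]
  ring

theorem inner_planeWave_planeWave (m n : Fin d → ℤ) (v w : Spinor d) :
    inner ℂ (planeWave m v) (planeWave n w) = if m = n then inner ℂ v w else 0 := by
  have h := inner_planeWave_mulOp_planeWave 1 m n v w
  rw [mulOp_one, one_apply_eq_self] at h
  rw [h, fCoeff]
  simp only [ContinuousMap.one_apply, mul_one, ← torusChar_neg, integral_torusChar, neg_eq_zero,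
    sub_eq_zero]
  split_ifs <;> simp

/-- The spinor with Fourier coefficients `ξ n`, `n ∈ B`. -/
def fourierSum (B : Finset (Fin d → ℤ)) (ξ : (Fin d → ℤ) → Spinor d) : SpinorL2 d :=
  ∑ n ∈ B, planeWave n (ξ n)

theorem norm_fourierSum (B : Finset (Fin d → ℤ)) (ξ : (Fin d → ℤ) → Spinor d) :
    ‖fourierSum B ξ‖ = √(∑ n ∈ B, ‖ξ n‖ ^ 2) := by
  rw [@norm_eq_sqrt_re_inner ℂ]
  congr 1
  simp only [fourierSum, sum_inner, inner_sum, inner_planeWave_planeWave, Finset.sum_ite_eq']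
  rw [map_sum]
  refine Finset.sum_congr rfl fun n hn => ?_
  rw [if_pos hn, inner_self_eq_norm_sq_to_K]
  norm_cast

theorem inner_fourierSum_mulOp_fourierSum (B : Finset (Fin d → ℤ)) (f : C(Torus d, ℂ))
    (η ξ : (Fin d → ℤ) → Spinor d) :
    inner ℂ (fourierSum B η) (mulOp d f (fourierSum B ξ)) =
      ∑ m ∈ B, ∑ n ∈ B, fCoeff f (m - n) * inner ℂ (η m) (ξ n) := by
  simp only [fourierSum, map_sum, sum_inner, inner_sum, inner_planeWave_mulOp_planeWave]
  exact Finset.sum_comm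

/-- Continuous spinors are dense in L², and each is a sum of scalar functions times constant
spinors. The scalar factors are uniform limits of trigonometric polynomials, which turn constant
spinors into sums of plane waves. -/
theorem span_planeWave_closure_eq_top :
    (Submodule.span ℂ {ψ : SpinorL2 d | ∃ n v, ψ = planeWave n v}).topologicalClosure = ⊤ := by
  set S := (Submodule.span ℂ {ψ : SpinorL2 d | ∃ n v, ψ = planeWave n v}).topologicalClosure with hS
  have hScl : IsClosed (S : Set (SpinorL2 d)) := Submodule.isClosed_topologicalClosure _
  have h1 : ∀ (v : Spinor d) (g : C(Torus d, ℂ)), mulOp d g (planeWave 0 v) ∈ S := by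
    intro v g
    have hc : Continuous fun g : C(Torus d, ℂ) => mulOp d g (planeWave 0 v) := by
      have h2 : Continuous (mulOp d) :=
        (((ContinuousLinearMap.lsmul ℂ ℂ : ℂ →L[ℂ] Spinor d →L[ℂ] Spinor d).holderL
          (torusMeasure d) ∞ 2 2).comp (ContinuousMap.toLp ∞ (torusMeasure d) ℂ)).continuous
      exact h2.clm_apply continuous_const
    have hg : g ∈ (Submodule.span ℂ (Set.range (torusChar (d := d)))).topologicalClosure := by
      rw [span_torusChar_closure_eq_top]; trivial
    refine closure_minimal (s := ↑(Submodule.span ℂ (Set.range (torusChar (d := d)))))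
      (t := (fun g : C(Torus d, ℂ) => mulOp d g (planeWave 0 v)) ⁻¹' S) ?_ (hScl.preimage hc) hg
    intro p hp
    induction hp using Submodule.span_induction with
    | mem p hp =>
      obtain ⟨n, rfl⟩ := hp
      refine Submodule.le_topologicalClosure _ (Submodule.subset_span ⟨n, v, ?_⟩)
      have : mulOp d (torusChar n) (planeWave 0 v) = ContinuousMap.toLp 2 (torusMeasure d) ℂ
        (torusChar n • (smoothWave 0 v).1) := mulOp_toLp _ _
      simp only [this]
      change _ = ContinuousMap.toLp 2 (torusMeasure d) ℂ (smoothWave n v).1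
      congr 1
      ext x : 1
      change torusChar n x • torusChar 0 x • v = torusChar n x • v
      simp [torusChar_zero]
    | zero => simp
    | add p q _ _ hp hq =>
      simp only [Set.mem_preimage, map_add, add_apply] at hp hq ⊢
      exact S.add_mem hp hq
    | smul c p _ hp =>
      simp only [Set.mem_preimage, map_smul, smul_apply] at hp ⊢
      exact S.smul_mem c hp
  have h2 : ∀ F : C(Torus d, Spinor d), ContinuousMap.toLp 2 (torusMeasure d) ℂ F ∈ S := by
    intro F
    have hF : ContinuousMap.toLp 2 (torusMeasure d) ℂ F =
        ∑ i, mulOp d ⟨fun x => F x i, by fun_prop⟩ (planeWave 0 (EuclideanSpace.single i 1)) := by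
      have : ∀ i, mulOp d ⟨fun x => F x i, by fun_prop⟩ (planeWave 0 (EuclideanSpace.single i 1)) =
          ContinuousMap.toLp 2 (torusMeasure d) ℂ ((⟨fun x => F x i, by fun_prop⟩ : C(Torus d, ℂ)) •
            (smoothWave 0 (EuclideanSpace.single i (1 : ℂ))).1) := fun i => mulOp_toLp _ _
      simp only [this, ← map_sum]
      congr 1
      ext x j
      rw [ContinuousMap.sum_apply, WithLp.ofLp_sum, Finset.sum_apply, Finset.sum_eq_single j]
      · simp [smoothWave_apply, torusChar_zero]
      · intro i _ hi; simp [smoothWave_apply, hi.symm]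
      · simp
    rw [hF]
    exact S.sum_mem fun i _ => h1 _ _
  rw [eq_top_iff]
  intro ψ _
  exact closure_minimal (t := (S : Set (SpinorL2 d))) (by rintro _ ⟨F, rfl⟩; exact h2 F) hScl
    (ContinuousMap.toLp_denseRange (Spinor d) (torusMeasure d) ℂ (p := 2) (by simp) ψ)

theorem eq_zero_of_inner_planeWave {ψ : SpinorL2 d}
    (h : ∀ n v, inner ℂ (planeWave n v) ψ = 0) : ψ = 0 := by
  have h1 : (Submodule.span ℂ {ψ : SpinorL2 d | ∃ n v, ψ = planeWave n v})ᗮ = ⊥ := by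
    rw [← Submodule.topologicalClosure_eq_top_iff, span_planeWave_closure_eq_top]
  have h2 : ψ ∈ (Submodule.span ℂ {ψ : SpinorL2 d | ∃ n v, ψ = planeWave n v})ᗮ := by
    rw [Submodule.mem_orthogonal]
    intro u hu
    induction hu using Submodule.span_induction with
    | mem u hu => obtain ⟨n, v, rfl⟩ := hu; exact h n v
    | zero => simp
    | add p q _ _ hp hq => rw [inner_add_left, hp, hq, add_zero]
    | smul c p _ hp => rw [inner_smul_left, hp, mul_zero]
  rw [h1] at h2
  exact h2

theorem eq_fourierSum_of_inner_eq_zero {ψ : SpinorL2 d} (B : Finset (Fin d → ℤ))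
    (h : ∀ n ∉ B, ∀ v, inner ℂ (planeWave n v) ψ = 0) :
    ψ = fourierSum B fun n => ContinuousLinearMap.adjoint (planeWave n) ψ := by
  rw [← sub_eq_zero]
  refine eq_zero_of_inner_planeWave fun n v => ?_
  simp only [inner_sub_right, fourierSum, inner_sum, inner_planeWave_planeWave, Finset.sum_ite_eq]
  split_ifs with hn
  · rw [ContinuousLinearMap.adjoint_inner_right, sub_self]
  · rw [h n hn, sub_zero]

theorem dense_fourierSum :
    Dense {ψ : SpinorL2 d | ∃ B ξ, ψ = fourierSum B ξ} := by
  have h : (Submodule.span ℂ {ψ : SpinorL2 d | ∃ n v, ψ = planeWave n v} : Set (SpinorL2 d)) ⊆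
      {ψ : SpinorL2 d | ∃ B ξ, ψ = fourierSum B ξ} := by
    intro ψ hψ
    classical
    have hext : ∀ (B C : Finset (Fin d → ℤ)) (ξ : (Fin d → ℤ) → Spinor d), B ⊆ C →
        fourierSum B ξ = fourierSum C fun n => if n ∈ B then ξ n else 0 := by
      intro B C ξ hBC
      rw [fourierSum, fourierSum, ← Finset.sum_subset hBC]
      · exact Finset.sum_congr rfl fun n hn => by rw [if_pos hn]
      · intro n _ hn; rw [if_neg hn, map_zero]
    induction hψ using Submodule.span_induction with
    | mem u hu => obtain ⟨n, v, rfl⟩ := hu; exact ⟨{n}, fun _ => v, by simp [fourierSum]⟩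
    | zero => exact ⟨∅, 0, by simp [fourierSum]⟩
    | add p q _ _ hp hq =>
      obtain ⟨B, ξ, rfl⟩ := hp
      obtain ⟨C, η, rfl⟩ := hq
      rw [hext B (B ∪ C) ξ Finset.subset_union_left, hext C (B ∪ C) η Finset.subset_union_right]
      refine ⟨B ∪ C, fun n => (if n ∈ B then ξ n else 0) + if n ∈ C then η n else 0, ?_⟩
      rw [fourierSum, fourierSum, ← Finset.sum_add_distrib]
      simp only [← map_add]
      rw [fourierSum]
    | smul c p _ hp =>
      obtain ⟨B, ξ, rfl⟩ := hp
      exact ⟨B, c • ξ, by simp [fourierSum, Finset.smul_sum]⟩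
  refine Dense.mono h ?_
  exact (Submodule.dense_iff_topologicalClosure_eq_top).2 span_planeWave_closure_eq_top

end PlaneWaves

end

section

variable {d : ℕ} (Γ : GammaMatrices d)

/-! ### The closed Dirac operator in Fourier space -/

section Dirac

theorem diracSmooth_apply (ψ : smoothFunctions d (Spinor d)) (x : Torus d) :
    diracSmooth Γ ψ x = -Complex.I • ∑ μ, gammaCLM Γ μ (partialDeriv μ ψ.1 x) := rfl

theorem diracCore_mem_graph_iff (p : SpinorL2 d × SpinorL2 d) :
    p ∈ (diracCore Γ).graph ↔ ∃ ψ, p = (smoothToL2 d ψ,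
      (ContinuousMap.toLp 2 (torusMeasure d) ℂ (diracSmooth Γ ψ) : SpinorL2 d)) := by
  have h : ∀ ψ, diracCore Γ ⟨smoothToL2 d ψ, ψ, rfl⟩ =
      (ContinuousMap.toLp 2 (torusMeasure d) ℂ (diracSmooth Γ ψ) : SpinorL2 d) := by
    intro ψ
    have h1 : (LinearEquiv.ofInjective (smoothToL2 d) smoothToL2_injective).symm
        ⟨smoothToL2 d ψ, ψ, rfl⟩ = ψ := by
      rw [LinearEquiv.symm_apply_eq]; rfl
    exact congrArg (fun χ => (ContinuousMap.toLp 2 (torusMeasure d) ℂ (diracSmooth Γ χ) :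
      SpinorL2 d)) h1
  rw [LinearPMap.mem_graph_iff]
  constructor
  · rintro ⟨⟨_, ψ, rfl⟩, h1, h2⟩
    exact ⟨ψ, Prod.ext h1.symm (by rw [← h2, h])⟩
  · rintro ⟨ψ, rfl⟩
    exact ⟨⟨smoothToL2 d ψ, ψ, rfl⟩, rfl, h ψ⟩

theorem partialDeriv_clm {F G : Type*} [NormedAddCommGroup F] [NormedSpace ℂ F]
    [NormedAddCommGroup G] [NormedSpace ℂ G] (L : F →L[ℂ] G) {f : Torus d → F} (hf : IsSmooth f)
    (μ : Fin d) (x : Torus d) :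
    partialDeriv μ (fun x => L (f x)) x = L (partialDeriv μ f x) :=
  ((L.restrictScalars ℝ).hasFDerivAt.comp_hasDerivAt (0 : ℝ)
    (differentiableAt_shift hf μ x).hasDerivAt).deriv

/-- Integration by parts: the difference of the two integrands is a sum of partial derivatives of
smooth functions, each of integral zero. -/
theorem inner_planeWave_diracSmooth (ψ : smoothFunctions d (Spinor d)) (n : Fin d → ℤ)
    (v : Spinor d) :
    inner ℂ (planeWave n v) (ContinuousMap.toLp 2 (torusMeasure d) ℂ (diracSmooth Γ ψ)) =
      inner ℂ (planeWave n (cliffordMul Γ n v)) (smoothToL2 d ψ) := by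
  have hψ : smoothToL2 d ψ = ContinuousMap.toLp 2 (torusMeasure d) ℂ ψ.1 := rfl
  have hint : ∀ g : Torus d → ℂ, Continuous g → Integrable g (torusMeasure d) := fun g hg =>
    hg.integrable_of_hasCompactSupport (HasCompactSupport.of_compactSpace g)
  rw [hψ, inner_planeWave_toLp, inner_planeWave_toLp, ← sub_eq_zero, ← integral_sub]
  · have hsm : ∀ μ, IsSmooth fun x => inner ℂ (gammaCLM Γ μ v) (ψ.1 x) := fun μ =>
      ((innerSL ℂ (gammaCLM Γ μ v)).restrictScalars ℝ).contDiff.comp ψ.2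
    have hsm2 : ∀ μ, IsSmooth fun x => torusChar (-n) x • inner ℂ (gammaCLM Γ μ v) (ψ.1 x) :=
      fun μ => (isSmooth_torusChar _).smul (hsm μ)
    have h1 : ∀ x, starRingEnd ℂ (torusChar n x) * inner ℂ v (diracSmooth Γ ψ x) -
        starRingEnd ℂ (torusChar n x) * inner ℂ (cliffordMul Γ n v) (ψ.1 x) =
        ∑ μ, -Complex.I * partialDeriv μ
          (fun x => torusChar (-n) x • inner ℂ (gammaCLM Γ μ v) (ψ.1 x)) x := by
      intro x
      have h2 : ∀ μ, partialDeriv μ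
          (fun x => torusChar (-n) x • inner ℂ (gammaCLM Γ μ v) (ψ.1 x)) x =
          torusChar (-n) x * inner ℂ v (gammaCLM Γ μ (partialDeriv μ ψ.1 x)) -
            Complex.I * n μ * torusChar (-n) x * inner ℂ (gammaCLM Γ μ v) (ψ.1 x) := by
        intro μ
        rw [partialDeriv_smul (isSmooth_torusChar _) (hsm μ), partialDeriv_torusChar]
        have := partialDeriv_clm (innerSL ℂ (gammaCLM Γ μ v)) ψ.2 μ x
        simp only [innerSL_apply_apply] at this
        rw [this, inner_gammaCLM]
        simp only [smul_eq_mul, Pi.neg_apply, Int.cast_neg]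
        ring
      simp only [h2, ← torusChar_neg, diracSmooth_apply, inner_smul_right, inner_sum,
        cliffordMul_apply, sum_inner, inner_smul_left, map_intCast, Finset.mul_sum,
        ← Finset.sum_sub_distrib]
      refine Finset.sum_congr rfl fun μ _ => ?_
      ring_nf
      rw [Complex.I_sq]
      ring
    simp only [h1]
    rw [integral_finsetSum]
    · refine Finset.sum_eq_zero fun μ _ => ?_
      rw [integral_const_mul, integral_partialDeriv (hsm2 μ), mul_zero]
      fun_prop
    · intro μ _
      exact (hint _ (continuous_partialDeriv (hsm2 μ) μ)).const_mul _
  · exact hint _ (by fun_prop)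
  · exact hint _ (by fun_prop)

theorem inner_planeWave_of_mem_closure {p : SpinorL2 d × SpinorL2 d}
    (hp : p ∈ (diracCore Γ).graph.topologicalClosure) (n : Fin d → ℤ) (v : Spinor d) :
    inner ℂ (planeWave n v) p.2 = inner ℂ (planeWave n (cliffordMul Γ n v)) p.1 := by
  refine closure_minimal (t := {p : SpinorL2 d × SpinorL2 d | inner ℂ (planeWave n v) p.2 =
    inner ℂ (planeWave n (cliffordMul Γ n v)) p.1}) ?_ (isClosed_eq (by fun_prop) (by fun_prop)) hp
  intro p hp
  obtain ⟨ψ, rfl⟩ := (diracCore_mem_graph_iff Γ p).1 hp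
  exact inner_planeWave_diracSmooth Γ ψ n v

/-- The Fourier coefficients of the second entry of a point in the closed graph are determined by
the first entry; if the first vanishes, so does the second, by completeness of plane waves. -/
theorem isClosable_diracCore : (diracCore Γ).IsClosable := by
  use (diracCore Γ).graph.topologicalClosure.toLinearPMap
  rw [Submodule.toLinearPMap_graph_eq]
  intro p hp hp1
  refine eq_zero_of_inner_planeWave fun n v => ?_
  rw [inner_planeWave_of_mem_closure Γ hp, hp1, inner_zero_right]

theorem dirac_graph : (dirac Γ).graph = (diracCore Γ).graph.topologicalClosure :=
  (isClosable_diracCore Γ).graph_closure_eq_closure_graph.symm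

theorem inner_planeWave_dirac (ψ : (dirac Γ).domain) (n : Fin d → ℤ) (v : Spinor d) :
    inner ℂ (planeWave n v) (dirac Γ ψ) = inner ℂ (planeWave n (cliffordMul Γ n v)) (ψ : SpinorL2 d) :=
  inner_planeWave_of_mem_closure Γ (p := (ψ, dirac Γ ψ))
    (by rw [← dirac_graph]; exact (dirac Γ).mem_graph ψ) n v

theorem exists_dirac_eq_iff {ψ χ : SpinorL2 d} :
    (∃ h : ψ ∈ (dirac Γ).domain, dirac Γ ⟨ψ, h⟩ = χ) ↔
      (ψ, χ) ∈ (diracCore Γ).graph.topologicalClosure := by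
  rw [← dirac_graph, LinearPMap.mem_graph_iff]
  constructor
  · rintro ⟨h, rfl⟩; exact ⟨⟨ψ, h⟩, rfl, rfl⟩
  · rintro ⟨⟨ψ', h⟩, h1, h2⟩
    simp only at h1 h2
    subst h1
    exact ⟨h, h2⟩

theorem diracSmooth_smoothWave (n : Fin d → ℤ) (v : Spinor d) :
    diracSmooth Γ (smoothWave n v) = (smoothWave n (cliffordMul Γ n v)).1 := by
  ext1 x
  have h : ∀ μ, partialDeriv μ (smoothWave n v).1 x = (Complex.I * n μ * torusChar n x) • v := by
    intro μ
    have := partialDeriv_smul (isSmooth_torusChar n) (g := fun _ : Torus d => v) contDiff_const μ x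
    rw [partialDeriv_torusChar] at this
    refine this.trans ?_
    simp [partialDeriv]
  rw [diracSmooth_apply, smoothWave_apply, cliffordMul_apply, Finset.smul_sum, Finset.smul_sum]
  refine Finset.sum_congr rfl fun μ _ => ?_
  rw [h, map_smul, smul_smul, smul_smul]
  congr 1
  linear_combination (-(n μ : ℂ) * torusChar n x) * Complex.I_sq

theorem dirac_planeWave (n : Fin d → ℤ) (v : Spinor d) :
    ∃ h : planeWave n v ∈ (dirac Γ).domain,
      dirac Γ ⟨planeWave n v, h⟩ = planeWave n (cliffordMul Γ n v) := by
  rw [exists_dirac_eq_iff]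
  refine Submodule.le_topologicalClosure _ ((diracCore_mem_graph_iff Γ _).2 ⟨smoothWave n v, ?_⟩)
  rw [diracSmooth_smoothWave]
  rfl

theorem dirac_fourierSum (B : Finset (Fin d → ℤ)) (ξ : (Fin d → ℤ) → Spinor d) :
    ∃ h : fourierSum B ξ ∈ (dirac Γ).domain,
      dirac Γ ⟨fourierSum B ξ, h⟩ = fourierSum B fun n => cliffordMul Γ n (ξ n) := by
  rw [exists_dirac_eq_iff]
  have : (fourierSum B ξ, fourierSum B fun n => cliffordMul Γ n (ξ n)) =
      ∑ n ∈ B, (planeWave n (ξ n), planeWave n (cliffordMul Γ n (ξ n))) := by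
    exact Prod.ext (by rw [Prod.fst_sum]; rfl) (by rw [Prod.snd_sum]; rfl)
  rw [this]
  exact Submodule.sum_mem _ fun n _ => (exists_dirac_eq_iff Γ).1 (dirac_planeWave Γ n (ξ n))

theorem inner_fourierSum_dirac (B : Finset (Fin d → ℤ)) (η : (Fin d → ℤ) → Spinor d)
    (ψ : (dirac Γ).domain) :
    inner ℂ (fourierSum B η) (dirac Γ ψ) =
      inner ℂ (fourierSum B fun n => cliffordMul Γ n (η n)) (ψ : SpinorL2 d) := by
  simp only [fourierSum, sum_inner, inner_planeWave_dirac]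

end Dirac

/-! ### The commutator with a smooth function -/

section Commutator

/-- The symbol `-i ∑_μ ∂_μ f γ^μ` of the commutator of `D` with a function `f`. -/
def gradSymbol (f : Torus d → ℂ) (x : Torus d) : Spinor d →L[ℂ] Spinor d :=
  -Complex.I • ∑ μ, partialDeriv μ f x • gammaCLM Γ μ

theorem gradSymbol_apply (f : Torus d → ℂ) (x : Torus d) (v : Spinor d) :
    gradSymbol Γ f x v = -Complex.I • ∑ μ, partialDeriv μ f x • gammaCLM Γ μ v := by
  simp [gradSymbol]

/-- The smooth function `f ψ`. -/
def smoothSMul (f : smoothFunctions d ℂ) (ψ : smoothFunctions d (Spinor d)) :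
    smoothFunctions d (Spinor d) :=
  ⟨f.1 • ψ.1, IsSmooth.smul f.2 ψ.2⟩

theorem diracSmooth_smul (f : smoothFunctions d ℂ) (ψ : smoothFunctions d (Spinor d))
    (x : Torus d) :
    diracSmooth Γ (smoothSMul f ψ) x = f.1 x • diracSmooth Γ ψ x + gradSymbol Γ f.1 x (ψ.1 x) := by
  have h : ∀ μ, partialDeriv μ (smoothSMul f ψ).1 x = _ := fun μ => partialDeriv_smul f.2 ψ.2 μ x
  simp only [diracSmooth_apply, h, map_add, map_smul, Finset.sum_add_distrib, smul_add,
    gradSymbol_apply, ← Finset.smul_sum]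
  rw [smul_comm]

/-- The multiplication operator with symbol `gradSymbol Γ f`. -/
def gradOp (f : smoothFunctions d ℂ) : SpinorL2 d →L[ℂ] SpinorL2 d :=
  -Complex.I • ∑ μ, mulOp d ⟨partialDeriv μ f.1, continuous_partialDeriv f.2 μ⟩ ∘L
    (gammaCLM Γ μ).compLpL 2 (torusMeasure d)

theorem gradOp_ae (f : smoothFunctions d ℂ) (ψ : SpinorL2 d) :
    gradOp Γ f ψ =ᵐ[torusMeasure d] fun x => gradSymbol Γ f.1 x (ψ x) := by
  have h1 : gradOp Γ f ψ = -Complex.I • ∑ μ,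
      mulOp d ⟨partialDeriv μ f.1, continuous_partialDeriv f.2 μ⟩
        ((gammaCLM Γ μ).compLpL 2 (torusMeasure d) ψ) := by
    simp [gradOp]
  rw [h1]
  have h2 := fun μ => (gammaCLM Γ μ).coeFn_compLpL (p := 2) (μ := torusMeasure d) ψ
  have h3 := fun μ => mulOp_ae (d := d) ⟨partialDeriv μ f.1, continuous_partialDeriv f.2 μ⟩
    ((gammaCLM Γ μ).compLpL 2 (torusMeasure d) ψ)
  filter_upwards [Lp.coeFn_smul (-Complex.I) (∑ μ,
    mulOp d ⟨partialDeriv μ f.1, continuous_partialDeriv f.2 μ⟩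
      ((gammaCLM Γ μ).compLpL 2 (torusMeasure d) ψ)),
    Lp.coeFn_fun_finsetSum Finset.univ fun μ =>
      mulOp d ⟨partialDeriv μ f.1, continuous_partialDeriv f.2 μ⟩
        ((gammaCLM Γ μ).compLpL 2 (torusMeasure d) ψ),
    eventually_all.2 h2, eventually_all.2 h3] with x h4 h5 h6 h7
  rw [h4, Pi.smul_apply, h5, gradSymbol_apply]
  congr 1
  exact Finset.sum_congr rfl fun μ _ => by rw [h7, h6]; rfl

/-- On smooth spinors this is the Leibniz rule. The map (ψ, χ) ↦ (f ψ, f χ + [D, f] ψ) is continuous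
and preserves the graph of the core, hence also its closure. -/
theorem dirac_mulOp (f : smoothFunctions d ℂ) (ψ : (dirac Γ).domain) :
    ∃ h : mulOp d f.1 ψ ∈ (dirac Γ).domain,
      dirac Γ ⟨mulOp d f.1 ψ, h⟩ = mulOp d f.1 (dirac Γ ψ) + gradOp Γ f ψ := by
  rw [exists_dirac_eq_iff]
  have hψ : ((ψ : SpinorL2 d), dirac Γ ψ) ∈ (diracCore Γ).graph.topologicalClosure :=
    (exists_dirac_eq_iff Γ).1 ⟨ψ.2, rfl⟩
  refine closure_minimal (s := ↑(diracCore Γ).graph)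
    (t := (fun p : SpinorL2 d × SpinorL2 d => (mulOp d f.1 p.1, mulOp d f.1 p.2 + gradOp Γ f p.1)) ⁻¹'
      (diracCore Γ).graph.topologicalClosure) ?_
    ((Submodule.isClosed_topologicalClosure _).preimage (by fun_prop)) hψ
  intro p hp
  obtain ⟨χ, rfl⟩ := (diracCore_mem_graph_iff Γ p).1 hp
  refine Submodule.le_topologicalClosure _ ((diracCore_mem_graph_iff Γ _).2 ⟨smoothSMul f χ, ?_⟩)
  refine Prod.ext (mulOp_toLp _ _) ?_
  simp only [mulOp_toLp]
  refine Lp.ext ?_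
  filter_upwards [Lp.coeFn_add (ContinuousMap.toLp 2 (torusMeasure d) ℂ (f.1 • diracSmooth Γ χ))
    (gradOp Γ f (smoothToL2 d χ)), gradOp_ae Γ f (smoothToL2 d χ),
    (f.1 • diracSmooth Γ χ).coeFn_toLp (p := 2) (𝕜 := ℂ) (torusMeasure d),
    χ.1.coeFn_toLp (p := 2) (𝕜 := ℂ) (torusMeasure d),
    (diracSmooth Γ (smoothSMul f χ)).coeFn_toLp (p := 2) (𝕜 := ℂ) (torusMeasure d)]
    with x h1 h2 h3 h4 h5
  have h4' : smoothToL2 d χ x = χ.1 x := h4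
  rw [h1, h5, Pi.add_apply, h2, h3, h4', diracSmooth_smul]
  rfl

theorem commutatorNorm_mulOp_ne_top (f : smoothFunctions d ℂ) :
    commutatorNorm (dirac Γ) (mulOp d f.1) ≠ ⊤ := by
  refine ne_top_of_le_ne_top ENNReal.coe_ne_top
    (commutatorNorm_le_iff.2 fun ψ => ?_ : _ ≤ (‖gradOp Γ f‖₊ : ℝ≥0∞))
  obtain ⟨h, h1⟩ := dirac_mulOp Γ f ψ
  refine ⟨h, ?_⟩
  rw [h1, add_sub_cancel_left]
  exact (gradOp Γ f).le_opNorm _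

theorem commutatorNorm_mulOp_le (f : smoothFunctions d ℂ) {C : ℝ≥0}
    (hC : ∀ x v, ‖gradSymbol Γ f.1 x v‖ ≤ C * ‖v‖) :
    commutatorNorm (dirac Γ) (mulOp d f.1) ≤ C := by
  refine commutatorNorm_le_iff.2 fun ψ => ?_
  obtain ⟨h, h1⟩ := dirac_mulOp Γ f ψ
  refine ⟨h, ?_⟩
  rw [h1, add_sub_cancel_left]
  refine Lp.norm_le_mul_norm_of_ae_le_mul ?_
  filter_upwards [gradOp_ae Γ f ψ] with x hx
  rw [hx]
  exact hC x _

end Commutator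

end

section

variable {d : ℕ}

/-! ### The Fejér kernel of the cube and its moments -/

section Fejer

/-- The cube of frequencies `n` with `|n_i| ≤ M`. -/
def freqCube (d M : ℕ) : Finset (Fin d → ℤ) := Fintype.piFinset fun _ => Finset.Icc (-M : ℤ) M

theorem card_freqCube (d M : ℕ) : (freqCube d M).card = (2 * M + 1) ^ d := by
  simp only [freqCube, Fintype.card_piFinset, Int.card_Icc, Finset.prod_const, Finset.card_univ,
    Fintype.card_fin]
  congr 1
  omega

theorem card_freqCube_ne_zero (d M : ℕ) : ((freqCube d M).card : ℂ) ≠ 0 := by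
  rw [card_freqCube]; exact_mod_cast (by positivity)

variable (d) in
/-- The Fejér kernel of the cube. -/
def fejer (M : ℕ) (y : Torus d) : ℝ :=
  ((freqCube d M).card : ℝ)⁻¹ * ‖∑ p ∈ freqCube d M, torusChar p y‖ ^ 2

theorem fejer_nonneg (M : ℕ) (y : Torus d) : 0 ≤ fejer d M y := by
  unfold fejer; positivity

theorem continuous_fejer (M : ℕ) : Continuous (fejer d M) := by
  unfold fejer; fun_prop

theorem integrable_of_continuous {F : Type*} [NormedAddCommGroup F] {g : Torus d → F}
    (hg : Continuous g) : Integrable g (torusMeasure d) :=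
  hg.integrable_of_hasCompactSupport (HasCompactSupport.of_compactSpace g)

variable (d) in
/-- The Fourier coefficients of the Fejér kernel. -/
def fejerCoeff (M : ℕ) (k : Fin d → ℤ) : ℂ :=
  ((freqCube d M).card : ℂ)⁻¹ *
    ∑ p ∈ freqCube d M, ∑ q ∈ freqCube d M, if p - q = k then 1 else 0

theorem coe_fejer (M : ℕ) (y : Torus d) : (fejer d M y : ℂ) = ((freqCube d M).card : ℂ)⁻¹ *
    ∑ p ∈ freqCube d M, ∑ q ∈ freqCube d M, torusChar (q - p) y := by
  have h : ((‖∑ p ∈ freqCube d M, torusChar p y‖ : ℂ)) ^ 2 =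
      ∑ p ∈ freqCube d M, ∑ q ∈ freqCube d M, torusChar (q - p) y := by
    rw [← Complex.conj_mul', map_sum, Finset.sum_mul_sum]
    simp only [conj_mul_torusChar]
  rw [fejer]
  push_cast
  rw [h]

theorem integral_fejer_mul_torusChar (M : ℕ) (k : Fin d → ℤ) :
    ∫ y, (fejer d M y : ℂ) * torusChar k y ∂torusMeasure d = fejerCoeff d M k := by
  simp only [coe_fejer, mul_assoc, integral_const_mul, Finset.sum_mul, ← torusChar_add]
  rw [fejerCoeff, integral_finsetSum _ fun p _ => integrable_of_continuous (by fun_prop)]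
  congr 1
  refine Finset.sum_congr rfl fun p _ => ?_
  rw [integral_finsetSum _ fun q _ => integrable_of_continuous (by fun_prop)]
  refine Finset.sum_congr rfl fun q _ => ?_
  rw [integral_torusChar]
  have : q - p + k = 0 ↔ p - q = k := by
    rw [← sub_eq_zero (a := p - q), ← neg_eq_zero]
    constructor <;> intro h <;> rw [← h] <;> abel
  simp only [this]

theorem fejerCoeff_zero (M : ℕ) : fejerCoeff d M 0 = 1 := by
  simp only [fejerCoeff, sub_eq_zero, Finset.sum_ite_eq, Finset.sum_ite_mem, Finset.inter_self,
    Finset.sum_const, nsmul_eq_mul, mul_one]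
  exact inv_mul_cancel₀ (card_freqCube_ne_zero d M)

theorem integral_fejer (M : ℕ) : ∫ y, fejer d M y ∂torusMeasure d = 1 := by
  have h := integral_fejer_mul_torusChar (d := d) M 0
  simp only [torusChar_zero, ContinuousMap.one_apply, mul_one, fejerCoeff_zero,
    integral_complex_ofReal] at h
  exact_mod_cast h

/-- For p in the cube, p minus the μ-th basis vector stays in the cube exactly when p_μ > -M. This
leaves the fraction 2M / (2M + 1) of all p. -/
theorem fejerCoeff_single (M : ℕ) (μ : Fin d) :
    fejerCoeff d M (Pi.single μ 1) = ((1 - 1 / (2 * M + 1) : ℝ) : ℂ) := by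
  classical
  have h1 : ∀ p ∈ freqCube d M, (∑ q ∈ freqCube d M,
      if p - q = Pi.single μ 1 then (1 : ℂ) else 0) = if (-M : ℤ) < p μ then 1 else 0 := by
    intro p hp
    have h2 : ∀ q, (p - q = Pi.single μ 1) = (q = p - Pi.single μ 1) := fun q => by
      rw [eq_iff_iff]
      constructor
      · intro h; rw [← h]; abel
      · rintro rfl; abel
    simp only [h2, Finset.sum_ite_eq']
    congr 1
    rw [eq_iff_iff]
    simp only [freqCube, Fintype.mem_piFinset, Finset.mem_Icc, Pi.sub_apply] at hp ⊢
    constructor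
    · intro h
      have := h μ
      simp at this
      omega
    · intro h i
      have := hp i
      by_cases hi : i = μ
      · subst hi; simp; omega
      · simpa [hi] using this
  rw [fejerCoeff, Finset.sum_congr rfl h1, Finset.sum_ite, Finset.sum_const_zero, add_zero,
    Finset.sum_const, nsmul_eq_mul, mul_one]
  have h3 : (freqCube d M).filter (fun p => (-M : ℤ) < p μ) = Fintype.piFinset
      fun i => if i = μ then Finset.Ioc (-M : ℤ) M else Finset.Icc (-M : ℤ) M := by
    ext p
    simp only [freqCube, Finset.mem_filter, Fintype.mem_piFinset]
    constructor
    · rintro ⟨h, h'⟩ i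
      have := h i
      split_ifs with hi
      · subst hi; simp at this ⊢; omega
      · exact this
    · intro h
      refine ⟨fun i => ?_, ?_⟩
      · have := h i
        split_ifs at this with hi
        · simp at this ⊢; omega
        · exact this
      · have := h μ
        simp at this; omega
  have h4 : Fintype.card (Fin d) = (Fintype.card (Fin d) - 1) + 1 :=
    (Nat.succ_pred_eq_of_pos (Fintype.card_pos_iff.2 ⟨μ⟩)).symm
  have h5 : ((freqCube d M).filter (fun p => (-M : ℤ) < p μ)).card * (2 * M + 1) =
      2 * M * (freqCube d M).card := by
    rw [h3, freqCube, Fintype.card_piFinset, Fintype.card_piFinset,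
      ← Finset.mul_prod_erase _ _ (Finset.mem_univ μ),
      ← Finset.mul_prod_erase _ (fun _ => (Finset.Icc (-M : ℤ) M).card) (Finset.mem_univ μ)]
    have h6 : ∏ x ∈ Finset.univ.erase μ, (if x = μ then Finset.Ioc (-M : ℤ) M else
        Finset.Icc (-M : ℤ) M).card = ∏ x ∈ Finset.univ.erase μ, (Finset.Icc (-M : ℤ) M).card :=
      Finset.prod_congr rfl fun x hx => by rw [if_neg (Finset.ne_of_mem_erase hx)]
    have h7 : (Finset.Icc (-M : ℤ) M).card = 2 * M + 1 := by rw [Int.card_Icc]; omega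
    have h8 : (Finset.Ioc (-M : ℤ) M).card = 2 * M := by rw [Int.card_Ioc]; omega
    rw [h6, if_pos rfl, h7, h8]
    ring
  have h9 : (((freqCube d M).filter (fun p => (-M : ℤ) < p μ)).card : ℂ) * (2 * M + 1) =
      2 * M * (freqCube d M).card := by exact_mod_cast h5
  have h10 : (2 * M + 1 : ℂ) ≠ 0 := by exact_mod_cast Nat.cast_add_one_ne_zero (R := ℂ) (2 * M)
  have h11 := card_freqCube_ne_zero d M
  push_cast
  field_simp
  linear_combination h9

theorem normSq_one_sub_torusChar (k : Fin d → ℤ) (y : Torus d) :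
    ‖1 - torusChar k y‖ ^ 2 = 2 - 2 * (torusChar k y).re := by
  have h := norm_torusChar_apply k y
  rw [← Complex.normSq_eq_norm_sq, Complex.normSq_apply]
  have h2 : ‖torusChar k y‖ ^ 2 = 1 := by rw [h]; norm_num
  rw [← Complex.normSq_eq_norm_sq, Complex.normSq_apply] at h2
  simp
  linarith

theorem integral_fejer_mul_norm_sq (M : ℕ) (μ : Fin d) :
    ∫ y, fejer d M y * ‖1 - torusChar (Pi.single μ 1) y‖ ^ 2 ∂torusMeasure d =
      2 / (2 * M + 1) := by
  have h1 : ∫ y, fejer d M y * (torusChar (Pi.single μ 1) y).re ∂torusMeasure d =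
      1 - 1 / (2 * M + 1) := by
    have h := congrArg Complex.re (integral_fejer_mul_torusChar (d := d) M (Pi.single μ 1))
    have hc := continuous_fejer (d := d) M
    have h2 := integral_re (𝕜 := ℂ) (integrable_of_continuous (d := d)
      (g := fun y => (fejer d M y : ℂ) * torusChar (Pi.single μ 1) y) (by fun_prop))
    rw [fejerCoeff_single, Complex.ofReal_re] at h
    rw [← h]
    simpa using h2
  have hc := continuous_fejer (d := d) M
  simp only [normSq_one_sub_torusChar, mul_sub]
  have hre : Continuous fun y : Torus d => fejer d M y * (2 * (torusChar (Pi.single μ 1) y).re) :=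
    hc.mul (continuous_const.mul (Complex.continuous_re.comp (map_continuous _)))
  rw [integral_sub (integrable_of_continuous (by fun_prop)) (integrable_of_continuous hre),
    integral_mul_const, integral_fejer]
  have h3 : ∀ y : Torus d, fejer d M y * (2 * (torusChar (Pi.single μ 1) y).re) =
    2 * (fejer d M y * (torusChar (Pi.single μ 1) y).re) := fun y => by ring
  simp only [h3, integral_const_mul, h1]
  ring

/-- Cauchy–Schwarz against a probability density, in the form 2δs ≤ δ² + s² with δ² the second
moment. -/
theorem integral_fejer_mul_norm_le (M : ℕ) (μ : Fin d) :
    ∫ y, fejer d M y * ‖1 - torusChar (Pi.single μ 1) y‖ ∂torusMeasure d ≤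
      √(2 / (2 * M + 1)) := by
  set δ := √(2 / (2 * M + 1) : ℝ) with hδ
  have hδ0 : 0 < δ := Real.sqrt_pos.2 (by positivity)
  have hδ2 : δ ^ 2 = 2 / (2 * M + 1) := Real.sq_sqrt (by positivity)
  have hc := continuous_fejer (d := d) M
  have h1 : ∫ y, δ * (fejer d M y * ‖1 - torusChar (Pi.single μ 1) y‖) ∂torusMeasure d ≤
      ∫ y, (δ ^ 2 / 2 * fejer d M y + 1 / 2 *
        (fejer d M y * ‖1 - torusChar (Pi.single μ 1) y‖ ^ 2)) ∂torusMeasure d := by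
    refine integral_mono (integrable_of_continuous (by fun_prop))
      (integrable_of_continuous (by fun_prop)) fun y => ?_
    have := mul_nonneg (fejer_nonneg M y) (sq_nonneg (δ - ‖1 - torusChar (Pi.single μ 1) y‖))
    simp only
    linarith
  rw [integral_const_mul, integral_add (integrable_of_continuous (by fun_prop))
    (integrable_of_continuous (by fun_prop)), integral_const_mul, integral_const_mul,
    integral_fejer_mul_norm_sq, integral_fejer, ← hδ2] at h1
  have h2 : δ * ∫ y, fejer d M y * ‖1 - torusChar (Pi.single μ 1) y‖ ∂torusMeasure d ≤ δ * δ := by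
    linarith
  exact le_of_mul_le_mul_left h2 hδ0

end Fejer

/-! ### The Schur multiplier estimate -/

section SchurMultiplier

variable (Γ : GammaMatrices d) {B : Finset (Fin d → ℤ)} {c : (Fin d → ℤ) → ℂ} {C : ℝ}

/-- The anticommutator of γ^μ with Clifford multiplication by m - n is 2 (m - n)_μ. So the form is
the mean of two copies of the given one, with γ^μ moved onto η or onto ξ, and this preserves norms.
-/
theorem norm_sum_component_le
    (hC : ∀ η ξ : (Fin d → ℤ) → Spinor d, ‖∑ m ∈ B, ∑ n ∈ B, c (m - n) *
      inner ℂ (η m) (cliffordMul Γ (m - n) (ξ n))‖ ≤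
        C * √(∑ n ∈ B, ‖η n‖ ^ 2) * √(∑ n ∈ B, ‖ξ n‖ ^ 2))
    (μ : Fin d) (η ξ : (Fin d → ℤ) → Spinor d) :
    ‖∑ m ∈ B, ∑ n ∈ B, c (m - n) * ((m μ - n μ : ℤ) * inner ℂ (η m) (ξ n))‖ ≤
      C * √(∑ n ∈ B, ‖η n‖ ^ 2) * √(∑ n ∈ B, ‖ξ n‖ ^ 2) := by
  have h1 := hC (fun n => gammaCLM Γ μ (η n)) ξ
  have h2 := hC η (fun n => gammaCLM Γ μ (ξ n))
  simp only [norm_gammaCLM] at h1 h2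
  have h3 : (2 : ℂ) * ∑ m ∈ B, ∑ n ∈ B, c (m - n) * ((m μ - n μ : ℤ) * inner ℂ (η m) (ξ n)) =
      (∑ m ∈ B, ∑ n ∈ B, c (m - n) *
        inner ℂ (gammaCLM Γ μ (η m)) (cliffordMul Γ (m - n) (ξ n))) +
      ∑ m ∈ B, ∑ n ∈ B, c (m - n) *
        inner ℂ (η m) (cliffordMul Γ (m - n) (gammaCLM Γ μ (ξ n))) := by
    simp only [← Finset.sum_add_distrib, Finset.mul_sum]
    refine Finset.sum_congr rfl fun m _ => Finset.sum_congr rfl fun n _ => ?_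
    rw [inner_gammaCLM, ← mul_add, ← inner_add_right, gammaCLM_cliffordMul, inner_smul_right]
    simp only [Pi.sub_apply]
    ring
  have h4 := congrArg norm h3
  rw [norm_mul, Complex.norm_ofNat] at h4
  have h5 := norm_add_le (∑ m ∈ B, ∑ n ∈ B, c (m - n) *
        inner ℂ (gammaCLM Γ μ (η m)) (cliffordMul Γ (m - n) (ξ n)))
    (∑ m ∈ B, ∑ n ∈ B, c (m - n) *
        inner ℂ (η m) (cliffordMul Γ (m - n) (gammaCLM Γ μ (ξ n))))
  linarith

/-- The factor `torusChar (m - n)` conjugates the form by a translation. Along the path s ↦ s t the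
derivative is, up to the factor i, the t-weighted sum of the component forms, conjugated by a
unitary; the mean value inequality on [0, 1] concludes. -/
theorem norm_sum_one_sub_torusChar_le
    (hC : ∀ (μ : Fin d) (η ξ : (Fin d → ℤ) → Spinor d),
      ‖∑ m ∈ B, ∑ n ∈ B, c (m - n) * ((m μ - n μ : ℤ) * inner ℂ (η m) (ξ n))‖ ≤
      C * √(∑ n ∈ B, ‖η n‖ ^ 2) * √(∑ n ∈ B, ‖ξ n‖ ^ 2))
    (t : Fin d → ℝ) (η ξ : (Fin d → ℤ) → Spinor d) :
    ‖∑ m ∈ B, ∑ n ∈ B, (1 - torusChar (m - n) (proj d t)) * (c (m - n) * inner ℂ (η m) (ξ n))‖ ≤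
      (∑ μ, |t μ|) * (C * √(∑ n ∈ B, ‖η n‖ ^ 2) * √(∑ n ∈ B, ‖ξ n‖ ^ 2)) := by
  set R := C * √(∑ n ∈ B, ‖η n‖ ^ 2) * √(∑ n ∈ B, ‖ξ n‖ ^ 2) with hR
  let h : ℝ → ℂ := fun s => ∑ m ∈ B, ∑ n ∈ B,
    torusChar (m - n) (proj d (s • t)) * (c (m - n) * inner ℂ (η m) (ξ n))
  have hchar : ∀ (k : Fin d → ℤ) (s : ℝ), HasDerivAt (fun s : ℝ => torusChar k (proj d (s • t)))
      (Complex.I * (∑ μ, (t μ : ℂ) * k μ) * torusChar k (proj d (s • t))) s := by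
    intro k s
    have h1 : ∀ s : ℝ, torusChar k (proj d (s • t)) =
        Complex.exp (Complex.I * (∑ μ, (t μ : ℂ) * k μ) * s) := by
      intro s
      rw [torusChar_proj, mul_assoc, Finset.sum_mul]
      congr 2
      refine Finset.sum_congr rfl fun i _ => ?_
      simp; ring
    have h2 : HasDerivAt (fun s : ℝ => Complex.I * (∑ μ, (t μ : ℂ) * k μ) * (s : ℂ))
        (Complex.I * (∑ μ, (t μ : ℂ) * k μ) * 1) s :=
      (Complex.ofRealCLM.hasDerivAt (x := s)).const_mul _
    rw [funext h1]
    refine h2.cexp.congr_deriv ?_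
    rw [h1]
    ring
  have hder : ∀ s : ℝ, HasDerivAt h (∑ m ∈ B, ∑ n ∈ B,
      Complex.I * (∑ μ, (t μ : ℂ) * (m - n) μ) * torusChar (m - n) (proj d (s • t)) *
        (c (m - n) * inner ℂ (η m) (ξ n))) s := fun s =>
    HasDerivAt.fun_sum fun m _ => HasDerivAt.fun_sum fun n _ => (hchar (m - n) s).mul_const _
  have hbound : ∀ s : ℝ, ‖∑ m ∈ B, ∑ n ∈ B,
      Complex.I * (∑ μ, (t μ : ℂ) * (m - n) μ) * torusChar (m - n) (proj d (s • t)) *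
        (c (m - n) * inner ℂ (η m) (ξ n))‖ ≤ (∑ μ, |t μ|) * R := by
    intro s
    set y := proj d (s • t)
    -- Since e_{m-n} = e_m · conj e_n, the phases are absorbed into η and ξ without changing their
    -- norms.
    have h1 : ∑ m ∈ B, ∑ n ∈ B, Complex.I * (∑ μ, (t μ : ℂ) * (m - n) μ) * torusChar (m - n) y *
        (c (m - n) * inner ℂ (η m) (ξ n)) =
        ∑ μ, Complex.I * t μ * ∑ m ∈ B, ∑ n ∈ B, c (m - n) * ((m μ - n μ : ℤ) *
          inner ℂ (torusChar (-m) y • η m) (torusChar (-n) y • ξ n)) := by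
      simp only [Finset.mul_sum, Finset.sum_mul]
      symm
      rw [Finset.sum_comm]
      refine Finset.sum_congr rfl fun m _ => ?_
      rw [Finset.sum_comm]
      refine Finset.sum_congr rfl fun n _ => Finset.sum_congr rfl fun μ _ => ?_
      rw [inner_smul_left, inner_smul_right, ← torusChar_neg, neg_neg, sub_eq_add_neg m n,
        torusChar_add]
      simp only [Pi.add_apply, Pi.neg_apply]
      push_cast
      ring
    rw [h1, Finset.sum_mul]
    refine (norm_sum_le _ _).trans (Finset.sum_le_sum fun μ _ => ?_)
    rw [norm_mul, norm_mul, Complex.norm_I, one_mul, Complex.norm_real, Real.norm_eq_abs]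
    refine mul_le_mul_of_nonneg_left ((hC μ _ _).trans_eq ?_) (abs_nonneg _)
    simp only [norm_smul, norm_torusChar_apply, one_mul, hR]
  have h01 := norm_image_sub_le_of_norm_deriv_le_segment_01'
    (fun s _ => (hder s).hasDerivWithinAt) (fun s _ => hbound s)
  rw [norm_sub_rev] at h01
  refine (le_of_eq ?_).trans h01
  congr 1
  simp only [h, zero_smul, one_smul, proj_zero, ← Finset.sum_sub_distrib, ← sub_mul]
  refine Finset.sum_congr rfl fun m _ => Finset.sum_congr rfl fun n _ => ?_
  congr 2
  have := torusChar_proj (m - n) 0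
  simp only [proj_zero] at this
  simp [this]

/-- For a representative with |t| ≤ π, Jordan's inequality for the sine gives |1 - e^{it}| = 2
|sin(t/2)| ≥ 2|t|/π. This trades the non-periodic |t_μ| for a trigonometric expression whose moments
are known. -/
theorem exists_proj_eq (y : Torus d) :
    ∃ t : Fin d → ℝ, proj d t = y ∧ ∀ μ, |t μ| ≤ π / 2 * ‖1 - torusChar (Pi.single μ 1) y‖ := by
  have h : ∀ μ, ∃ t : ℝ, |t| ≤ π ∧ (t : AddCircle (2 * π)) = y μ := by
    intro μ
    have : y μ ∈ ((↑) : ℝ → AddCircle (2 * π)) '' Set.Ioc (-π) (-π + 2 * π) := by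
      rw [AddCircle.coe_image_Ioc_eq]; trivial
    obtain ⟨t, ht, h⟩ := this
    exact ⟨t, abs_le.2 ⟨ht.1.le, by linarith [ht.2]⟩, h⟩
  choose t ht hty using h
  refine ⟨t, funext hty, fun μ => ?_⟩
  have h1 : torusChar (Pi.single μ 1) y = Complex.exp (Complex.I * t μ) := by
    rw [← show proj d t = y from funext hty, torusChar_proj, Finset.sum_eq_single μ]
    · simp
    · intro i _ hi; simp [hi]
    · simp
  rw [h1, norm_sub_rev, Complex.norm_exp_I_mul_ofReal_sub_one, norm_mul, Real.norm_eq_abs,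
    Real.norm_eq_abs, abs_two]
  have h2 : |t μ / 2| = |t μ| / 2 := by rw [abs_div, abs_two]
  have h3 := Real.mul_abs_le_abs_sin (x := t μ / 2) (by rw [h2]; linarith [ht μ])
  rw [h2] at h3
  have h4 := mul_le_mul_of_nonneg_left h3 Real.pi_pos.le
  have h5 : π * (2 / π * (|t μ| / 2)) = |t μ| := by field_simp
  linarith

/-- The rate at which the Fejér kernel of the cube concentrates at the origin. -/
def fejerRate (d M : ℕ) : ℝ := π / 2 * (d * √(2 / (2 * M + 1)))

theorem fejerRate_pos (hd : 1 ≤ d) (M : ℕ) : 0 < fejerRate d M := by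
  have : (0 : ℝ) < d := by exact_mod_cast hd
  unfold fejerRate; positivity

theorem tendsto_fejerRate (d : ℕ) : Tendsto (fejerRate d) atTop (𝓝 0) := by
  have h1 : Tendsto (fun M : ℕ => (2 : ℝ) / (2 * M + 1)) atTop (𝓝 0) :=
    tendsto_const_nhds.div_atTop (tendsto_atTop_add_const_right _ _
      (tendsto_natCast_atTop_atTop.const_mul_atTop two_pos))
  have h2 := ((Real.continuous_sqrt.tendsto 0).comp h1).const_mul (d : ℝ) |>.const_mul (π / 2)
  rw [Real.sqrt_zero, mul_zero, mul_zero] at h2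
  exact h2

/-- The multiplier 1 - F̂_M(k) is the F_M-average of 1 - e_k(y). Averaging the translation estimate
leaves the first moments of the kernel, which sum to `fejerRate`. -/
theorem norm_sum_one_sub_fejerCoeff_le (M : ℕ) (hC0 : 0 ≤ C)
    (hC : ∀ η ξ : (Fin d → ℤ) → Spinor d, ‖∑ m ∈ B, ∑ n ∈ B, c (m - n) *
      inner ℂ (η m) (cliffordMul Γ (m - n) (ξ n))‖ ≤
        C * √(∑ n ∈ B, ‖η n‖ ^ 2) * √(∑ n ∈ B, ‖ξ n‖ ^ 2))
    (η ξ : (Fin d → ℤ) → Spinor d) :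
    ‖∑ m ∈ B, ∑ n ∈ B, (1 - fejerCoeff d M (m - n)) * (c (m - n) * inner ℂ (η m) (ξ n))‖ ≤
      fejerRate d M * (C * √(∑ n ∈ B, ‖η n‖ ^ 2) * √(∑ n ∈ B, ‖ξ n‖ ^ 2)) := by
  set R := C * √(∑ n ∈ B, ‖η n‖ ^ 2) * √(∑ n ∈ B, ‖ξ n‖ ^ 2) with hR
  have hR0 : 0 ≤ R := by positivity
  have hcont := continuous_fejer (d := d) M
  have h1 : ∑ m ∈ B, ∑ n ∈ B, (1 - fejerCoeff d M (m - n)) * (c (m - n) * inner ℂ (η m) (ξ n)) =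
      ∫ y, (fejer d M y : ℂ) * ∑ m ∈ B, ∑ n ∈ B, (1 - torusChar (m - n) y) *
        (c (m - n) * inner ℂ (η m) (ξ n)) ∂torusMeasure d := by
    simp only [Finset.mul_sum]
    rw [integral_finsetSum _ fun m _ => integrable_of_continuous (by fun_prop)]
    refine Finset.sum_congr rfl fun m _ => ?_
    rw [integral_finsetSum _ fun n _ => integrable_of_continuous (by fun_prop)]
    refine Finset.sum_congr rfl fun n _ => ?_
    simp only [← mul_assoc, integral_mul_const]
    congr 2
    simp only [mul_sub, mul_one]
    rw [integral_sub (integrable_of_continuous (by fun_prop))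
      (integrable_of_continuous (by fun_prop)), integral_fejer_mul_torusChar,
      integral_complex_ofReal, integral_fejer, Complex.ofReal_one]
  rw [h1]
  have h2 : ∀ y : Torus d, ‖(fejer d M y : ℂ) * ∑ m ∈ B, ∑ n ∈ B, (1 - torusChar (m - n) y) *
        (c (m - n) * inner ℂ (η m) (ξ n))‖ ≤
      ∑ μ, π / 2 * R * (fejer d M y * ‖1 - torusChar (Pi.single μ 1) y‖) := by
    intro y
    obtain ⟨t, rfl, ht⟩ := exists_proj_eq y
    rw [norm_mul, Complex.norm_real, Real.norm_eq_abs, abs_of_nonneg (fejer_nonneg _ _)]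
    have h3 := norm_sum_one_sub_torusChar_le (norm_sum_component_le Γ hC) t η ξ
    refine (mul_le_mul_of_nonneg_left h3 (fejer_nonneg _ _)).trans ?_
    rw [← hR, Finset.sum_mul, Finset.mul_sum]
    refine Finset.sum_le_sum fun μ _ => ?_
    have h4 := mul_le_mul_of_nonneg_left (ht μ) (mul_nonneg hR0 (fejer_nonneg M (proj d t)))
    linarith
  refine (norm_integral_le_of_norm_le (integrable_of_continuous (by fun_prop))
    (Eventually.of_forall h2)).trans ?_
  rw [integral_finsetSum _ fun μ _ => integrable_of_continuous (by fun_prop)]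
  simp only [integral_const_mul]
  refine (Finset.sum_le_sum fun μ _ => mul_le_mul_of_nonneg_left (integral_fejer_mul_norm_le M μ)
    (by positivity)).trans (le_of_eq ?_)
  simp [fejerRate]
  ring

end SchurMultiplier

end

section

variable {d : ℕ} (Γ : GammaMatrices d)

/-! ### Norm, positivity and density for multiplication operators -/

section Multiplication

theorem continuous_mulOp : Continuous (mulOp d) :=
  (((ContinuousLinearMap.lsmul ℂ ℂ : ℂ →L[ℂ] Spinor d →L[ℂ] Spinor d).holderL
    (torusMeasure d) ∞ 2 2).comp (ContinuousMap.toLp ∞ (torusMeasure d) ℂ)).continuous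

theorem norm_mulOp_le (g : C(Torus d, ℂ)) {C : ℝ} (hC : 0 ≤ C) (h : ∀ x, ‖g x‖ ≤ C) :
    ‖mulOp d g‖ ≤ C := by
  refine ContinuousLinearMap.opNorm_le_bound _ hC fun ψ => Lp.norm_le_mul_norm_of_ae_le_mul ?_
  filter_upwards [mulOp_ae g ψ] with x hx
  rw [hx, norm_smul]
  exact mul_le_mul_of_nonneg_right (h x) (norm_nonneg _)

theorem isPositive_mulOp (g : C(Torus d, ℂ)) (h : ∀ x, 0 ≤ (g x).re ∧ (g x).im = 0) :
    (mulOp d g).IsPositive := by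
  let k : C(Torus d, ℂ) := ⟨fun x => (√(g x).re : ℂ), Complex.continuous_ofReal.comp
    (Real.continuous_sqrt.comp (Complex.continuous_re.comp g.continuous))⟩
  have hk : star k = k := by
    ext x; simp [k]
  have h1 : mulOp d g = ContinuousLinearMap.adjoint (mulOp d k) ∘L mulOp d k := by
    rw [← ContinuousLinearMap.star_eq_adjoint, ← mulOp_star, hk]
    ext1 ψ
    refine Lp.ext ?_
    filter_upwards [mulOp_ae g ψ, mulOp_ae k ψ, mulOp_ae k (mulOp d k ψ)] with x h1 h2 h3
    rw [ContinuousLinearMap.comp_apply, h1, h3, h2, smul_smul]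
    congr 1
    change g x = (√(g x).re : ℂ) * (√(g x).re : ℂ)
    rw [← Complex.ofReal_mul, Real.mul_self_sqrt (h x).1]
    apply Complex.ext <;> simp [(h x).2]
  rw [h1]
  exact ContinuousLinearMap.isPositive_adjoint_comp_self _

theorem dense_smoothFunctions : Dense (smoothFunctions d ℂ : Set C(Torus d, ℂ)) := by
  refine Dense.mono (s₁ := ↑(Submodule.span ℂ (Set.range (torusChar (d := d))))) ?_
    (Submodule.dense_iff_topologicalClosure_eq_top.2 span_torusChar_closure_eq_top)
  refine Submodule.span_le.2 ?_
  rintro _ ⟨n, rfl⟩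
  exact isSmooth_torusChar n

theorem norm_inner_self_eq_sq {H : Type*} [NormedAddCommGroup H] [InnerProductSpace ℂ H] (x : H) :
    ‖inner ℂ x x‖ = ‖x‖ ^ 2 := by
  rw [inner_self_eq_norm_sq_to_K]; simp

theorem opNorm_le_of_inner {H : Type*} [NormedAddCommGroup H] [InnerProductSpace ℂ H]
    {A : H →L[ℂ] H} {r : ℝ} (hr : 0 ≤ r) (h : ∀ x y, ‖inner ℂ x (A y)‖ ≤ r * (‖x‖ * ‖y‖)) :
    ‖A‖ ≤ r := by
  refine A.opNorm_le_bound hr fun y => ?_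
  have h1 := h (A y) y
  rw [norm_inner_self_eq_sq] at h1
  rcases (norm_nonneg (A y)).eq_or_lt with h0 | h0
  · rw [← h0]; positivity
  · refine le_of_mul_le_mul_left ?_ h0
    nlinarith

theorem fourierSum_eq_of_subset {B C : Finset (Fin d → ℤ)} (ξ : (Fin d → ℤ) → Spinor d)
    (hBC : B ⊆ C) : ∃ ξ', fourierSum B ξ = fourierSum C ξ' := by
  classical
  refine ⟨fun n => if n ∈ B then ξ n else 0, ?_⟩
  rw [fourierSum, fourierSum, ← Finset.sum_subset hBC]
  · exact Finset.sum_congr rfl fun n hn => by rw [if_pos hn]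
  · intro n _ hn; rw [if_neg hn, map_zero]

theorem opNorm_le_of_inner_fourierSum {A : SpinorL2 d →L[ℂ] SpinorL2 d} {r : ℝ} (hr : 0 ≤ r)
    (h : ∀ B η ξ, ‖inner ℂ (fourierSum B η) (A (fourierSum B ξ))‖ ≤
      r * (‖fourierSum B η‖ * ‖fourierSum B ξ‖)) : ‖A‖ ≤ r := by
  classical
  refine opNorm_le_of_inner hr fun x y => ?_
  refine dense_fourierSum.induction (P := fun x => ∀ y, ‖inner ℂ x (A y)‖ ≤ r * (‖x‖ * ‖y‖))
    ?_ ?_ x y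
  · rintro _ ⟨B, η, rfl⟩ y
    refine dense_fourierSum.induction (P := fun y => ‖inner ℂ (fourierSum B η) (A y)‖ ≤
      r * (‖fourierSum B η‖ * ‖y‖)) ?_ (isClosed_le (by fun_prop) (by fun_prop)) y
    rintro _ ⟨C, ξ, rfl⟩
    obtain ⟨η', h1⟩ := fourierSum_eq_of_subset η (Finset.subset_union_left (s₁ := B) (s₂ := C))
    obtain ⟨ξ', h2⟩ := fourierSum_eq_of_subset ξ (Finset.subset_union_right (s₁ := B) (s₂ := C))
    rw [h1, h2]
    exact h _ _ _
  · simp only [Set.ofPred_forall]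
    exact isClosed_iInter fun y => isClosed_le (by fun_prop) (by fun_prop)

end Multiplication

/-! ### Fejér means: approximation and contraction of commutators -/

section FejerMean

theorem fCoeff_torusChar (l k : Fin d → ℤ) :
    fCoeff (torusChar l) k = if l = k then 1 else 0 := by
  simp only [fCoeff, conj_mul_torusChar, integral_torusChar, sub_eq_zero]

/-- The convolution of `f` with the Fejér kernel of the cube. -/
def fejerMean (M : ℕ) (f : C(Torus d, ℂ)) : C(Torus d, ℂ) :=
  ((freqCube d M).card : ℂ)⁻¹ • ∑ p ∈ freqCube d M, ∑ q ∈ freqCube d M,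
    fCoeff f (p - q) • torusChar (p - q)

theorem isSmooth_fejerMean (M : ℕ) (f : C(Torus d, ℂ)) : fejerMean M f ∈ smoothFunctions d ℂ :=
  Submodule.smul_mem _ _ (Submodule.sum_mem _ fun _ _ => Submodule.sum_mem _ fun _ _ =>
    Submodule.smul_mem _ _ (isSmooth_torusChar _))

theorem fejerMean_apply (M : ℕ) (f : C(Torus d, ℂ)) (x : Torus d) :
    fejerMean M f x = ((freqCube d M).card : ℂ)⁻¹ * ∑ p ∈ freqCube d M, ∑ q ∈ freqCube d M,
      fCoeff f (p - q) * torusChar (p - q) x := by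
  simp [fejerMean]

theorem fCoeff_fejerMean (M : ℕ) (f : C(Torus d, ℂ)) (k : Fin d → ℤ) :
    fCoeff (fejerMean M f) k = fejerCoeff d M k * fCoeff f k := by
  have h : ∀ l, ∫ x, starRingEnd ℂ (torusChar k x) * torusChar l x ∂torusMeasure d =
    if l = k then 1 else 0 := fun l => fCoeff_torusChar l k
  have h1 : ∀ x, starRingEnd ℂ (torusChar k x) * fejerMean M f x = ((freqCube d M).card : ℂ)⁻¹ *
      ∑ p ∈ freqCube d M, ∑ q ∈ freqCube d M,
        fCoeff f (p - q) * (starRingEnd ℂ (torusChar k x) * torusChar (p - q) x) := by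
    intro x
    rw [fejerMean_apply, mul_left_comm]
    simp only [Finset.mul_sum]
    simp only [mul_left_comm (starRingEnd ℂ (torusChar k x))]
  rw [fCoeff]
  simp only [h1]
  rw [integral_const_mul, fejerCoeff, mul_assoc, Finset.sum_mul,
    integral_finsetSum _ fun p _ => integrable_of_continuous (by fun_prop)]
  congr 1
  refine Finset.sum_congr rfl fun p _ => ?_
  rw [Finset.sum_mul, integral_finsetSum _ fun q _ => integrable_of_continuous (by fun_prop)]
  refine Finset.sum_congr rfl fun q _ => ?_
  rw [integral_const_mul, h]
  split_ifs with hk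
  · rw [hk]; ring
  · ring

theorem fCoeff_sub (f g : C(Torus d, ℂ)) (k : Fin d → ℤ) :
    fCoeff (f - g) k = fCoeff f k - fCoeff g k := by
  simp only [fCoeff, ContinuousMap.sub_apply, mul_sub]
  exact integral_sub (integrable_of_continuous (by fun_prop)) (integrable_of_continuous (by fun_prop))

/-- `C` bounds the commutator of `D` with `f`, as a form on the span of the frequencies in `B`. -/
def CommutatorFormBound (B : Finset (Fin d → ℤ)) (f : C(Torus d, ℂ)) (C : ℝ) : Prop :=
  ∀ η ξ : (Fin d → ℤ) → Spinor d, ‖∑ m ∈ B, ∑ n ∈ B, fCoeff f (m - n) *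
    inner ℂ (η m) (cliffordMul Γ (m - n) (ξ n))‖ ≤
      C * √(∑ n ∈ B, ‖η n‖ ^ 2) * √(∑ n ∈ B, ‖ξ n‖ ^ 2)

theorem inner_commutator_fourierSum (B : Finset (Fin d → ℤ)) (f : C(Torus d, ℂ))
    (η ξ : (Fin d → ℤ) → Spinor d) :
    inner ℂ (fourierSum B fun n => cliffordMul Γ n (η n)) (mulOp d f (fourierSum B ξ)) -
      inner ℂ (fourierSum B η) (mulOp d f (fourierSum B fun n => cliffordMul Γ n (ξ n))) =
    ∑ m ∈ B, ∑ n ∈ B, fCoeff f (m - n) * inner ℂ (η m) (cliffordMul Γ (m - n) (ξ n)) := by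
  simp only [inner_fourierSum_mulOp_fourierSum, ← Finset.sum_sub_distrib, inner_cliffordMul,
    cliffordMul_sub, inner_sub_right, mul_sub]

/-- The set `B` is arbitrary so that the same bound applies to f (all finite `B`) and to its
compression (`B` the frequency ball). -/
theorem CommutatorFormBound.norm_inner_sub_fejerMean_le {B : Finset (Fin d → ℤ)}
    {f : C(Torus d, ℂ)} {C : ℝ} (h : CommutatorFormBound Γ B f C) (hC : 0 ≤ C) (M : ℕ)
    (η ξ : (Fin d → ℤ) → Spinor d) :
    ‖inner ℂ (fourierSum B η) (mulOp d (f - fejerMean M f) (fourierSum B ξ))‖ ≤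
      fejerRate d M * C * (‖fourierSum B η‖ * ‖fourierSum B ξ‖) := by
  rw [inner_fourierSum_mulOp_fourierSum, norm_fourierSum, norm_fourierSum]
  refine (le_of_eq ?_).trans ((norm_sum_one_sub_fejerCoeff_le Γ M hC h η ξ).trans (le_of_eq ?_))
  · congr 1
    refine Finset.sum_congr rfl fun m _ => Finset.sum_congr rfl fun n _ => ?_
    rw [fCoeff_sub, fCoeff_fejerMean]
    ring
  · ring

theorem commutatorFormBound_of_commutatorNorm_le {f : C(Torus d, ℂ)} {C : ℝ≥0}
    (h : commutatorNorm (dirac Γ) (mulOp d f) ≤ C) (B : Finset (Fin d → ℤ)) :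
    CommutatorFormBound Γ B f C := by
  intro η ξ
  obtain ⟨hξ, hξ2⟩ := dirac_fourierSum Γ B ξ
  obtain ⟨h1, h2⟩ := commutatorNorm_le_iff.1 h ⟨_, hξ⟩
  rw [hξ2] at h2
  have h3 := inner_fourierSum_dirac Γ B η ⟨_, h1⟩
  rw [← inner_commutator_fourierSum, ← h3, ← inner_sub_right, ← norm_fourierSum, ← norm_fourierSum]
  refine (norm_inner_le_norm _ _).trans ?_
  calc _ ≤ ‖fourierSum B η‖ * (C * ‖fourierSum B ξ‖) := by gcongr
    _ = _ := by ring

theorem norm_mulOp_sub_fejerMean_le {f : C(Torus d, ℂ)} {C : ℝ≥0}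
    (h : commutatorNorm (dirac Γ) (mulOp d f) ≤ C) (M : ℕ) :
    ‖mulOp d f - mulOp d (fejerMean M f)‖ ≤ fejerRate d M * C := by
  rw [← map_sub]
  refine opNorm_le_of_inner_fourierSum (by unfold fejerRate; positivity) fun B η ξ => ?_
  exact (commutatorFormBound_of_commutatorNorm_le Γ h B).norm_inner_sub_fejerMean_le Γ C.2 M η ξ

theorem partialDeriv_sum_torusChar {ι : Type*} (s : Finset ι) (a : ι → ℂ)
    (k : ι → Fin d → ℤ) (μ : Fin d) (x : Torus d) :
    partialDeriv μ (fun x => ∑ i ∈ s, a i * torusChar (k i) x) x =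
      ∑ i ∈ s, a i * (Complex.I * k i μ * torusChar (k i) x) :=
  (HasDerivAt.fun_sum fun i _ => (hasDerivAt_torusChar_shift (k i) μ x).const_mul (a i)).deriv

theorem gradSymbol_fejerMean (M : ℕ) (f : C(Torus d, ℂ)) (x : Torus d) (v : Spinor d) :
    gradSymbol Γ (fejerMean M f) x v = ((freqCube d M).card : ℂ)⁻¹ •
      ∑ p ∈ freqCube d M, ∑ q ∈ freqCube d M,
        (fCoeff f (p - q) * torusChar (p - q) x) • cliffordMul Γ (p - q) v := by
  have h : (fejerMean M f : Torus d → ℂ) = fun x => ∑ i ∈ freqCube d M ×ˢ freqCube d M,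
      (((freqCube d M).card : ℂ)⁻¹ * fCoeff f (i.1 - i.2)) * torusChar (i.1 - i.2) x := by
    ext x
    rw [fejerMean_apply, Finset.mul_sum, Finset.sum_product]
    simp only [Finset.mul_sum, mul_assoc]
  rw [gradSymbol_apply, h]
  simp only [partialDeriv_sum_torusChar]
  rw [← Finset.sum_product', Finset.smul_sum, Finset.smul_sum]
  simp only [Finset.sum_smul, Finset.smul_sum, cliffordMul_apply]
  rw [Finset.sum_comm]
  refine Finset.sum_congr rfl fun i _ => Finset.sum_congr rfl fun μ _ => ?_
  simp only [smul_smul]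
  congr 1
  linear_combination (-((freqCube d M).card : ℂ)⁻¹ * fCoeff f (i.1 - i.2) * (i.1 - i.2) μ *
    torusChar (i.1 - i.2) x) * Complex.I_sq

/-- The symbol of [D, F_M * f] at x is the commutator form of f evaluated on wave packets over the
cube located at x. Only frequencies in the cube enter, so information about the truncation of f
suffices. -/
theorem CommutatorFormBound.commutatorNorm_fejerMean_le {M : ℕ} {f : C(Torus d, ℂ)} {C : ℝ≥0}
    (h : CommutatorFormBound Γ (freqCube d M) f C) :
    commutatorNorm (dirac Γ) (mulOp d (fejerMean M f)) ≤ C := by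
  refine commutatorNorm_mulOp_le Γ ⟨_, isSmooth_fejerMean M f⟩ fun x v => ?_
  set w := gradSymbol Γ (fejerMean M f) x v with hw
  -- Each of these vectors has ℓ² norm √card times that of w or v; the product of the two roots
  -- cancels the normalisation 1/card of the Fejér mean.
  have h1 := h (fun p => torusChar (-p) x • w) (fun q => torusChar (-q) x • v)
  have h2 : inner ℂ w w = ((freqCube d M).card : ℂ)⁻¹ *
      ∑ p ∈ freqCube d M, ∑ q ∈ freqCube d M, fCoeff f (p - q) *
        inner ℂ (torusChar (-p) x • w) (cliffordMul Γ (p - q) (torusChar (-q) x • v)) := by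
    conv_lhs => rw [hw]
    nth_rw 2 [gradSymbol_fejerMean]
    rw [← hw]
    simp only [inner_smul_right, inner_sum, map_smul, inner_smul_left]
    congr 1
    refine Finset.sum_congr rfl fun p _ => Finset.sum_congr rfl fun q _ => ?_
    rw [← torusChar_neg, neg_neg, sub_eq_add_neg p q, torusChar_add]
    ring
  have h3 := congrArg norm h2
  rw [norm_inner_self_eq_sq, norm_mul, norm_inv, Complex.norm_natCast] at h3
  simp only [norm_smul, norm_torusChar_apply, one_mul, Finset.sum_const, nsmul_eq_mul] at h1
  have hc : (0 : ℝ) < (freqCube d M).card := by rw [card_freqCube]; positivity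
  rw [Real.sqrt_mul hc.le, Real.sqrt_mul hc.le, Real.sqrt_sq (norm_nonneg _),
    Real.sqrt_sq (norm_nonneg _)] at h1
  have h4 : ‖w‖ * ‖w‖ ≤ ‖w‖ * (C * ‖v‖) := by
    rw [← sq, h3]
    refine (mul_le_mul_of_nonneg_left h1 (by positivity)).trans (le_of_eq ?_)
    have h5 := Real.mul_self_sqrt hc.le
    field_simp
    linear_combination (‖w‖ * C * ‖v‖) * h5
  rcases (norm_nonneg w).eq_or_lt with h0 | h0
  · change ‖w‖ ≤ _
    rw [← h0]; positivity
  · exact le_of_mul_le_mul_left h4 h0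

end FejerMean

end

section

variable {d : ℕ} (Γ : GammaMatrices d)

/-! ### The truncated space and its commutators -/

section Truncation

open scoped Classical in
variable (d) in
/-- The frequencies of modulus at most `Λ`. -/
def freqBall (Λ : ℝ≥0) : Finset (Fin d → ℤ) :=
  (freqCube d ⌈Λ⌉₊).filter fun n => ((∑ i, n i ^ 2 : ℤ) : ℝ) ≤ Λ ^ 2

theorem mem_freqBall {Λ : ℝ≥0} {n : Fin d → ℤ} :
    n ∈ freqBall d Λ ↔ ((∑ i, n i ^ 2 : ℤ) : ℝ) ≤ Λ ^ 2 := by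
  refine ⟨fun h => (Finset.mem_filter.1 h).2, fun h => Finset.mem_filter.2 ⟨?_, h⟩⟩
  refine Fintype.mem_piFinset.2 fun i => ?_
  have h1 : n i ^ 2 ≤ ∑ i, n i ^ 2 :=
    Finset.single_le_sum (f := fun i => n i ^ 2) (fun i _ => sq_nonneg _) (Finset.mem_univ i)
  have h2 : ((n i : ℝ)) ^ 2 ≤ (⌈Λ⌉₊ : ℝ) ^ 2 := by
    refine le_trans (by exact_mod_cast h1) (h.trans ?_)
    have := Nat.le_ceil Λ
    gcongr
    exact_mod_cast this
  have h3 := abs_le_of_sq_le_sq' h2 (by positivity)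
  rw [Finset.mem_Icc]
  exact ⟨by exact_mod_cast h3.1, by exact_mod_cast h3.2⟩

/-- The bound is |n|² ≤ d (Λ/d)² ≤ Λ²; the side Λ/√d would do as well, but only growth with Λ is
needed. -/
theorem freqCube_subset_freqBall (Λ : ℝ≥0) : freqCube d ⌊Λ / d⌋₊ ⊆ freqBall d Λ := by
  intro n hn
  rw [mem_freqBall]
  rcases d.eq_zero_or_pos with rfl | hd
  · simp
  have h1 : ∀ i, ((n i : ℝ)) ^ 2 ≤ (Λ / d) ^ 2 := by
    intro i
    have h2 := Finset.mem_Icc.1 (Fintype.mem_piFinset.1 hn i)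
    have h3 : |(n i : ℝ)| ≤ (⌊Λ / d⌋₊ : ℝ) := by
      rw [abs_le]; exact ⟨by exact_mod_cast h2.1, by exact_mod_cast h2.2⟩
    have h4 : ((⌊Λ / d⌋₊ : ℝ≥0) : ℝ) ≤ ((Λ / d : ℝ≥0) : ℝ) :=
      NNReal.coe_le_coe.2 (Nat.floor_le zero_le)
    rw [sq_le_sq, abs_of_nonneg (a := (Λ : ℝ) / d) (by positivity)]
    refine h3.trans ?_
    simpa using h4
  have hd1 : (1 : ℝ) ≤ d := by exact_mod_cast hd
  push_cast
  refine (Finset.sum_le_sum fun i _ => h1 i).trans ?_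
  rw [Finset.sum_const, Finset.card_univ, Fintype.card_fin, nsmul_eq_mul, div_pow,
    mul_div_assoc', div_le_iff₀ (by positivity), mul_comm]
  have : (d : ℝ) ≤ (d : ℝ) ^ 2 := by nlinarith
  gcongr

theorem planeWave_mem_truncSpace_of_eigen {Λ : ℝ≥0} {n : Fin d → ℤ} {v : Spinor d} {l : ℝ}
    (hl : |l| ≤ Λ) (h : cliffordMul Γ n v = (l : ℂ) • v) : planeWave n v ∈ truncSpace Γ Λ := by
  refine Submodule.le_topologicalClosure _ (Submodule.subset_span ⟨l, hl, ?_⟩)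
  obtain ⟨h1, h2⟩ := dirac_planeWave Γ n v
  exact ⟨h1, by rw [h2, h, map_smul]⟩

/-- With l = |n| ≠ 0, the spinor v is half the sum of v ± l⁻¹ c(n) v, where c(n) is Clifford
multiplication, and these give eigenvectors for ±l because c(n)² = l². For l = 0 the frequency is 0
and the wave is harmonic. -/
theorem planeWave_mem_truncSpace {Λ : ℝ≥0} {n : Fin d → ℤ} (hn : n ∈ freqBall d Λ)
    (v : Spinor d) : planeWave n v ∈ truncSpace Γ Λ := by
  rw [mem_freqBall] at hn
  set N := ∑ i, n i ^ 2 with hN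
  have hN0 : 0 ≤ N := Finset.sum_nonneg fun i _ => sq_nonneg _
  set l := √(N : ℝ) with hl
  have hl2 : l * l = N := Real.mul_self_sqrt (by exact_mod_cast hN0)
  have hlΛ : |l| ≤ Λ := by
    rw [abs_of_nonneg (Real.sqrt_nonneg _)]
    exact Real.sqrt_le_iff.2 ⟨Λ.2, hn⟩
  rcases eq_or_ne l 0 with h0 | h0
  · have hn0 : n = 0 := by
      rw [h0, mul_zero] at hl2
      have h1 : N = 0 := by exact_mod_cast hl2.symm
      have h2 := (Finset.sum_eq_zero_iff_of_nonneg (fun i _ => sq_nonneg (n i))).1 h1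
      exact funext fun i => by simpa using h2 i (Finset.mem_univ i)
    refine planeWave_mem_truncSpace_of_eigen Γ (l := 0) (by simp) ?_
    simp [hn0, cliffordMul_apply]
  · have hc : (l : ℂ) ≠ 0 := by exact_mod_cast h0
    have hS : cliffordMul Γ n (cliffordMul Γ n v) = ((l : ℂ) * l) • v := by
      rw [cliffordMul_cliffordMul, ← hN]
      congr 1
      exact_mod_cast hl2.symm
    have h1 := planeWave_mem_truncSpace_of_eigen Γ (n := n)
      (v := v + (l : ℂ)⁻¹ • cliffordMul Γ n v) hlΛ (by
        rw [map_add, map_smul, hS, smul_smul, inv_mul_cancel_left₀ hc, smul_add, smul_smul,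
          mul_inv_cancel₀ hc, one_smul, add_comm])
    have h2 := planeWave_mem_truncSpace_of_eigen Γ (n := n) (l := -l)
      (v := v - (l : ℂ)⁻¹ • cliffordMul Γ n v) (by rwa [abs_neg]) (by
        rw [map_sub, map_smul, hS, smul_smul, inv_mul_cancel_left₀ hc, Complex.ofReal_neg,
          neg_smul, smul_sub, smul_smul, mul_inv_cancel₀ hc, one_smul, neg_sub])
    have h3 := (truncSpace Γ Λ).smul_mem (1 / 2 : ℂ) ((truncSpace Γ Λ).add_mem h1 h2)
    rw [← map_add, ← map_smul] at h3
    convert h3 using 2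
    rw [add_add_sub_cancel, ← two_smul ℂ, smul_smul]
    simp

/-- Moving D twice across the inner product, an eigenvector for l satisfies l² ⟨e_n ⊗ w, ψ⟩ = |n|²
⟨e_n ⊗ w, ψ⟩. Hence it has no component at frequencies with |n| > Λ ≥ |l|. -/
theorem inner_planeWave_of_mem_truncSpace {Λ : ℝ≥0} {ψ : SpinorL2 d} (hψ : ψ ∈ truncSpace Γ Λ)
    {n : Fin d → ℤ} (hn : n ∉ freqBall d Λ) (v : Spinor d) : inner ℂ (planeWave n v) ψ = 0 := by
  have h : truncSpace Γ Λ ≤ (LinearMap.range (planeWave n : Spinor d →ₗ[ℂ] SpinorL2 d))ᗮ := by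
    refine Submodule.topologicalClosure_minimal _ (Submodule.span_le.2 ?_)
      (Submodule.isClosed_orthogonal _)
    rintro ψ ⟨l, hl, hψ, hD⟩
    rw [SetLike.mem_coe, Submodule.mem_orthogonal]
    rintro _ ⟨w, rfl⟩
    have h1 : ∀ w, (l : ℂ) * inner ℂ (planeWave n w) ψ =
        inner ℂ (planeWave n (cliffordMul Γ n w)) ψ := by
      intro w
      rw [← inner_smul_right, ← hD]
      exact inner_planeWave_dirac Γ ⟨ψ, hψ⟩ n w
    have h2 : (l : ℂ) * (l * inner ℂ (planeWave n w) ψ) =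
        ((∑ i, n i ^ 2 : ℤ) : ℂ) * inner ℂ (planeWave n w) ψ := by
      rw [h1, h1, cliffordMul_cliffordMul, map_smul, inner_smul_left, map_intCast]
    rw [mem_freqBall, not_le] at hn
    have h3 : l ^ 2 < ((∑ i, n i ^ 2 : ℤ) : ℝ) := by
      refine lt_of_le_of_lt ?_ hn
      rw [← sq_abs]
      gcongr
    have h4 : ((l ^ 2 - ((∑ i, n i ^ 2 : ℤ) : ℝ) : ℝ) : ℂ) * inner ℂ (planeWave n w) ψ = 0 := by
      push_cast
      push_cast at h2
      linear_combination h2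
    refine (mul_eq_zero.1 h4).resolve_left ?_
    rw [Complex.ofReal_eq_zero]
    linarith
  exact (Submodule.mem_orthogonal _ _).1 (h hψ) _ ⟨v, rfl⟩

theorem exists_eq_fourierSum {Λ : ℝ≥0} {ψ : SpinorL2 d} (hψ : ψ ∈ truncSpace Γ Λ) :
    ∃ ξ, ψ = fourierSum (freqBall d Λ) ξ :=
  ⟨_, eq_fourierSum_of_inner_eq_zero _ fun _ hn => inner_planeWave_of_mem_truncSpace Γ hψ hn⟩

theorem fourierSum_mem_truncSpace {Λ : ℝ≥0} {B : Finset (Fin d → ℤ)} (hB : B ⊆ freqBall d Λ)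
    (ξ : (Fin d → ℤ) → Spinor d) : fourierSum B ξ ∈ truncSpace Γ Λ :=
  Submodule.sum_mem _ fun _ hn => planeWave_mem_truncSpace Γ (hB hn) _

instance finiteDimensional_truncSpace (Λ : ℝ≥0) : FiniteDimensional ℂ (truncSpace Γ Λ) := by
  have h : truncSpace Γ Λ ≤ (freqBall d Λ).sup
      fun n => LinearMap.range (planeWave n : Spinor d →ₗ[ℂ] SpinorL2 d) := by
    intro ψ hψ
    obtain ⟨ξ, rfl⟩ := exists_eq_fourierSum Γ hψ
    exact Submodule.sum_mem _ fun n hn => Finset.le_sup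
      (f := fun n => LinearMap.range (planeWave n : Spinor d →ₗ[ℂ] SpinorL2 d)) hn ⟨ξ n, rfl⟩
  exact Submodule.finiteDimensional_of_le h

theorem inner_compress {H : Type*} [NormedAddCommGroup H] [InnerProductSpace ℂ H]
    {K : Submodule ℂ H} [CompleteSpace K] (a : H →L[ℂ] H) (η ξ : K) :
    inner ℂ η (compress K a ξ) = inner ℂ (η : H) (a ξ) := by
  simp [compress]

theorem mem_dirac_domain_of_mem_truncSpace {Λ : ℝ≥0} {ψ : SpinorL2 d} (hψ : ψ ∈ truncSpace Γ Λ) :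
    ψ ∈ (dirac Γ).domain := by
  obtain ⟨ξ, rfl⟩ := exists_eq_fourierSum Γ hψ
  exact (dirac_fourierSum Γ _ ξ).1

theorem inner_compressPMap {Λ : ℝ≥0} (η : (Fin d → ℤ) → Spinor d) {B : Finset (Fin d → ℤ)}
    (hB : B ⊆ freqBall d Λ) (ψ : (compressPMap (dirac Γ) (truncSpace Γ Λ)).domain) :
    inner ℂ (⟨fourierSum B η, fourierSum_mem_truncSpace Γ hB η⟩ : truncSpace Γ Λ)
      (compressPMap (dirac Γ) (truncSpace Γ Λ) ψ) =
    inner ℂ (fourierSum B fun n => cliffordMul Γ n (η n)) ((ψ : truncSpace Γ Λ) : SpinorL2 d) := by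
  rw [← inner_fourierSum_dirac Γ B η ⟨((ψ : truncSpace Γ Λ) : SpinorL2 d), ψ.2⟩]
  exact Submodule.inner_orthogonalProjectionOnto_eq_of_mem_left _ _

theorem coe_compressPMap_fourierSum {Λ : ℝ≥0} (ξ : (Fin d → ℤ) → Spinor d)
    {B : Finset (Fin d → ℤ)} (hB : B ⊆ freqBall d Λ)
    (ψ : (compressPMap (dirac Γ) (truncSpace Γ Λ)).domain)
    (hψ : ((ψ : truncSpace Γ Λ) : SpinorL2 d) = fourierSum B ξ) :
    (compressPMap (dirac Γ) (truncSpace Γ Λ) ψ : SpinorL2 d) =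
      fourierSum B fun n => cliffordMul Γ n (ξ n) := by
  have h1 : dirac Γ ⟨((ψ : truncSpace Γ Λ) : SpinorL2 d), ψ.2⟩ =
      fourierSum B fun n => cliffordMul Γ n (ξ n) := by
    obtain ⟨h2, h3⟩ := dirac_fourierSum Γ B ξ
    rw [← h3]
    congr 1
    exact Subtype.ext hψ
  change ((truncSpace Γ Λ).orthogonalProjectionOnto
    (dirac Γ ⟨((ψ : truncSpace Γ Λ) : SpinorL2 d), ψ.2⟩) : SpinorL2 d) = _
  rw [h1]
  exact Submodule.orthogonalProjectionOnto_mem_subspace_eq_self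
    (⟨_, fourierSum_mem_truncSpace Γ hB _⟩ : truncSpace Γ Λ) ▸ rfl

theorem commutatorFormBound_of_commutatorNorm_compress_le {Λ : ℝ≥0} {f : C(Torus d, ℂ)} {C : ℝ≥0}
    (h : commutatorNorm (compressPMap (dirac Γ) (truncSpace Γ Λ))
      (compress (truncSpace Γ Λ) (mulOp d f)) ≤ C) {B : Finset (Fin d → ℤ)}
    (hB : B ⊆ freqBall d Λ) : CommutatorFormBound Γ B f C := by
  intro η ξ
  let ψ : truncSpace Γ Λ := ⟨fourierSum B ξ, fourierSum_mem_truncSpace Γ hB ξ⟩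
  let χ : truncSpace Γ Λ := ⟨fourierSum B η, fourierSum_mem_truncSpace Γ hB η⟩
  have hψ : ψ ∈ (compressPMap (dirac Γ) (truncSpace Γ Λ)).domain := (dirac_fourierSum Γ B ξ).1
  obtain ⟨h1, h2⟩ := commutatorNorm_le_iff.1 h ⟨ψ, hψ⟩
  have h3 : inner ℂ χ (compressPMap (dirac Γ) (truncSpace Γ Λ)
      ⟨compress (truncSpace Γ Λ) (mulOp d f) ψ, h1⟩) =
      inner ℂ (fourierSum B fun n => cliffordMul Γ n (η n)) (mulOp d f (fourierSum B ξ)) := by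
    refine (inner_compressPMap Γ η hB _).trans ?_
    exact inner_compress (mulOp d f) (⟨_, fourierSum_mem_truncSpace Γ hB _⟩ : truncSpace Γ Λ) ψ
  have h4 : inner ℂ χ (compress (truncSpace Γ Λ) (mulOp d f)
      (compressPMap (dirac Γ) (truncSpace Γ Λ) ⟨ψ, hψ⟩)) =
      inner ℂ (fourierSum B η) (mulOp d f (fourierSum B fun n => cliffordMul Γ n (ξ n))) := by
    rw [inner_compress, coe_compressPMap_fourierSum Γ ξ hB ⟨ψ, hψ⟩ rfl]
  rw [← inner_commutator_fourierSum, ← h3, ← h4, ← inner_sub_right, ← norm_fourierSum,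
    ← norm_fourierSum]
  refine (norm_inner_le_norm _ _).trans ?_
  calc _ ≤ ‖χ‖ * (C * ‖ψ‖) := by gcongr
    _ = _ := by simp only [χ, ψ, Submodule.coe_norm]; ring

/-- Since P_Λ commutes with D, the truncated commutator [D_Λ, P f P] equals P [D, f] P, and P is a
contraction. -/
theorem commutatorNorm_compress_le {Λ : ℝ≥0} {f : C(Torus d, ℂ)} {C : ℝ≥0}
    (h : commutatorNorm (dirac Γ) (mulOp d f) ≤ C) :
    commutatorNorm (compressPMap (dirac Γ) (truncSpace Γ Λ))
      (compress (truncSpace Γ Λ) (mulOp d f)) ≤ C := by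
  refine commutatorNorm_le_iff.2 fun ψ => ?_
  obtain ⟨h1, h2⟩ := commutatorNorm_le_iff.1 h ⟨((ψ : truncSpace Γ Λ) : SpinorL2 d), ψ.2⟩
  have h0 : compress (truncSpace Γ Λ) (mulOp d f) ψ ∈
      (compressPMap (dirac Γ) (truncSpace Γ Λ)).domain :=
    mem_dirac_domain_of_mem_truncSpace Γ (Subtype.property _)
  refine ⟨h0, ?_⟩
  have h3 : compressPMap (dirac Γ) (truncSpace Γ Λ) ⟨_, h0⟩ -
      compress (truncSpace Γ Λ) (mulOp d f) (compressPMap (dirac Γ) (truncSpace Γ Λ) ψ) =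
      (truncSpace Γ Λ).orthogonalProjectionOnto (dirac Γ ⟨_, h1⟩ -
        mulOp d f (dirac Γ ⟨((ψ : truncSpace Γ Λ) : SpinorL2 d), ψ.2⟩)) := by
    -- Tested against trigonometric spinors, D moves to the left argument, whose frequencies stay in
    -- the ball; there the projection is invisible.
    refine ext_inner_left ℂ fun χ => ?_
    obtain ⟨η, hη⟩ := exists_eq_fourierSum Γ χ.2
    obtain ⟨ξ, hξ⟩ := exists_eq_fourierSum Γ (ψ : truncSpace Γ Λ).2
    have hχ : χ = ⟨fourierSum (freqBall d Λ) η,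
      fourierSum_mem_truncSpace Γ (Finset.Subset.refl _) η⟩ := Subtype.ext hη
    have h4 := coe_compressPMap_fourierSum Γ ξ (Finset.Subset.refl _) ψ hξ
    have h5 : dirac Γ ⟨((ψ : truncSpace Γ Λ) : SpinorL2 d), ψ.2⟩ =
        fourierSum (freqBall d Λ) fun n => cliffordMul Γ n (ξ n) := by
      obtain ⟨h2, h3⟩ := dirac_fourierSum Γ (freqBall d Λ) ξ
      rw [← h3]
      congr 1
      exact Subtype.ext hξ
    have h6 := inner_compressPMap Γ η (Finset.Subset.refl _) ⟨_, h0⟩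
    have h7 := inner_fourierSum_dirac Γ (freqBall d Λ) η ⟨_, h1⟩
    have h8 := inner_compress (mulOp d f) (⟨fourierSum (freqBall d Λ)
      fun n => cliffordMul Γ n (η n), fourierSum_mem_truncSpace Γ (Finset.Subset.refl _) _⟩ :
      truncSpace Γ Λ) (ψ : truncSpace Γ Λ)
    rw [map_sub, inner_sub_right, inner_sub_right, inner_compress, h4, h5, hχ]
    congr 1
    · refine h6.trans (h8.trans (h7.symm.trans ?_))
      exact (Submodule.inner_orthogonalProjectionOnto_eq_of_mem_left
        (⟨_, fourierSum_mem_truncSpace Γ (Finset.Subset.refl _) η⟩ : truncSpace Γ Λ) _).symm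
    · exact (Submodule.inner_orthogonalProjectionOnto_eq_of_mem_left
        (⟨_, fourierSum_mem_truncSpace Γ (Finset.Subset.refl _) η⟩ : truncSpace Γ Λ) _).symm
  rw [h3]
  exact ((truncSpace Γ Λ).norm_orthogonalProjectionOnto_apply_le _).trans h2

end Truncation

end

section

variable {d : ℕ} (Γ : GammaMatrices d)

/-! ### Compression and lower symbol -/

section Maps

theorem continuous_compress {H : Type*} [NormedAddCommGroup H] [InnerProductSpace ℂ H]
    (K : Submodule ℂ H) [CompleteSpace K] : Continuous (compress K) :=
  continuous_const.clm_comp (continuous_id.clm_comp continuous_const)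

/-- The truncated system is defined from smooth functions only, but it is finite-dimensional, hence
closed, and smooth functions are uniformly dense. -/
theorem compress_mulOp_mem (Λ : ℝ≥0) (f : C(Torus d, ℂ)) :
    compress (truncSpace Γ Λ) (mulOp d f) ∈ (truncSystem Γ Λ).toSubmodule := by
  have hcl : IsClosed ((truncSystem Γ Λ).toSubmodule : Set (truncSpace Γ Λ →L[ℂ] truncSpace Γ Λ)) :=
    Submodule.closed_of_finiteDimensional _
  refine closure_minimal (s := (smoothFunctions d ℂ : Set C(Torus d, ℂ)))
    (t := (fun f => compress (truncSpace Γ Λ) (mulOp d f)) ⁻¹' (truncSystem Γ Λ).toSubmodule) ?_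
    (hcl.preimage ((continuous_compress _).comp continuous_mulOp)) (dense_smoothFunctions f)
  intro f hf
  exact ⟨mulOp d f, ⟨f, hf, rfl⟩, rfl⟩

/-- The compression `a ↦ P_Λ a P_Λ` from `C(𝕋^d)` to the truncated operator system. -/
def compressMap (Λ : ℝ≥0) :
    (continuousSystem d).toSubmodule →ₗ[ℂ] (truncSystem Γ Λ).toSubmodule :=
  LinearMap.codRestrict _ (compress (truncSpace Γ Λ) ∘ₗ (continuousSystem d).toSubmodule.subtype) (by
    rintro ⟨_, f, rfl⟩
    exact compress_mulOp_mem Γ Λ f)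

theorem isLipschitzMap_compressMap (Λ : ℝ≥0) :
    IsLipschitzMap (dirac Γ) (smoothSystem d).toSubmodule
      (compressPMap (dirac Γ) (truncSpace Γ Λ)) (truncSystem Γ Λ).toSubmodule
      (compressMap Γ Λ) where
  map_unit := Subtype.ext (compress_one _)
  map_nonneg a ha := ha.orthogonalProjectionOnto_comp _
  map_mem a _ := Subtype.property _
  commutatorNorm_le := by
    rintro ⟨_, _⟩ ⟨f, -, rfl⟩ C h
    exact commutatorNorm_compress_le Γ h

variable {Λ : ℝ≥0} {M : ℕ} (hM : freqCube d M ⊆ freqBall d Λ)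

/-- The wave packet with frequencies in the cube, concentrated at the point `-x`. -/
def wavePacket (M : ℕ) (x : Torus d) : SpinorL2 d :=
  fourierSum (freqCube d M) fun p =>
    ((√((freqCube d M).card : ℝ) : ℂ)⁻¹ * torusChar (-p) x) • EuclideanSpace.single 0 1

theorem continuous_wavePacket (M : ℕ) : Continuous (wavePacket (d := d) M) := by
  unfold wavePacket fourierSum; fun_prop

theorem norm_wavePacket (M : ℕ) (x : Torus d) : ‖wavePacket M x‖ = 1 := by
  have hc : (0 : ℝ) < (freqCube d M).card := by rw [card_freqCube]; positivity
  rw [wavePacket, norm_fourierSum]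
  simp only [norm_smul, norm_mul, norm_torusChar_apply, norm_inv, Complex.norm_real,
    Real.norm_eq_abs, abs_of_nonneg (Real.sqrt_nonneg _), mul_one, PiLp.norm_single, norm_one,
    Finset.sum_const, nsmul_eq_mul, inv_pow, Real.sq_sqrt hc.le]
  rw [mul_inv_cancel₀ hc.ne', Real.sqrt_one]

theorem inner_wavePacket_mulOp (f : C(Torus d, ℂ)) (M : ℕ) (x : Torus d) :
    inner ℂ (wavePacket M x) (mulOp d f (wavePacket M x)) = fejerMean M f x := by
  have hc : (0 : ℝ) < (freqCube d M).card := by rw [card_freqCube]; positivity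
  rw [wavePacket, inner_fourierSum_mulOp_fourierSum, fejerMean_apply]
  simp only [Finset.mul_sum]
  refine Finset.sum_congr rfl fun p _ => Finset.sum_congr rfl fun q _ => ?_
  have h1 : inner ℂ (EuclideanSpace.single 0 1 : Spinor d) (EuclideanSpace.single 0 1) = 1 := by
    simp
  have h2 : ((√((freqCube d M).card : ℝ) : ℂ)⁻¹) * (√((freqCube d M).card : ℝ) : ℂ)⁻¹ =
      ((freqCube d M).card : ℂ)⁻¹ := by
    rw [← mul_inv, ← Complex.ofReal_mul, Real.mul_self_sqrt hc.le]; simp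
  rw [inner_smul_left, inner_smul_right, h1, map_mul, map_inv₀, Complex.conj_ofReal,
    ← torusChar_neg, neg_neg, sub_eq_add_neg, torusChar_add, ← h2]
  ring

/-- The wave packet as an element of the truncated space. -/
def truncWavePacket (x : Torus d) : truncSpace Γ Λ :=
  ⟨wavePacket M x, fourierSum_mem_truncSpace Γ hM _⟩

/-- The lower symbol of an operator on the truncated space. -/
def lowerSymbol : (truncSpace Γ Λ →L[ℂ] truncSpace Γ Λ) →ₗ[ℂ] C(Torus d, ℂ) where
  toFun T := ⟨fun x => inner ℂ (truncWavePacket Γ hM x) (T (truncWavePacket Γ hM x)), by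
    have : Continuous (truncWavePacket Γ hM) := (continuous_wavePacket M).subtype_mk _
    fun_prop⟩
  map_add' S T := by ext x; simp
  map_smul' c T := by ext x; simp

theorem lowerSymbol_apply (T : truncSpace Γ Λ →L[ℂ] truncSpace Γ Λ) (x : Torus d) :
    lowerSymbol Γ hM T x = inner ℂ (truncWavePacket Γ hM x) (T (truncWavePacket Γ hM x)) := rfl

/-- This identifies the composite of the two maps with Fejér convolution, and shows that the Fejér
mean depends on f only through its compression. -/
theorem lowerSymbol_compress (f : C(Torus d, ℂ)) :
    lowerSymbol Γ hM (compress (truncSpace Γ Λ) (mulOp d f)) = fejerMean M f := by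
  ext x
  rw [lowerSymbol_apply, inner_compress]
  exact inner_wavePacket_mulOp f M x

theorem norm_truncWavePacket (x : Torus d) : ‖truncWavePacket Γ hM x‖ = 1 := norm_wavePacket M x

/-- The positive map from the truncated operator system to `C(𝕋^d)` given by the lower symbol. -/
def symbolMap : (truncSystem Γ Λ).toSubmodule →ₗ[ℂ] (continuousSystem d).toSubmodule :=
  LinearMap.codRestrict _ (mulOp d ∘ₗ lowerSymbol Γ hM ∘ₗ (truncSystem Γ Λ).toSubmodule.subtype)
    fun _ => ⟨_, rfl⟩

theorem symbolMap_unit : symbolMap Γ hM (truncSystem Γ Λ).unit = (continuousSystem d).unit := by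
  refine Subtype.ext ?_
  change mulOp d (lowerSymbol Γ hM 1) = 1
  rw [← mulOp_one]
  congr 1
  ext x
  rw [lowerSymbol_apply, one_apply_eq_self, inner_self_eq_norm_sq_to_K, norm_truncWavePacket]
  simp

theorem norm_symbolMap_le (b : (truncSystem Γ Λ).toSubmodule) :
    ‖(symbolMap Γ hM b : SpinorL2 d →L[ℂ] SpinorL2 d)‖ ≤
      ‖(b : truncSpace Γ Λ →L[ℂ] truncSpace Γ Λ)‖ := by
  refine norm_mulOp_le _ (norm_nonneg _) fun x => ?_
  have h1 := norm_inner_le_norm (𝕜 := ℂ) (truncWavePacket Γ hM x)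
    ((b : truncSpace Γ Λ →L[ℂ] truncSpace Γ Λ) (truncWavePacket Γ hM x))
  have h2 := (b : truncSpace Γ Λ →L[ℂ] truncSpace Γ Λ).le_opNorm (truncWavePacket Γ hM x)
  rw [norm_truncWavePacket, one_mul] at h1
  rw [norm_truncWavePacket, mul_one] at h2
  exact h1.trans h2

theorem isLipschitzMap_symbolMap :
    IsLipschitzMap (compressPMap (dirac Γ) (truncSpace Γ Λ)) (truncSystem Γ Λ).toSubmodule
      (dirac Γ) (smoothSystem d).toSubmodule (symbolMap Γ hM) where
  map_unit := symbolMap_unit Γ hM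
  map_nonneg b hb := isPositive_mulOp _ fun x => by
    have h := hb.inner_nonneg_right (truncWavePacket Γ hM x)
    rw [Complex.le_def] at h
    exact ⟨h.1, h.2.symm⟩
  map_mem := by
    rintro ⟨_, _⟩ ⟨_, ⟨f, -, rfl⟩, rfl⟩
    exact ⟨fejerMean M f, isSmooth_fejerMean M f,
      congrArg (mulOp d) (lowerSymbol_compress Γ hM f).symm⟩
  commutatorNorm_le := by
    rintro ⟨_, _⟩ ⟨_, ⟨f, -, rfl⟩, rfl⟩ C h
    have h1 := (commutatorFormBound_of_commutatorNorm_compress_le Γ h hM).commutatorNorm_fejerMean_le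
    change commutatorNorm (dirac Γ)
      (mulOp d (lowerSymbol Γ hM (compress (truncSpace Γ Λ) (mulOp d f)))) ≤ C
    rwa [lowerSymbol_compress]

theorem norm_sub_symbolMap_compressMap_le (a : (continuousSystem d).toSubmodule)
    (ha : (a : SpinorL2 d →L[ℂ] SpinorL2 d) ∈ (smoothSystem d).toSubmodule)
    (h : commutatorNorm (dirac Γ) (a : SpinorL2 d →L[ℂ] SpinorL2 d) ≤ 1) :
    ‖(a : SpinorL2 d →L[ℂ] SpinorL2 d) -
      (symbolMap Γ hM (compressMap Γ Λ a) : SpinorL2 d →L[ℂ] SpinorL2 d)‖ ≤ fejerRate d M := by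
  obtain ⟨_, _⟩ := a
  obtain ⟨f, -, rfl⟩ := ha
  change ‖mulOp d f - mulOp d (lowerSymbol Γ hM (compress (truncSpace Γ Λ) (mulOp d f)))‖ ≤ _
  rw [lowerSymbol_compress]
  simpa using norm_mulOp_sub_fejerMean_le Γ (C := 1) (by simpa using h) M

/-- No relation between M and Λ is required, because the estimate lives on the whole frequency ball;
this permits M = 0 below. -/
theorem norm_compress_sub_fejerMean_le {f : C(Torus d, ℂ)} {C : ℝ≥0}
    (h : commutatorNorm (compressPMap (dirac Γ) (truncSpace Γ Λ))
      (compress (truncSpace Γ Λ) (mulOp d f)) ≤ C) (M : ℕ) :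
    ‖compress (truncSpace Γ Λ) (mulOp d f) -
      compress (truncSpace Γ Λ) (mulOp d (fejerMean M f))‖ ≤ fejerRate d M * C := by
  have h1 := commutatorFormBound_of_commutatorNorm_compress_le Γ h (Finset.Subset.refl _)
  rw [← map_sub, ← map_sub]
  refine opNorm_le_of_inner (by unfold fejerRate; positivity) fun η ξ => ?_
  rw [inner_compress, Submodule.coe_norm, Submodule.coe_norm]
  obtain ⟨η', hη⟩ := exists_eq_fourierSum Γ η.2
  obtain ⟨ξ', hξ⟩ := exists_eq_fourierSum Γ ξ.2
  rw [hη, hξ]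
  exact h1.norm_inner_sub_fejerMean_le Γ C.2 M η' ξ'

theorem norm_sub_compressMap_symbolMap_le (b : (truncSystem Γ Λ).toSubmodule)
    (h : commutatorNorm (compressPMap (dirac Γ) (truncSpace Γ Λ))
      (b : truncSpace Γ Λ →L[ℂ] truncSpace Γ Λ) ≤ 1) :
    ‖(b : truncSpace Γ Λ →L[ℂ] truncSpace Γ Λ) -
      (compressMap Γ Λ (symbolMap Γ hM b) : truncSpace Γ Λ →L[ℂ] truncSpace Γ Λ)‖ ≤
        fejerRate d M := by
  obtain ⟨b, hb⟩ := b
  change commutatorNorm (compressPMap (dirac Γ) (truncSpace Γ Λ)) b ≤ 1 at h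
  obtain ⟨_, ⟨f, -, rfl⟩, rfl⟩ := id hb
  change ‖compress (truncSpace Γ Λ) (mulOp d f) - compress (truncSpace Γ Λ)
    (mulOp d (lowerSymbol Γ hM (compress (truncSpace Γ Λ) (mulOp d f))))‖ ≤ _
  rw [lowerSymbol_compress]
  simpa using norm_compress_sub_fejerMean_le Γ (C := 1) (by simpa using h) M

end Maps

/-! ### Compactness of the state spaces and convergence -/

section Convergence

theorem fejerMean_zero (f : C(Torus d, ℂ)) : fejerMean 0 f = fCoeff f 0 • 1 := by
  have h : freqCube d 0 = {0} := by
    ext n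
    simp only [freqCube, Fintype.mem_piFinset, Nat.cast_zero, neg_zero, Finset.Icc_self,
      Finset.mem_singleton, funext_iff, Pi.zero_apply]
  simp [fejerMean, h, torusChar_zero]

theorem commutatorNorm_ne_top_of_mem_truncSystem {Λ : ℝ≥0}
    {a : truncSpace Γ Λ →L[ℂ] truncSpace Γ Λ} (ha : a ∈ (truncSystem Γ Λ).toSubmodule) :
    commutatorNorm (compressPMap (dirac Γ) (truncSpace Γ Λ)) a ≠ ⊤ := by
  obtain ⟨_, ⟨f, hf, rfl⟩, rfl⟩ := ha
  obtain ⟨C, hC⟩ := WithTop.ne_top_iff_exists.1 (commutatorNorm_mulOp_ne_top Γ ⟨f, hf⟩)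
  exact ne_top_of_le_ne_top ENNReal.coe_ne_top (commutatorNorm_compress_le Γ hC.symm.le)

/-- A Poincaré inequality: for M = 0 the Fejér mean is the average of f, so the approximation
estimate measures the distance to scalars. -/
theorem exists_norm_sub_smul_one_le {Λ : ℝ≥0} {a : truncSpace Γ Λ →L[ℂ] truncSpace Γ Λ}
    (ha : a ∈ (truncSystem Γ Λ).toSubmodule)
    (h : commutatorNorm (compressPMap (dirac Γ) (truncSpace Γ Λ)) a ≤ 1) :
    ∃ c : ℂ, ‖a - c • (1 : truncSpace Γ Λ →L[ℂ] truncSpace Γ Λ)‖ ≤ fejerRate d 0 := by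
  obtain ⟨_, ⟨f, -, rfl⟩, rfl⟩ := ha
  have h1 := norm_compress_sub_fejerMean_le Γ (C := 1) (by simpa using h) 0
  rw [fejerMean_zero, map_smul, map_smul, mulOp_one, compress_one, NNReal.coe_one, mul_one] at h1
  exact ⟨_, h1⟩

theorem isLipschitzSubspace_of_finiteDimensional {H : Type*} [NormedAddCommGroup H]
    [InnerProductSpace ℂ H] [CompleteSpace H] [FiniteDimensional ℂ H] {D : H →ₗ.[ℂ] H}
    {E : OperatorSystem H} {R : ℝ} (h1 : ∀ a ∈ E.toSubmodule, commutatorNorm D a ≠ ⊤)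
    (h2 : ∀ a ∈ E.toSubmodule, commutatorNorm D a ≤ 1 → ∃ c : ℂ, ‖a - c • (1 : H →L[ℂ] H)‖ ≤ R) :
    IsLipschitzSubspace D E E.toSubmodule where
  le := le_rfl
  dense := subset_closure
  commutatorNorm_ne_top := h1
  totallyBounded := by
    intro ε hε
    have hK : IsCompact (Metric.closedBall (0 : E.toSubmodule) R) := by
      have := FiniteDimensional.proper ℂ E.toSubmodule
      exact isCompact_closedBall _ _
    obtain ⟨F, -, hF, hF2⟩ := hK.finite_cover_balls hε
    refine ⟨F, hF, fun a ha h => ?_⟩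
    obtain ⟨c, hc⟩ := h2 a ha h
    let b : E.toSubmodule := ⟨a, ha⟩ - c • E.unit
    have hb : b ∈ Metric.closedBall (0 : E.toSubmodule) R := by
      rw [mem_closedBall_zero_iff]; exact hc
    obtain ⟨b', hb', hbb⟩ := Set.mem_iUnion₂.1 (hF2 hb)
    rw [mem_ball_iff_norm] at hbb
    exact ⟨c, b', hb', hbb.le⟩

theorem isLipschitzSubspace_truncSystem (Λ : ℝ≥0) :
    IsLipschitzSubspace (compressPMap (dirac Γ) (truncSpace Γ Λ)) (truncSystem Γ Λ)
      (truncSystem Γ Λ).toSubmodule :=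
  isLipschitzSubspace_of_finiteDimensional
    (fun _ => commutatorNorm_ne_top_of_mem_truncSystem Γ)
    (fun _ => exists_norm_sub_smul_one_le Γ)

theorem isLipschitzSubspace_continuousSystem (hd : 1 ≤ d) :
    IsLipschitzSubspace (dirac Γ) (continuousSystem d) (smoothSystem d).toSubmodule where
  le := by
    rintro _ ⟨f, -, rfl⟩
    exact ⟨f, rfl⟩
  dense := by
    rintro _ ⟨f, rfl⟩
    exact image_closure_subset_closure_image continuous_mulOp ⟨f, dense_smoothFunctions f, rfl⟩
  commutatorNorm_ne_top := by
    rintro _ ⟨f, hf, rfl⟩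
    exact commutatorNorm_mulOp_ne_top Γ ⟨f, hf⟩
  totallyBounded := by
    intro ε hε
    obtain ⟨M, hM⟩ := ((tendsto_fejerRate d).eventually (gt_mem_nhds (half_pos hε))).exists
    -- The cut-off Λ = M d makes ⌊Λ/d⌋ equal to M, so the chosen cube fits into the ball.
    have hsub : freqCube d M ⊆ freqBall d (M * d) := by
      have h := freqCube_subset_freqBall (d := d) (M * d)
      have h0 : (d : ℝ≥0) ≠ 0 := by exact_mod_cast (by omega : d ≠ 0)
      rwa [mul_div_cancel_right₀ _ h0, Nat.floor_natCast] at h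
    obtain ⟨F, hF, hF2⟩ := (isLipschitzSubspace_truncSystem Γ (M * d)).totallyBounded_of_approx
      (D₁ := dirac Γ) (E₁ := continuousSystem d) (𝓔₁ := (smoothSystem d).toSubmodule)
      (r := compressMap Γ (M * d)) (s := symbolMap Γ hsub) (by
        rintro _ ⟨f, -, rfl⟩
        exact ⟨f, rfl⟩) (isLipschitzMap_compressMap Γ _) (symbolMap_unit Γ hsub)
      (norm_symbolMap_le Γ hsub) (half_pos hε)
      fun a ha h => (norm_sub_symbolMap_compressMap_le Γ hsub a ha h).trans hM.le
    refine ⟨F, hF, fun a ha h => ?_⟩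
    obtain ⟨c, b, hb, hab⟩ := hF2 a ha h
    exact ⟨c, b, hb, hab.trans (by linarith)⟩

instance nontrivial_truncSpace (Λ : ℝ≥0) : Nontrivial (truncSpace Γ Λ) := by
  refine ⟨⟨truncWavePacket Γ (freqCube_subset_freqBall Λ) 0, 0, fun h => ?_⟩⟩
  have h1 := norm_truncWavePacket Γ (freqCube_subset_freqBall Λ) 0
  rw [h, norm_zero] at h1
  exact zero_ne_one h1

theorem gHConverges_truncation (hd : 1 ≤ d) :
    GHConverges (atTop : Filter ℝ≥0) (fun Λ => State (truncSystem Γ Λ)) (fun Λ => truncDist Γ Λ)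
      (State (continuousSystem d)) (torusDist Γ) := by
  have : Nontrivial (SpinorL2 d) := by
    refine ⟨⟨wavePacket 0 0, 0, fun h => ?_⟩⟩
    have h1 := norm_wavePacket (d := d) 0 0
    rw [h, norm_zero] at h1
    exact zero_ne_one h1
  choose p hp using fun Λ => (isLipschitzSubspace_truncSystem Γ Λ).exists_represents
  obtain ⟨q, hq⟩ := (isLipschitzSubspace_continuousSystem Γ hd).exists_represents
  refine ⟨p, q, hp, hq, ?_⟩
  rw [tendsto_iff_dist_tendsto_zero]
  -- The cube inside the ball of radius Λ has M = ⌊Λ/d⌋, which grows without bound because d ≥ 1.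
  have hfloor : Tendsto (fun Λ : ℝ≥0 => ⌊Λ / d⌋₊) atTop atTop :=
    tendsto_nat_floor_atTop.comp (tendsto_id.atTop_div_const (by exact_mod_cast hd))
  have hlim : Tendsto (fun Λ : ℝ≥0 => 4 * fejerRate d ⌊Λ / d⌋₊) atTop (𝓝 0) := by
    simpa using ((tendsto_fejerRate d).comp hfloor).const_mul 4
  refine squeeze_zero (fun _ => dist_nonneg) (fun Λ => ?_) hlim
  have hM := freqCube_subset_freqBall (d := d) Λ
  exact dist_le_of_isLipschitzMap (ε := ⟨_, (fejerRate_pos hd ⌊Λ / d⌋₊).le⟩)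
    (isLipschitzSubspace_continuousSystem Γ hd) (isLipschitzSubspace_truncSystem Γ Λ) (hp Λ) hq
    (isLipschitzMap_compressMap Γ Λ) (isLipschitzMap_symbolMap Γ hM)
    (norm_sub_symbolMap_compressMap_le Γ hM)
    (fun b _ h => norm_sub_compressMap_symbolMap_le Γ hM b h)

end Convergence

end

end SpectralTruncation

end

theorem mainTheorem1 (d : ℕ) (hd : 1 ≤ d) (Γ : SpectralTruncation.GammaMatrices d) :
    SpectralTruncation.GHConverges (Filter.atTop : Filter NNReal)
      (fun Λ => SpectralTruncation.State (SpectralTruncation.truncSystem Γ Λ))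
      (fun Λ => SpectralTruncation.truncDist Γ Λ)
      (SpectralTruncation.State (SpectralTruncation.continuousSystem d))
      (SpectralTruncation.torusDist Γ) :=
  SpectralTruncation.gHConverges_truncation Γ hd
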